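/- An oriented link is an isotopy class of non-empty oriented tame links in $\mathbb{R}^3$ (equivalently, in $S^3$). The Conway polynomial $\nabla(K)\in\mathbb{Z}[z]$ of an oriented link $K$ is the isotopy invariant determined by $\nabla(\text{unknot})=1$ and the skein relation $\nabla(K_+)-\nabla(K_-)=z\,\nabla(K_0)$, where $K_+$, $K_-$, $K_0$ are oriented links that differ only inside a ball, in which they are, respectively, a positive crossing, a negative crossing and its oriented smoothing. The degree of $K$ is the degree of the polynomial $\nabla(K)$ (the zero polynomial does not have a degree in $\{0,1,2,\dots\}$). A braid word on $n\ge 1$ strands is a finite word in the letters $\sigma_1^{\pm1},\dots,\sigma_{n-1}^{\pm1}$, where $\sigma_i$ is the braid in which the $i$-th strand passes under the $(i+1)$-st strand. It is homogeneous if, for each $i\in\{1,\dots,n-1\}$, the letter $\sigma_i$ appears in the word if and only if the letter $\sigma_i^{-1}$ does not. A link is homogeneous if it is the closure of a homogeneous braid word on some number $n\ge 1$ of strands. **Theorem.** For each integer $k\ge 0$ there are only finitely many homogeneous links of degree $k$. -/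

import Mathlib

open Polynomial

noncomputable section

namespace PLLink

/-- Euclidean three-space with its coordinates (only its affine structure is used). -/
abbrev Space : Type := Fin 3 → ℝ

/-- The union of the straight segments belonging to a set of directed edges. -/
def support (S : Set (Space × Space)) : Set Space :=
  ⋃ e ∈ S, segment ℝ e.1 e.2

/-- An oriented polygonal link in three-space: a non-empty finite set of directed straight edges
`(p, q)` (from `p` to `q`), such that every edge is followed by exactly one edge and preceded by
exactly one edge, and two different edges meet at most in common endpoints. It is thus a disjoint
union of finitely many (at least one) oriented simple closed polygons. -/
structure PolyLink where
  edges : Set (Space × Space)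
  finite : edges.Finite
  nonempty : edges.Nonempty
  proper : ∀ e ∈ edges, e.1 ≠ e.2
  next : ∀ e ∈ edges, ∃! f, f ∈ edges ∧ f.1 = e.2
  prev : ∀ e ∈ edges, ∃! f, f ∈ edges ∧ f.2 = e.1
  disjoint : ∀ e ∈ edges, ∀ f ∈ edges, e ≠ f →
    segment ℝ e.1 e.2 ∩ segment ℝ f.1 f.2 ⊆ ({e.1, e.2} : Set Space) ∩ {f.1, f.2}

/-- A triangle move: the edge from `a` to `b` is replaced by the two edges from `a` to `c` and from
`c` to `b`, where the (possibly degenerate) triangle `abc` meets the link only in the edge `ab`. -/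
def TriangleMove (K L : PolyLink) : Prop :=
  ∃ a b c : Space, (a, b) ∈ K.edges ∧
    convexHull ℝ {a, b, c} ∩ support K.edges = segment ℝ a b ∧
    L.edges = (K.edges \ {(a, b)}) ∪ {(a, c), (c, b)}

/-- Oriented links up to isotopy: polygonal links modulo the equivalence relation generated by the
triangle moves (`Quot` is the quotient by the generated equivalence relation). -/
def Link : Type := Quot TriangleMove

/-- The isotopy class of a polygonal link. -/
def PolyLink.toLink (K : PolyLink) : Link := Quot.mk TriangleMove K

/-- An oriented triangle, the standard representative of the unknot. -/
def PolyLink.IsTriangle (K : PolyLink) : Prop :=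
  ∃ a b c : Space, K.edges = {(a, b), (b, c), (c, a)}

/-- `(Kp, Kn, K0)` is a skein triple: the three links share the edges `R`, which stay outside an
octahedron with corners `a, b, c, d, o + h, o - h` except at `a, b, c, d`; here `ab` and `cd` are
the diagonals of a plane convex quadrilateral, crossing at `o`. Looking at the octahedron from the
side of `o + h`, inside it
* `Kp` runs from `a` to `b` above the straight strand from `c` to `d` (a positive crossing),
* `Kn` runs from `a` to `b` below the straight strand from `c` to `d` (a negative crossing),
* `K0` is the oriented smoothing, running from `a` to `d` and from `c` to `b`. -/
def SkeinTriple (Kp Kn K0 : PolyLink) : Prop :=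
  ∃ (R : Set (Space × Space)) (a b c d o h : Space),
    o ∈ openSegment ℝ a b ∧ o ∈ openSegment ℝ c d ∧
    0 < (Matrix.of ![b - a, d - c, h]).det ∧
    convexHull ℝ {a, b, c, d, o + h, o - h} ∩ support R ⊆ {a, b, c, d} ∧
    Kp.edges = R ∪ {(a, o + h), (o + h, b), (c, d)} ∧
    Kn.edges = R ∪ {(a, o - h), (o - h, b), (c, d)} ∧
    K0.edges = R ∪ {(a, d), (c, b)}

/-- The two properties that characterise the Conway polynomial among the maps that assign an
integer polynomial in one variable `z` (here `X`) to every isotopy class of oriented links. -/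
structure IsConwayPolynomial (nabla : Link → ℤ[X]) : Prop where
  unknot : ∀ K : PolyLink, K.IsTriangle → nabla K.toLink = 1
  skein : ∀ Kp Kn K0 : PolyLink, SkeinTriple Kp Kn K0 →
    nabla Kp.toLink - nabla Kn.toLink = X * nabla K0.toLink

open Classical in
/-- The Conway polynomial: the link invariant determined by the skein relation and its value on the
unknot. -/
def conway : Link → ℤ[X] :=
  if h : ∃ nabla : Link → ℤ[X], IsConwayPolynomial nabla then h.choose else 0

/-- Braid words on `N + 1` strands. The strands and the generators are numbered from zero; the
letter `(i, true)` is the generator `σ_i` and the letter `(i, false)` is its inverse. -/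
abbrev BraidWord (N : ℕ) : Type := List (Fin N × Bool)

/-- A braid word is homogeneous if each generator appears in it if and only if the inverse of that
generator does not. -/
def BraidWord.Homogeneous {N : ℕ} (w : BraidWord N) : Prop :=
  ∀ i : Fin N, (i, true) ∈ w ↔ (i, false) ∉ w

/-! ### The closure of a braid word

The braid runs downwards (in the direction of decreasing second coordinate), its strands are
numbered from left to right (first coordinate), and it is seen from the positive side of the third
coordinate. -/

/-- The permutation of strand positions effected by a letter. -/
def letterPerm {N : ℕ} (g : Fin N × Bool) : Equiv.Perm (Fin (N + 1)) :=
  Equiv.swap g.1.castSucc g.1.succ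

/-- The position at which the overcrossing strand of a letter starts: in `σ_i` the strand at
position `i` passes under the strand at position `i + 1`, in the inverse it passes over. -/
def letterOver {N : ℕ} (g : Fin N × Bool) : Fin (N + 1) :=
  if g.2 then g.1.succ else g.1.castSucc

/-- The point on strand position `j` between the first `l` letters and the rest of the word. -/
def levelPt {N : ℕ} (l : ℕ) (j : Fin (N + 1)) : Space := ![(j : ℝ), -(l : ℝ), 0]

/-- The middle of the strand that starts at position `j` at level `l` and crosses the letter `g`:
halfway to its end, and lifted by `1` if it is the overcrossing strand. -/
def midPt {N : ℕ} (g : Fin N × Bool) (l : ℕ) (j : Fin (N + 1)) : Space :=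
  ![((j : ℝ) + (letterPerm g j : ℝ)) / 2, -(l : ℝ) - 1 / 2, if j = letterOver g then 1 else 0]

/-- The lower corner of the closing arc at position `j`, for a word of length `m`. -/
def lowPt {N : ℕ} (m : ℕ) (j : Fin (N + 1)) : Space := ![(j : ℝ), -(m : ℝ) - 1, -1]

/-- The upper corner of the closing arc at position `j`. -/
def highPt {N : ℕ} (j : Fin (N + 1)) : Space := ![(j : ℝ), 1, -1]

/-- The edges of the closure of a braid word: first the braid itself, where every letter occupies
one unit of height, then for each position `j` an arc that returns from the bottom of the braid to
its top behind the braid, in the plane where the first coordinate is `j`. -/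
def closureEdges {N : ℕ} (w : BraidWord N) : Set (Space × Space) :=
  {e | ∃ (l : Fin w.length) (j : Fin (N + 1)),
    e = (levelPt l j, midPt (w.get l) l j) ∨
    e = (midPt (w.get l) l j, levelPt (l + 1) (letterPerm (w.get l) j))} ∪
  {e | ∃ j : Fin (N + 1),
    e = (levelPt w.length j, lowPt w.length j) ∨
    e = (lowPt w.length j, highPt j) ∨
    e = (highPt j, levelPt 0 j)}

theorem closureEdges_finite {N : ℕ} (w : BraidWord N) : (closureEdges w).Finite := by
  have h : closureEdges w ⊆
      (Set.range fun p : Fin w.length × Fin (N + 1) => (levelPt p.1 p.2, midPt (w.get p.1) p.1 p.2))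
      ∪ (Set.range fun p : Fin w.length × Fin (N + 1) =>
        (midPt (w.get p.1) p.1 p.2, levelPt (p.1 + 1) (letterPerm (w.get p.1) p.2)))
      ∪ (Set.range fun j : Fin (N + 1) => (levelPt w.length j, lowPt w.length j))
      ∪ (Set.range fun j : Fin (N + 1) => (lowPt w.length j, highPt j))
      ∪ (Set.range fun j : Fin (N + 1) => (highPt j, levelPt 0 j)) := by
    rintro e (⟨l, j, rfl | rfl⟩ | ⟨j, rfl | rfl | rfl⟩)
    · exact Or.inl (Or.inl (Or.inl (Or.inl ⟨(l, j), rfl⟩)))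
    · exact Or.inl (Or.inl (Or.inl (Or.inr ⟨(l, j), rfl⟩)))
    · exact Or.inl (Or.inl (Or.inr ⟨j, rfl⟩))
    · exact Or.inl (Or.inr ⟨j, rfl⟩)
    · exact Or.inr ⟨j, rfl⟩
  refine Set.Finite.subset ?_ h
  exact ((((Set.finite_range _).union (Set.finite_range _)).union (Set.finite_range _)).union
    (Set.finite_range _)).union (Set.finite_range _)

theorem space_eq_iff (p q : Space) : p = q ↔ p 0 = q 0 ∧ p 1 = q 1 ∧ p 2 = q 2 := by
  constructor
  · rintro rfl; exact ⟨rfl, rfl, rfl⟩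
  · rintro ⟨h0, h1, h2⟩; funext i; fin_cases i <;> assumption

theorem finVal_inj {N : ℕ} {j k : Fin (N + 1)} (h : (j : ℝ) = (k : ℝ)) : j = k :=
  Fin.ext (by exact_mod_cast h)

/-- Two strands that cross the same letter and have the same first coordinate at the same height
are the two crossing strands, at the middle of the letter. -/
theorem strand_cross {N : ℕ} (g : Fin N × Bool) {j k : Fin (N + 1)} (hjk : j ≠ k) {u : ℝ}
    (h0 : 0 ≤ u) (h1 : u ≤ 1)
    (h : (j : ℝ) + u * ((letterPerm g j : ℝ) - j) = k + u * ((letterPerm g k : ℝ) - k)) :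
    u = 1 / 2 ∧ ((j = letterOver g ∧ k ≠ letterOver g) ∨ (j ≠ letterOver g ∧ k = letterOver g)) := by
  obtain ⟨i, s⟩ := g
  have key : ∀ j : Fin (N + 1), (j = i.castSucc ∧ letterPerm (i, s) j = i.succ) ∨
      (j = i.succ ∧ letterPerm (i, s) j = i.castSucc) ∨
      ((j : ℕ) ≠ i ∧ (j : ℕ) ≠ i + 1 ∧ letterPerm (i, s) j = j) := by
    intro j
    by_cases hj : j = i.castSucc
    · left; simp [letterPerm, hj]
    · by_cases hj' : j = i.succ
      · right; left; simp [letterPerm, hj']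
      · right; right
        refine ⟨fun h => hj (Fin.ext h), fun h => hj' (Fin.ext h), ?_⟩
        simp [letterPerm, Equiv.swap_apply_of_ne_of_ne hj hj']
  have hne : i.castSucc ≠ i.succ := by
    intro h; have := congrArg Fin.val h; simp at this
  have far : ∀ j : Fin (N + 1), (j : ℕ) ≠ i → (j : ℕ) ≠ i + 1 →
      (j : ℝ) ≤ (i : ℝ) - 1 ∨ (i : ℝ) + 2 ≤ (j : ℝ) := by
    intro j h1 h2
    rcases lt_or_ge (j : ℕ) i with h | h
    · left; have : (j : ℕ) + 1 ≤ i := h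
      have : ((j : ℕ) : ℝ) + 1 ≤ ((i : ℕ) : ℝ) := by exact_mod_cast this
      linarith
    · right; have : (i : ℕ) + 2 ≤ j := by omega
      exact_mod_cast this
  rcases key j with ⟨hj, hpj⟩ | ⟨hj, hpj⟩ | ⟨hj, hj', hpj⟩ <;>
  rcases key k with ⟨hk, hpk⟩ | ⟨hk, hpk⟩ | ⟨hk, hk', hpk⟩ <;>
  rw [hpj, hpk] at h
  · exact absurd (hj.trans hk.symm) hjk
  · subst hj hk
    simp only [Fin.val_castSucc, Fin.val_succ, Nat.cast_add, Nat.cast_one] at h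
    refine ⟨by linarith, ?_⟩
    cases s <;> simp [letterOver, hne, hne.symm]
  · subst hj
    simp only [Fin.val_castSucc, Fin.val_succ, Nat.cast_add, Nat.cast_one] at h
    rcases far k hk hk' with h' | h' <;> linarith
  · subst hj hk
    simp only [Fin.val_castSucc, Fin.val_succ, Nat.cast_add, Nat.cast_one] at h
    refine ⟨by linarith, ?_⟩
    cases s <;> simp [letterOver, hne, hne.symm]
  · exact absurd (hj.trans hk.symm) hjk
  · subst hj
    simp only [Fin.val_castSucc, Fin.val_succ, Nat.cast_add, Nat.cast_one] at h
    rcases far k hk hk' with h' | h' <;> linarith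
  · subst hk
    simp only [Fin.val_castSucc, Fin.val_succ, Nat.cast_add, Nat.cast_one] at h
    rcases far j hj hj' with h' | h' <;> linarith
  · subst hk
    simp only [Fin.val_castSucc, Fin.val_succ, Nat.cast_add, Nat.cast_one] at h
    rcases far j hj hj' with h' | h' <;> linarith
  · exact absurd (finVal_inj (by linarith)) hjk

theorem levelPt_inj {N : ℕ} {l l' : ℕ} {j k : Fin (N + 1)} (h : levelPt l j = levelPt l' k) :
    l = l' ∧ j = k := by
  rw [space_eq_iff] at h
  simp only [levelPt, Matrix.cons_val] at h
  exact ⟨by have := h.2.1; exact_mod_cast neg_injective this, finVal_inj h.1⟩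

theorem midPt_inj {N : ℕ} (w : BraidWord N) {l l' : Fin w.length} {j k : Fin (N + 1)}
    (h : midPt (w.get l) l j = midPt (w.get l') l' k) : l = l' ∧ j = k := by
  rw [space_eq_iff] at h
  simp only [midPt, Matrix.cons_val] at h
  obtain ⟨h0, h1, h2⟩ := h
  have hl : l = l' := Fin.ext (by
    have : ((l : ℕ) : ℝ) = ((l' : ℕ) : ℝ) := by linarith
    exact_mod_cast this)
  subst hl
  refine ⟨rfl, ?_⟩
  by_contra hjk
  obtain ⟨-, ⟨ha, hb⟩ | ⟨ha, hb⟩⟩ := strand_cross (w.get l) hjk (u := 1 / 2) (by norm_num)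
    (by norm_num) (by linarith)
  · rw [if_pos ha, if_neg hb] at h2; norm_num at h2
  · rw [if_neg ha, if_pos hb] at h2; norm_num at h2

theorem levelPt_ne_midPt {N : ℕ} (g : Fin N × Bool) (l l' : ℕ) (j k : Fin (N + 1)) :
    levelPt l j ≠ midPt g l' k := by
  intro h
  rw [space_eq_iff] at h
  simp only [levelPt, midPt, Matrix.cons_val] at h
  have h1 : (2 * l : ℝ) = 2 * l' + 1 := by linarith [h.2.1]
  have h2 : 2 * l = 2 * l' + 1 := by exact_mod_cast h1
  omega

theorem levelPt_ne_lowPt {N : ℕ} (l m : ℕ) (j k : Fin (N + 1)) : levelPt l j ≠ lowPt m k := by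
  intro h
  rw [space_eq_iff] at h
  simp only [levelPt, lowPt, Matrix.cons_val] at h
  linarith [h.2.2]

theorem levelPt_ne_highPt {N : ℕ} (l : ℕ) (j k : Fin (N + 1)) : levelPt l j ≠ highPt k := by
  intro h
  rw [space_eq_iff] at h
  simp only [levelPt, highPt, Matrix.cons_val] at h
  linarith [h.2.2]

theorem midPt_nonneg {N : ℕ} (g : Fin N × Bool) (j : Fin (N + 1)) :
    (0 : ℝ) ≤ if j = letterOver g then 1 else 0 := by
  split_ifs <;> norm_num

theorem midPt_ne_lowPt {N : ℕ} (g : Fin N × Bool) (l m : ℕ) (j k : Fin (N + 1)) :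
    midPt g l j ≠ lowPt m k := by
  intro h
  rw [space_eq_iff] at h
  simp only [midPt, lowPt, Matrix.cons_val] at h
  linarith [h.2.2, midPt_nonneg g j]

theorem midPt_ne_highPt {N : ℕ} (g : Fin N × Bool) (l : ℕ) (j k : Fin (N + 1)) :
    midPt g l j ≠ highPt k := by
  intro h
  rw [space_eq_iff] at h
  simp only [midPt, highPt, Matrix.cons_val] at h
  linarith [h.2.2, midPt_nonneg g j]

theorem lowPt_inj {N : ℕ} {m : ℕ} {j k : Fin (N + 1)} (h : lowPt m j = lowPt m k) : j = k := by
  rw [space_eq_iff] at h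
  simp only [lowPt, Matrix.cons_val] at h
  exact finVal_inj h.1

theorem highPt_inj {N : ℕ} {j k : Fin (N + 1)} (h : highPt j = highPt k) : j = k := by
  rw [space_eq_iff] at h
  simp only [highPt, Matrix.cons_val] at h
  exact finVal_inj h.1

theorem lowPt_ne_highPt {N : ℕ} (m : ℕ) (j k : Fin (N + 1)) : lowPt m j ≠ highPt k := by
  intro h
  rw [space_eq_iff] at h
  simp only [lowPt, highPt, Matrix.cons_val] at h
  have : (0 : ℝ) ≤ m := Nat.cast_nonneg m
  linarith [h.2.1]

theorem closureEdges_proper {N : ℕ} (w : BraidWord N) : ∀ e ∈ closureEdges w, e.1 ≠ e.2 := by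
  rintro e (⟨l, j, rfl | rfl⟩ | ⟨j, rfl | rfl | rfl⟩)
  · exact levelPt_ne_midPt _ _ _ _ _
  · exact (levelPt_ne_midPt _ _ _ _ _).symm
  · exact levelPt_ne_lowPt _ _ _ _
  · exact lowPt_ne_highPt _ _ _
  · exact (levelPt_ne_highPt _ _ _).symm

theorem closureEdges_fst_inj {N : ℕ} (w : BraidWord N) :
    ∀ e ∈ closureEdges w, ∀ f ∈ closureEdges w, e.1 = f.1 → e = f := by
  rintro e (⟨l, j, rfl | rfl⟩ | ⟨j, rfl | rfl | rfl⟩) f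
    (⟨l', k, rfl | rfl⟩ | ⟨k, rfl | rfl | rfl⟩) h <;> dsimp only at h
  · obtain ⟨h1, rfl⟩ := levelPt_inj h
    obtain rfl := Fin.ext h1
    rfl
  · exact absurd h (levelPt_ne_midPt _ _ _ _ _)
  · exact absurd (levelPt_inj h).1 l.2.ne
  · exact absurd h (levelPt_ne_lowPt _ _ _ _)
  · exact absurd h (levelPt_ne_highPt _ _ _)
  · exact absurd h.symm (levelPt_ne_midPt _ _ _ _ _)
  · obtain ⟨rfl, rfl⟩ := midPt_inj w h
    rfl
  · exact absurd h.symm (levelPt_ne_midPt _ _ _ _ _)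
  · exact absurd h (midPt_ne_lowPt _ _ _ _ _)
  · exact absurd h (midPt_ne_highPt _ _ _ _)
  · exact absurd (levelPt_inj h).1 l'.2.ne'
  · exact absurd h (levelPt_ne_midPt _ _ _ _ _)
  · obtain ⟨-, rfl⟩ := levelPt_inj h
    rfl
  · exact absurd h (levelPt_ne_lowPt _ _ _ _)
  · exact absurd h (levelPt_ne_highPt _ _ _)
  · exact absurd h.symm (levelPt_ne_lowPt _ _ _ _)
  · exact absurd h.symm (midPt_ne_lowPt _ _ _ _ _)
  · exact absurd h.symm (levelPt_ne_lowPt _ _ _ _)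
  · rw [lowPt_inj h]
  · exact absurd h (lowPt_ne_highPt _ _ _)
  · exact absurd h.symm (levelPt_ne_highPt _ _ _)
  · exact absurd h.symm (midPt_ne_highPt _ _ _ _)
  · exact absurd h.symm (levelPt_ne_highPt _ _ _)
  · exact absurd h.symm (lowPt_ne_highPt _ _ _)
  · rw [highPt_inj h]

theorem closureEdges_snd_inj {N : ℕ} (w : BraidWord N) :
    ∀ e ∈ closureEdges w, ∀ f ∈ closureEdges w, e.2 = f.2 → e = f := by
  rintro e (⟨l, j, rfl | rfl⟩ | ⟨j, rfl | rfl | rfl⟩) f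
    (⟨l', k, rfl | rfl⟩ | ⟨k, rfl | rfl | rfl⟩) h <;> dsimp only at h
  · obtain ⟨rfl, rfl⟩ := midPt_inj w h
    rfl
  · exact absurd h.symm (levelPt_ne_midPt _ _ _ _ _)
  · exact absurd h (midPt_ne_lowPt _ _ _ _ _)
  · exact absurd h (midPt_ne_highPt _ _ _ _)
  · exact absurd h.symm (levelPt_ne_midPt _ _ _ _ _)
  · exact absurd h (levelPt_ne_midPt _ _ _ _ _)
  · obtain ⟨h1, h2⟩ := levelPt_inj h
    obtain rfl := Fin.ext (Nat.succ_injective h1)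
    obtain rfl := (letterPerm _).injective h2
    rfl
  · exact absurd h (levelPt_ne_lowPt _ _ _ _)
  · exact absurd h (levelPt_ne_highPt _ _ _)
  · exact absurd (levelPt_inj h).1 (Nat.succ_ne_zero _)
  · exact absurd h.symm (midPt_ne_lowPt _ _ _ _ _)
  · exact absurd h.symm (levelPt_ne_lowPt _ _ _ _)
  · rw [lowPt_inj h]
  · exact absurd h (lowPt_ne_highPt _ _ _)
  · exact absurd h.symm (levelPt_ne_lowPt _ _ _ _)
  · exact absurd h.symm (midPt_ne_highPt _ _ _ _)
  · exact absurd h.symm (levelPt_ne_highPt _ _ _)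
  · exact absurd h.symm (lowPt_ne_highPt _ _ _)
  · rw [highPt_inj h]
  · exact absurd h.symm (levelPt_ne_highPt _ _ _)
  · exact absurd h (levelPt_ne_midPt _ _ _ _ _)
  · exact absurd (levelPt_inj h).1 (Nat.succ_ne_zero _).symm
  · exact absurd h (levelPt_ne_lowPt _ _ _ _)
  · exact absurd h (levelPt_ne_highPt _ _ _)
  · obtain ⟨-, rfl⟩ := levelPt_inj h
    rfl

theorem exists_edge_from_level {N : ℕ} (w : BraidWord N) (l : ℕ) (hl : l ≤ w.length)
    (j : Fin (N + 1)) : ∃ f ∈ closureEdges w, f.1 = levelPt l j := by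
  rcases hl.lt_or_eq with h | rfl
  · exact ⟨_, Or.inl ⟨⟨l, h⟩, j, Or.inl rfl⟩, rfl⟩
  · exact ⟨_, Or.inr ⟨j, Or.inl rfl⟩, rfl⟩

theorem exists_edge_to_level {N : ℕ} (w : BraidWord N) (l : ℕ) (hl : l ≤ w.length)
    (j : Fin (N + 1)) : ∃ f ∈ closureEdges w, f.2 = levelPt l j := by
  cases l with
  | zero => exact ⟨_, Or.inr ⟨j, Or.inr (Or.inr rfl)⟩, rfl⟩
  | succ l =>
    refine ⟨_, Or.inl ⟨⟨l, hl⟩, (letterPerm (w.get ⟨l, hl⟩)).symm j, Or.inr rfl⟩, ?_⟩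
    simp

theorem closureEdges_next {N : ℕ} (w : BraidWord N) :
    ∀ e ∈ closureEdges w, ∃! f, f ∈ closureEdges w ∧ f.1 = e.2 := by
  intro e he
  have : ∃ f ∈ closureEdges w, f.1 = e.2 := by
    obtain ⟨l, j, rfl | rfl⟩ | ⟨j, rfl | rfl | rfl⟩ := he
    · exact ⟨_, Or.inl ⟨l, j, Or.inr rfl⟩, rfl⟩
    · exact exists_edge_from_level w _ l.2 _
    · exact ⟨_, Or.inr ⟨j, Or.inr (Or.inl rfl)⟩, rfl⟩
    · exact ⟨_, Or.inr ⟨j, Or.inr (Or.inr rfl)⟩, rfl⟩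
    · exact exists_edge_from_level w _ (Nat.zero_le _) _
  obtain ⟨f, hf, hfe⟩ := this
  exact ⟨f, ⟨hf, hfe⟩, fun g hg => closureEdges_fst_inj w g hg.1 f hf (hg.2.trans hfe.symm)⟩

theorem closureEdges_prev {N : ℕ} (w : BraidWord N) :
    ∀ e ∈ closureEdges w, ∃! f, f ∈ closureEdges w ∧ f.2 = e.1 := by
  intro e he
  have : ∃ f ∈ closureEdges w, f.2 = e.1 := by
    obtain ⟨l, j, rfl | rfl⟩ | ⟨j, rfl | rfl | rfl⟩ := he
    · exact exists_edge_to_level w _ l.2.le _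
    · exact ⟨_, Or.inl ⟨l, j, Or.inl rfl⟩, rfl⟩
    · exact exists_edge_to_level w _ le_rfl _
    · exact ⟨_, Or.inr ⟨j, Or.inl rfl⟩, rfl⟩
    · exact ⟨_, Or.inr ⟨j, Or.inr (Or.inl rfl)⟩, rfl⟩
  obtain ⟨f, hf, hfe⟩ := this
  exact ⟨f, ⟨hf, hfe⟩, fun g hg => closureEdges_snd_inj w g hg.1 f hf (hg.2.trans hfe.symm)⟩

/-- Any common point of the edges `e` and `f` is an endpoint of both of them. -/
def EndsOnly (e f : Space × Space) : Prop :=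
  ∀ s t : ℝ, 0 ≤ s → s ≤ 1 → 0 ≤ t → t ≤ 1 →
    (∀ c, (1 - s) * e.1 c + s * e.2 c = (1 - t) * f.1 c + t * f.2 c) →
    (s = 0 ∨ s = 1) ∧ (t = 0 ∨ t = 1)

theorem EndsOnly.symm {e f : Space × Space} (h : EndsOnly e f) : EndsOnly f e :=
  fun s t hs hs' ht ht' hc => (h t s ht ht' hs hs' fun c => (hc c).symm).symm

theorem EndsOnly.disjoint {e f : Space × Space} (h : EndsOnly e f) :
    segment ℝ e.1 e.2 ∩ segment ℝ f.1 f.2 ⊆ ({e.1, e.2} : Set Space) ∩ {f.1, f.2} := by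
  rintro p ⟨hp, hp'⟩
  rw [segment_eq_image] at hp hp'
  obtain ⟨s, ⟨hs, hs'⟩, rfl⟩ := hp
  obtain ⟨t, ⟨ht, ht'⟩, hst⟩ := hp'
  have hst' := hst
  dsimp only at hst hst' ⊢
  obtain ⟨h1, h2⟩ := h s t hs hs' ht ht' fun c => by
    have := congrFun hst c
    simpa using this.symm
  constructor
  · rcases h1 with rfl | rfl <;> simp
  · rw [← hst']
    rcases h2 with rfl | rfl <;> simp

/-- Two natural numbers are equal or differ by at least one. -/
theorem nat_eq_or {a b : ℕ} : a = b ∨ (a : ℝ) + 1 ≤ b ∨ (b : ℝ) + 1 ≤ a := by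
  rcases lt_trichotomy a b with h | h | h
  · right; left; exact_mod_cast h
  · left; exact h
  · right; right; exact_mod_cast h

theorem endsOnly_closureEdges {N : ℕ} (w : BraidWord N) :
    ∀ e ∈ closureEdges w, ∀ f ∈ closureEdges w, e ≠ f → EndsOnly e f := by
  -- upper half against upper half
  have h11 : ∀ (l l' : Fin w.length) (j k : Fin (N + 1)),
      (levelPt l j, midPt (w.get l) l j) ≠ (levelPt l' k, midPt (w.get l') l' k) →
      EndsOnly (levelPt l j, midPt (w.get l) l j) (levelPt l' k, midPt (w.get l') l' k) := by
    intro l l' j k hne s t hs hs' ht ht' hc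
    have c0 := hc 0
    have c1 := hc 1
    have c2 := hc 2
    simp only [levelPt, midPt, Matrix.cons_val] at c0 c1 c2
    rcases nat_eq_or (a := l) (b := l') with h | h | h
    · obtain rfl := Fin.ext h
      have hst : s = t := by linarith
      subst hst
      have hjk : j ≠ k := by rintro rfl; exact hne rfl
      obtain ⟨hu, ⟨ha, hb⟩ | ⟨ha, hb⟩⟩ := strand_cross (w.get l) hjk (u := s / 2) (by linarith)
        (by linarith) (by linarith)
      · rw [if_pos ha, if_neg hb] at c2
        exact ⟨Or.inl (by linarith), Or.inl (by linarith)⟩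
      · rw [if_neg ha, if_pos hb] at c2
        exact ⟨Or.inl (by linarith), Or.inl (by linarith)⟩
    · exfalso; linarith
    · exfalso; linarith
  -- lower half against lower half
  have h22 : ∀ (l l' : Fin w.length) (j k : Fin (N + 1)),
      (midPt (w.get l) l j, levelPt (l + 1) (letterPerm (w.get l) j)) ≠
        (midPt (w.get l') l' k, levelPt (l' + 1) (letterPerm (w.get l') k)) →
      EndsOnly (midPt (w.get l) l j, levelPt (l + 1) (letterPerm (w.get l) j))
        (midPt (w.get l') l' k, levelPt (l' + 1) (letterPerm (w.get l') k)) := by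
    intro l l' j k hne s t hs hs' ht ht' hc
    have c0 := hc 0
    have c1 := hc 1
    have c2 := hc 2
    simp only [levelPt, midPt, Matrix.cons_val] at c0 c1 c2
    push_cast at c1
    rcases nat_eq_or (a := l) (b := l') with h | h | h
    · obtain rfl := Fin.ext h
      have hst : s = t := by linarith
      subst hst
      have hjk : j ≠ k := by rintro rfl; exact hne rfl
      obtain ⟨hu, ⟨ha, hb⟩ | ⟨ha, hb⟩⟩ := strand_cross (w.get l) hjk (u := (1 + s) / 2)
        (by linarith) (by linarith) (by linarith)
      · rw [if_pos ha, if_neg hb] at c2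
        exact ⟨Or.inr (by linarith), Or.inr (by linarith)⟩
      · rw [if_neg ha, if_pos hb] at c2
        exact ⟨Or.inr (by linarith), Or.inr (by linarith)⟩
    · exfalso; linarith
    · exfalso; linarith
  -- upper half against lower half
  have h12 : ∀ (l l' : Fin w.length) (j k : Fin (N + 1)),
      EndsOnly (levelPt l j, midPt (w.get l) l j)
        (midPt (w.get l') l' k, levelPt (l' + 1) (letterPerm (w.get l') k)) := by
    intro l l' j k s t hs hs' ht ht' hc
    have c1 := hc 1
    simp only [levelPt, midPt, Matrix.cons_val] at c1
    push_cast at c1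
    rcases nat_eq_or (a := l) (b := l') with h | h | h
    · rw [h] at c1
      exact ⟨Or.inr (by linarith), Or.inl (by linarith)⟩
    · exfalso; linarith
    · exact ⟨Or.inl (by linarith), Or.inr (by linarith)⟩
  have hlen : ∀ l : Fin w.length, ((l : ℕ) : ℝ) + 1 ≤ w.length := fun l => by exact_mod_cast l.2
  have hnn : ∀ l : ℕ, (0 : ℝ) ≤ l := fun l => Nat.cast_nonneg l
  have h13 : ∀ (l : Fin w.length) (j k : Fin (N + 1)),
      EndsOnly (levelPt l j, midPt (w.get l) l j) (levelPt w.length k, lowPt w.length k) := by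
    intro l j k s t hs hs' ht ht' hc
    have c1 := hc 1
    simp only [levelPt, midPt, lowPt, Matrix.cons_val] at c1
    exfalso; linarith [hlen l]
  have h14 : ∀ (l : Fin w.length) (j k : Fin (N + 1)),
      EndsOnly (levelPt l j, midPt (w.get l) l j) (lowPt w.length k, highPt k) := by
    intro l j k s t hs hs' ht ht' hc
    have c2 := hc 2
    simp only [levelPt, midPt, lowPt, highPt, Matrix.cons_val] at c2
    exfalso; linarith [mul_nonneg hs (midPt_nonneg (w.get l) j)]
  have h15 : ∀ (l : Fin w.length) (j k : Fin (N + 1)),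
      EndsOnly (levelPt l j, midPt (w.get l) l j) (highPt k, levelPt 0 k) := by
    intro l j k s t hs hs' ht ht' hc
    have c1 := hc 1
    simp only [levelPt, midPt, highPt, Matrix.cons_val] at c1
    push_cast at c1
    exact ⟨Or.inl (by linarith [hnn l]), Or.inr (by linarith [hnn l])⟩
  have h23 : ∀ (l : Fin w.length) (j k : Fin (N + 1)),
      EndsOnly (midPt (w.get l) l j, levelPt (l + 1) (letterPerm (w.get l) j))
        (levelPt w.length k, lowPt w.length k) := by
    intro l j k s t hs hs' ht ht' hc
    have c1 := hc 1
    simp only [levelPt, midPt, lowPt, Matrix.cons_val] at c1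
    push_cast at c1
    exact ⟨Or.inr (by linarith [hlen l]), Or.inl (by linarith [hlen l])⟩
  have h24 : ∀ (l : Fin w.length) (j k : Fin (N + 1)),
      EndsOnly (midPt (w.get l) l j, levelPt (l + 1) (letterPerm (w.get l) j))
        (lowPt w.length k, highPt k) := by
    intro l j k s t hs hs' ht ht' hc
    have c2 := hc 2
    simp only [levelPt, midPt, lowPt, highPt, Matrix.cons_val] at c2
    exfalso
    linarith [mul_nonneg (sub_nonneg.2 hs') (midPt_nonneg (w.get l) j)]
  have h25 : ∀ (l : Fin w.length) (j k : Fin (N + 1)),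
      EndsOnly (midPt (w.get l) l j, levelPt (l + 1) (letterPerm (w.get l) j))
        (highPt k, levelPt 0 k) := by
    intro l j k s t hs hs' ht ht' hc
    have c1 := hc 1
    simp only [levelPt, midPt, highPt, Matrix.cons_val] at c1
    push_cast at c1
    exfalso; linarith [hnn l]
  have h33 : ∀ j k : Fin (N + 1), j ≠ k →
      EndsOnly (levelPt w.length j, lowPt w.length j) (levelPt w.length k, lowPt w.length k) := by
    intro j k hjk s t hs hs' ht ht' hc
    have c0 := hc 0
    simp only [levelPt, lowPt, Matrix.cons_val] at c0
    exact absurd (finVal_inj (by linarith)) hjk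
  have h44 : ∀ j k : Fin (N + 1), j ≠ k →
      EndsOnly (lowPt w.length j, highPt j) (lowPt w.length k, highPt k) := by
    intro j k hjk s t hs hs' ht ht' hc
    have c0 := hc 0
    simp only [highPt, lowPt, Matrix.cons_val] at c0
    exact absurd (finVal_inj (by linarith)) hjk
  have h55 : ∀ j k : Fin (N + 1), j ≠ k →
      EndsOnly (highPt j, levelPt 0 j) (highPt k, levelPt 0 k) := by
    intro j k hjk s t hs hs' ht ht' hc
    have c0 := hc 0
    simp only [levelPt, highPt, Matrix.cons_val] at c0
    exact absurd (finVal_inj (by linarith)) hjk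
  have h34 : ∀ j k : Fin (N + 1),
      EndsOnly (levelPt w.length j, lowPt w.length j) (lowPt w.length k, highPt k) := by
    intro j k s t hs hs' ht ht' hc
    have c1 := hc 1
    have c2 := hc 2
    simp only [levelPt, lowPt, highPt, Matrix.cons_val] at c1 c2
    have hs1 : s = 1 := by linarith
    subst hs1
    refine ⟨Or.inr rfl, Or.inl ?_⟩
    have h0 : t * ((w.length : ℝ) + 2) = 0 := by linarith
    rcases mul_eq_zero.1 h0 with h | h
    · exact h
    · linarith [hnn w.length]
  have h35 : ∀ j k : Fin (N + 1),
      EndsOnly (levelPt w.length j, lowPt w.length j) (highPt k, levelPt 0 k) := by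
    intro j k s t hs hs' ht ht' hc
    have c1 := hc 1
    have c2 := hc 2
    simp only [levelPt, lowPt, highPt, Matrix.cons_val] at c1 c2
    push_cast at c1
    exact ⟨Or.inl (by linarith [hnn w.length]), Or.inr (by linarith [hnn w.length])⟩
  have h45 : ∀ j k : Fin (N + 1),
      EndsOnly (lowPt w.length j, highPt j) (highPt k, levelPt 0 k) := by
    intro j k s t hs hs' ht ht' hc
    have c1 := hc 1
    have c2 := hc 2
    simp only [levelPt, lowPt, highPt, Matrix.cons_val] at c1 c2
    push_cast at c1
    have ht0 : t = 0 := by linarith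
    subst ht0
    refine ⟨Or.inr ?_, Or.inl rfl⟩
    have h0 : (1 - s) * ((w.length : ℝ) + 2) = 0 := by linarith
    rcases mul_eq_zero.1 h0 with h | h
    · linarith
    · linarith [hnn w.length]
  rintro e (⟨l, j, rfl | rfl⟩ | ⟨j, rfl | rfl | rfl⟩) f
    (⟨l', k, rfl | rfl⟩ | ⟨k, rfl | rfl | rfl⟩) h
  · exact h11 _ _ _ _ h
  · exact h12 _ _ _ _
  · exact h13 _ _ _
  · exact h14 _ _ _
  · exact h15 _ _ _
  · exact (h12 _ _ _ _).symm
  · exact h22 _ _ _ _ h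
  · exact h23 _ _ _
  · exact h24 _ _ _
  · exact h25 _ _ _
  · exact (h13 _ _ _).symm
  · exact (h23 _ _ _).symm
  · exact h33 _ _ (by rintro rfl; exact h rfl)
  · exact h34 _ _
  · exact h35 _ _
  · exact (h14 _ _ _).symm
  · exact (h24 _ _ _).symm
  · exact (h34 _ _).symm
  · exact h44 _ _ (by rintro rfl; exact h rfl)
  · exact h45 _ _
  · exact (h15 _ _ _).symm
  · exact (h25 _ _ _).symm
  · exact (h35 _ _).symm
  · exact (h45 _ _).symm
  · exact h55 _ _ (by rintro rfl; exact h rfl)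

/-- The closure of a braid word, as an oriented polygonal link. -/
def closurePoly {N : ℕ} (w : BraidWord N) : PolyLink where
  edges := closureEdges w
  finite := closureEdges_finite w
  nonempty := ⟨_, Or.inr ⟨0, Or.inl rfl⟩⟩
  proper := closureEdges_proper w
  next := closureEdges_next w
  prev := closureEdges_prev w
  disjoint := fun e he f hf hef => (endsOnly_closureEdges w e he f hf hef).disjoint

/-- The link that is the closure of a braid word. -/
def braidClosure {N : ℕ} (w : BraidWord N) : Link := (closurePoly w).toLink

/-- A link is homogeneous if it is the closure of a homogeneous braid word on some positive number
`N + 1` of strands. -/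
def Link.Homogeneous (K : Link) : Prop :=
  ∃ (N : ℕ) (w : BraidWord N), w.Homogeneous ∧ braidClosure w = K

end PLLink

end

namespace PLLink

/-! ### Inserting and removing a vertex of a polygonal link -/

/-! Let `w` be a braid word with `L` letters on `N + 1` strands. The Conway polynomial of its
closure has degree at most `L - N`, and its coefficient in degree `L - N` is `topCoeff w`, a product
over the generators of factors that depend only on how often the generator and its inverse occur
(`topTerm_cl`). For a homogeneous word every factor is a sign, so degree `k` forces `L ≤ k + N`. A
generator that occurs only once can be removed: the closure is then a connected sum of the closures
of the parts on its two sides, hence again the closure of a homogeneous word, on one strand fewer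
(`cl_skipWord`). So each of the `N` generators may be assumed to occur at least twice, and `2 * N ≤
L ≤ k + N` gives `N ≤ k` and `L ≤ 2 * k`. Only finitely many words remain.

The top term is found by induction on `L`. The skein relation compares a word with the word in which
one letter is inverted and with the word in which it is deleted, and `topCoeff` satisfies the same
recursion. Hence the claim for one choice of signs of the letters implies it for every other choice.
The signs can then be chosen so as to make moves possible: a repeated letter becomes a cancelling
pair, and `i j i` is replaced by `j i j` in the form σ_i σ_j σ_i⁻¹ = σ_j⁻¹ σ_i σ_j. Such moves make
the largest generator occur at most once (`word_induction`). If it does not occur, the closure is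
split and its polynomial vanishes; if it occurs once, the word can be destabilized.

What remains is topology of polygons modulo triangle moves. A continuous family of embedded vertex
maps stays in one class (`toLink_eq_of_family`), because embeddedness is open, nearby vertex maps
are joined by triangle moves, and the interval is connected. Closed braids are drawn in pages. They
are deformed linearly, and two strands never collide because the differences of their coordinates,
before and after the deformation, lie in one convex cone that misses the origin. If the strands of a
subword can be put into layers with every overcrossing strand in the higher layer, the subword can
be deformed into a picture that remembers only which layer leads where (`Layered.wordLink_eq`). This
gives cancellation, far commutation and the braid relation at once; a variant around the back gives
conjugation (`BackLayered.wordLink_eq`). Stabilization and the skein relation are verified on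
explicit polygons.

The existence of the Conway polynomial is not needed: without it `conway` is zero, and zero does not
have degree `k`. -/

theorem PolyLink.ext_edges {K L : PolyLink} (h : K.edges = L.edges) : K = L := by
  cases K; cases L; subst h; rfl

/-- Both edges follow the predecessor `d` of `e`, and the successor of `d` is unique. -/
theorem PolyLink.fst_inj (K : PolyLink) {e f : Space × Space} (he : e ∈ K.edges)
    (hf : f ∈ K.edges) (h : e.1 = f.1) : e = f := by
  obtain ⟨d, ⟨hd, hde⟩, -⟩ := K.prev e he
  obtain ⟨g, -, hg⟩ := K.next d hd
  exact (hg e ⟨he, hde.symm⟩).trans (hg f ⟨hf, by rw [← h, hde]⟩).symm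

theorem PolyLink.snd_inj (K : PolyLink) {e f : Space × Space} (he : e ∈ K.edges)
    (hf : f ∈ K.edges) (h : e.2 = f.2) : e = f := by
  obtain ⟨d, ⟨hd, hde⟩, -⟩ := K.next e he
  obtain ⟨g, -, hg⟩ := K.prev d hd
  exact (hg e ⟨he, hde.symm⟩).trans (hg f ⟨hf, by rw [← h, hde]⟩).symm

/-- A polygonal link from a set of edges with injective endpoint maps. -/
def PolyLink.ofInj (E : Set (Space × Space)) (finite : E.Finite) (nonempty : E.Nonempty)
    (proper : ∀ e ∈ E, e.1 ≠ e.2)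
    (fst_inj : ∀ e ∈ E, ∀ f ∈ E, e.1 = f.1 → e = f)
    (snd_inj : ∀ e ∈ E, ∀ f ∈ E, e.2 = f.2 → e = f)
    (next : ∀ e ∈ E, ∃ f ∈ E, f.1 = e.2) (prev : ∀ e ∈ E, ∃ f ∈ E, f.2 = e.1)
    (disjoint : ∀ e ∈ E, ∀ f ∈ E, e ≠ f →
      segment ℝ e.1 e.2 ∩ segment ℝ f.1 f.2 ⊆ ({e.1, e.2} : Set Space) ∩ {f.1, f.2}) :
    PolyLink where
  edges := E
  finite := finite
  nonempty := nonempty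
  proper := proper
  next := fun e he => by
    obtain ⟨f, hf, h⟩ := next e he
    exact ⟨f, ⟨hf, h⟩, fun g hg => fst_inj g hg.1 f hf (hg.2.trans h.symm)⟩
  prev := fun e he => by
    obtain ⟨f, hf, h⟩ := prev e he
    exact ⟨f, ⟨hf, h⟩, fun g hg => snd_inj g hg.1 f hf (hg.2.trans h.symm)⟩
  disjoint := disjoint

theorem toLink_eq_of_triangleMove {K L : PolyLink} (h : TriangleMove K L) :
    K.toLink = L.toLink := Quot.sound h

/-- The midpoint of the segment would lie on both edges without being an endpoint. -/
theorem PolyLink.not_two_cycle (K : PolyLink) {a c : Space} (h : (a, c) ∈ K.edges)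
    (h' : (c, a) ∈ K.edges) : False := by
  have hne : a ≠ c := K.proper _ h
  have hm := K.disjoint _ h _ h' (by
    intro h0; exact hne (Prod.ext_iff.1 h0).1)
    (a := midpoint ℝ a c) ⟨midpoint_mem_segment a c, by
      rw [segment_symm]; exact midpoint_mem_segment a c⟩
  rcases hm.1 with h0 | h0
  · exact hne (by simpa using h0)
  · exact hne (by simpa using h0)

/-- A vertex `c` between `a` and `b` can be removed if the triangle `abc` meets the other edges at
most in `a` and `b`. -/
theorem exists_remove_vertex (K : PolyLink) {a b c : Space} (hac : (a, c) ∈ K.edges)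
    (hcb : (c, b) ∈ K.edges)
    (hull : ∀ e ∈ K.edges, e ≠ (a, c) → e ≠ (c, b) →
      convexHull ℝ {a, b, c} ∩ segment ℝ e.1 e.2 ⊆ {a, b}) :
    ∃ L : PolyLink, L.edges = (K.edges \ {(a, c), (c, b)}) ∪ {(a, b)} ∧ L.toLink = K.toLink := by
  have hne : a ≠ c := K.proper _ hac
  have hne' : c ≠ b := K.proper _ hcb
  have hab : a ≠ b := by
    rintro rfl
    exact K.not_two_cycle hac hcb
  have hseg : segment ℝ a b ⊆ convexHull ℝ {a, b, c} :=
    segment_subset_convexHull (by simp) (by simp)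
  have hfst : ∀ f ∈ K.edges, f ≠ (a, c) → f.1 ≠ a := fun f hf h h' => h (K.fst_inj hf hac h')
  have hsnd : ∀ f ∈ K.edges, f ≠ (c, b) → f.2 ≠ b := fun f hf h h' => h (K.snd_inj hf hcb h')
  have hdis : ∀ f ∈ K.edges, f ≠ (a, c) → f ≠ (c, b) →
      segment ℝ a b ∩ segment ℝ f.1 f.2 ⊆ ({a, b} : Set Space) ∩ {f.1, f.2} := by
    -- The hull condition makes `x` one of `a` and `b`; these are endpoints of edges of `K`, so `x`
    -- is an endpoint of `f` as well.
    intro f hf h h' x hx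
    have h1 := hull f hf h h' ⟨hseg hx.1, hx.2⟩
    refine ⟨h1, ?_⟩
    rcases h1 with rfl | h1
    · exact (K.disjoint _ hac _ hf h.symm ⟨left_mem_segment _ _ _, hx.2⟩).2
    · rw [Set.mem_singleton_iff] at h1
      subst h1
      exact (K.disjoint _ hcb _ hf h'.symm ⟨right_mem_segment _ _ _, hx.2⟩).2
  let L : PolyLink := PolyLink.ofInj ((K.edges \ {(a, c), (c, b)}) ∪ {(a, b)})
    ((K.finite.subset Set.sdiff_subset).union (Set.finite_singleton _)) ⟨(a, b), Or.inr rfl⟩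
    (by
      rintro e (⟨he, -⟩ | rfl)
      · exact K.proper e he
      · exact hab)
    (by
      rintro e (⟨he, he'⟩ | rfl) f (⟨hf, hf'⟩ | rfl) h
      · exact K.fst_inj he hf h
      · simp only [Set.mem_insert_iff, Set.mem_singleton_iff, not_or] at he'
        exact absurd h (hfst e he he'.1)
      · simp only [Set.mem_insert_iff, Set.mem_singleton_iff, not_or] at hf'
        exact absurd h.symm (hfst f hf hf'.1)
      · rfl)
    (by
      rintro e (⟨he, he'⟩ | rfl) f (⟨hf, hf'⟩ | rfl) h
      · exact K.snd_inj he hf h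
      · simp only [Set.mem_insert_iff, Set.mem_singleton_iff, not_or] at he'
        exact absurd h (hsnd e he he'.2)
      · simp only [Set.mem_insert_iff, Set.mem_singleton_iff, not_or] at hf'
        exact absurd h.symm (hsnd f hf hf'.2)
      · rfl)
    (by
      have key : ∀ x : Space, x ≠ c → (∃ f ∈ K.edges, f.1 = x) →
          ∃ f ∈ (K.edges \ {(a, c), (c, b)}) ∪ {(a, b)}, f.1 = x := by
        rintro x hx ⟨f, hf, rfl⟩
        by_cases h1 : f = (a, c)
        · exact ⟨(a, b), Or.inr rfl, by rw [h1]⟩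
        · refine ⟨f, Or.inl ⟨hf, ?_⟩, rfl⟩
          rintro (h | h)
          · exact h1 h
          · rw [Set.mem_singleton_iff] at h; exact hx (by rw [h])
      rintro e (⟨he, he'⟩ | rfl)
      · refine key _ (fun h => he' (Or.inl (K.snd_inj he hac h))) ?_
        obtain ⟨f, hf, -⟩ := K.next e he
        exact ⟨f, hf⟩
      · refine key _ hne'.symm ?_
        obtain ⟨f, hf, -⟩ := K.next _ hcb
        exact ⟨f, hf⟩)
    (by
      have key : ∀ x : Space, x ≠ c → (∃ f ∈ K.edges, f.2 = x) →
          ∃ f ∈ (K.edges \ {(a, c), (c, b)}) ∪ {(a, b)}, f.2 = x := by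
        rintro x hx ⟨f, hf, rfl⟩
        by_cases h1 : f = (c, b)
        · exact ⟨(a, b), Or.inr rfl, by rw [h1]⟩
        · refine ⟨f, Or.inl ⟨hf, ?_⟩, rfl⟩
          rintro (h | h)
          · exact hx (by rw [h])
          · exact h1 h
      rintro e (⟨he, he'⟩ | rfl)
      · refine key _ (fun h => he' (Or.inr (K.fst_inj he hcb h))) ?_
        obtain ⟨f, hf, -⟩ := K.prev e he
        exact ⟨f, hf⟩
      · refine key _ hne ?_
        obtain ⟨f, hf, -⟩ := K.prev _ hac
        exact ⟨f, hf⟩)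
    (by
      rintro e (⟨he, he'⟩ | rfl) f (⟨hf, hf'⟩ | rfl) h
      · exact K.disjoint e he f hf h
      · simp only [Set.mem_insert_iff, Set.mem_singleton_iff, not_or] at he'
        rw [Set.inter_comm, Set.inter_comm ({_, _} : Set Space)]
        exact hdis e he he'.1 he'.2
      · simp only [Set.mem_insert_iff, Set.mem_singleton_iff, not_or] at hf'
        exact hdis f hf hf'.1 hf'.2
      · exact absurd rfl h)
  -- A triangle move inserts a vertex, so the move runs from `L` to `K`.
  refine ⟨L, rfl, toLink_eq_of_triangleMove ⟨a, b, c, Or.inr rfl, ?_, ?_⟩⟩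
  · apply Set.Subset.antisymm
    · rintro x ⟨hx, hx'⟩
      simp only [support, Set.mem_iUnion] at hx'
      obtain ⟨e, (⟨he, he'⟩ | rfl), hxe⟩ := hx'
      · simp only [Set.mem_insert_iff, Set.mem_singleton_iff, not_or] at he'
        rcases hull e he he'.1 he'.2 ⟨hx, hxe⟩ with rfl | h
        · exact left_mem_segment _ _ _
        · rw [Set.mem_singleton_iff] at h; rw [h]; exact right_mem_segment _ _ _
      · exact hxe
    · intro x hx
      refine ⟨hseg hx, ?_⟩
      simp only [support, Set.mem_iUnion]
      exact ⟨(a, b), Or.inr rfl, hx⟩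
  · have : (a, b) ∉ K.edges := fun h => hne' (Prod.ext_iff.1 (K.fst_inj hac h rfl)).2
    ext e
    change e ∈ K.edges ↔ e ∈ (((K.edges \ {(a, c), (c, b)}) ∪ {(a, b)}) \ {(a, b)}) ∪ {(a, c), (c, b)}
    simp only [Set.mem_union, Set.mem_sdiff, Set.mem_insert_iff, Set.mem_singleton_iff]
    constructor
    · intro he
      by_cases h : e = (a, c) ∨ e = (c, b)
      · exact Or.inr h
      · exact Or.inl ⟨Or.inl ⟨he, h⟩, fun h' => this (h' ▸ he)⟩
    · rintro (⟨⟨h, -⟩ | h, h'⟩ | rfl | rfl)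
      · exact h
      · exact absurd h h'
      · exact hac
      · exact hcb

theorem segment_subset_union {a b c : Space} (hc : c ∈ segment ℝ a b) :
    segment ℝ a b ⊆ segment ℝ a c ∪ segment ℝ c b := by
  intro x hx
  rw [segment_eq_image_lineMap] at hc
  obtain ⟨θ, -, rfl⟩ := hc
  rw [← insert_endpoints_openSegment] at hx
  rcases hx with rfl | rfl | hx
  · exact Or.inl (left_mem_segment _ _ _)
  · exact Or.inr (right_mem_segment _ _ _)
  · rcases openSegment_subset_union a b ⟨θ, rfl⟩ hx with rfl | hx | hx
    · exact Or.inl (right_mem_segment _ _ _)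
    · exact Or.inl (openSegment_subset_segment _ _ _ hx)
    · exact Or.inr (openSegment_subset_segment _ _ _ hx)

/-- A vertex in the interior of a straight piece can be removed. -/
theorem exists_merge (K : PolyLink) {a b c : Space} (hac : (a, c) ∈ K.edges)
    (hcb : (c, b) ∈ K.edges) (hc : c ∈ segment ℝ a b) :
    ∃ L : PolyLink, L.edges = (K.edges \ {(a, c), (c, b)}) ∪ {(a, b)} ∧ L.toLink = K.toLink := by
  refine exists_remove_vertex K hac hcb fun e he h h' => ?_
  rintro x ⟨hx, hx'⟩
  have hne : (a, c) ≠ (c, b) := fun h => K.proper _ hac (Prod.ext_iff.1 h).1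
  -- As `c` lies on `ab`, the triangle is degenerate and contained in the segment.
  have hx1 : x ∈ segment ℝ a b := by
    rw [← convexHull_pair]
    refine convexHull_min ?_ (convex_convexHull ℝ _) hx
    rintro y (rfl | rfl | rfl)
    · exact subset_convexHull _ _ (by simp)
    · exact subset_convexHull _ _ (by simp)
    · rw [convexHull_pair]; exact hc
  have h3 : x ∈ segment ℝ a c ∨ x ∈ segment ℝ c b := by
    exact segment_subset_union hc hx1
  rcases h3 with h3 | h3
  · have := K.disjoint _ hac _ he h.symm ⟨h3, hx'⟩
    rcases this.1 with rfl | hxc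
    · simp
    · rw [Set.mem_singleton_iff] at hxc
      subst hxc
      rcases this.2 with hh | hh
      · exact absurd (K.fst_inj he hcb hh.symm) h'
      · exact absurd (K.snd_inj he hac (Set.mem_singleton_iff.1 hh).symm) h
  · have := K.disjoint _ hcb _ he h'.symm ⟨h3, hx'⟩
    rcases this.1 with rfl | hxc
    · rcases this.2 with hh | hh
      · exact absurd (K.fst_inj he hcb hh.symm) h'
      · exact absurd (K.snd_inj he hac (Set.mem_singleton_iff.1 hh).symm) h
    · simp only [Set.mem_singleton_iff] at hxc
      simp [hxc]

theorem mem_seg {a b x : Space} :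
    x ∈ segment ℝ a b ↔ ∃ s : ℝ, 0 ≤ s ∧ s ≤ 1 ∧ (1 - s) • a + s • b = x := by
  rw [segment_eq_image]
  constructor
  · rintro ⟨s, ⟨h, h'⟩, rfl⟩; exact ⟨s, h, h', rfl⟩
  · rintro ⟨s, h, h', rfl⟩; exact ⟨s, ⟨h, h'⟩, rfl⟩

/-- A vertex `c` off a plane through `a` and `b` can be inserted into the edge `ab` if the triangle
`abc` meets the link only in this edge. -/
theorem exists_insert_vertex (K : PolyLink) {a b c : Space} (hab : (a, b) ∈ K.edges)
    (hull : convexHull ℝ {a, b, c} ∩ support K.edges ⊆ segment ℝ a b)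
    (f : Space →ₗ[ℝ] ℝ) (hfab : f a = f b) (hfc : f c ≠ f a) :
    ∃ L : PolyLink, L.edges = (K.edges \ {(a, b)}) ∪ {(a, c), (c, b)} ∧
      L.toLink = K.toLink := by
  have hne : a ≠ b := K.proper _ hab
  have hsub : ∀ e ∈ K.edges, segment ℝ e.1 e.2 ⊆ support K.edges := fun e he x hx => by
    simp only [support, Set.mem_iUnion]; exact ⟨e, he, hx⟩
  have hfseg : ∀ x ∈ segment ℝ a b, f x = f a := by
    intro x hx
    obtain ⟨s, -, -, rfl⟩ := mem_seg.1 hx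
    simp only [map_add, map_smul, ← hfab, smul_eq_mul]; ring
  -- The functional `f` is constant on `ab` but not on `ac` or `cb`, so each new edge meets the old
  -- link only in its end on `ab`.
  have hac : ∀ e ∈ K.edges, ∀ x ∈ segment ℝ a c, x ∈ segment ℝ e.1 e.2 → x = a := by
    intro e he x hx hx'
    have h1 := hfseg x (hull ⟨segment_subset_convexHull (by simp) (by simp) hx, hsub e he hx'⟩)
    obtain ⟨s, -, -, rfl⟩ := mem_seg.1 hx
    simp only [map_add, map_smul, smul_eq_mul] at h1
    have h2 : s * (f c - f a) = 0 := by linarith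
    rcases mul_eq_zero.1 h2 with rfl | h2
    · simp
    · exact absurd (sub_eq_zero.1 h2) hfc
  have hcb : ∀ e ∈ K.edges, ∀ x ∈ segment ℝ c b, x ∈ segment ℝ e.1 e.2 → x = b := by
    intro e he x hx hx'
    have h1 := hfseg x (hull ⟨segment_subset_convexHull (by simp) (by simp) hx, hsub e he hx'⟩)
    obtain ⟨s, -, -, rfl⟩ := mem_seg.1 hx
    simp only [map_add, map_smul, smul_eq_mul, ← hfab] at h1
    have h2 : (1 - s) * (f c - f a) = 0 := by linarith
    rcases mul_eq_zero.1 h2 with h2 | h2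
    · obtain rfl : s = 1 := by linarith
      simp
    · exact absurd (sub_eq_zero.1 h2) hfc
  have hacb : segment ℝ a c ∩ segment ℝ c b ⊆ {c} := by
    rintro x ⟨hx, hx'⟩
    obtain ⟨s, -, -, rfl⟩ := mem_seg.1 hx
    obtain ⟨t, -, -, h⟩ := mem_seg.1 hx'
    have h1 := congrArg f h
    simp only [map_add, map_smul, smul_eq_mul, ← hfab] at h1
    have h2 : (s - (1 - t)) * (f c - f a) = 0 := by linarith
    rcases mul_eq_zero.1 h2 with h2 | h2
    · obtain rfl : s = 1 - t := by linarith
      have h3 : t • (b - a) = 0 := by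
        have : (1 - t) • c + t • b - ((1 - (1 - t)) • a + (1 - t) • c) = 0 := by rw [h, sub_self]
        rw [← this]; module
      rcases smul_eq_zero.1 h3 with rfl | h3
      · simp
      · exact absurd (sub_eq_zero.1 h3).symm hne
    · exact absurd (sub_eq_zero.1 h2) hfc
  have hca : c ≠ a := fun h => hfc (by rw [h])
  have hcb' : c ≠ b := fun h => hfc (by rw [h, hfab])
  have hc1 : ∀ e ∈ K.edges, e.1 ≠ c := fun e he h =>
    hca (hac e he c (right_mem_segment _ _ _) (h ▸ left_mem_segment _ _ _))
  have hc2 : ∀ e ∈ K.edges, e.2 ≠ c := fun e he h =>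
    hca (hac e he c (right_mem_segment _ _ _) (h ▸ right_mem_segment _ _ _))
  have hd1 : ∀ e ∈ K.edges, e ≠ (a, b) →
      segment ℝ a c ∩ segment ℝ e.1 e.2 ⊆ ({a, c} : Set Space) ∩ {e.1, e.2} := by
    rintro e he hne' x ⟨hx, hx'⟩
    obtain rfl := hac e he x hx hx'
    exact ⟨by simp, (K.disjoint _ hab _ he hne'.symm ⟨left_mem_segment _ _ _, hx'⟩).2⟩
  have hd2 : ∀ e ∈ K.edges, e ≠ (a, b) →
      segment ℝ c b ∩ segment ℝ e.1 e.2 ⊆ ({c, b} : Set Space) ∩ {e.1, e.2} := by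
    rintro e he hne' x ⟨hx, hx'⟩
    obtain rfl := hcb e he x hx hx'
    exact ⟨by simp, (K.disjoint _ hab _ he hne'.symm ⟨right_mem_segment _ _ _, hx'⟩).2⟩
  let L : PolyLink := PolyLink.ofInj ((K.edges \ {(a, b)}) ∪ {(a, c), (c, b)})
    ((K.finite.subset Set.sdiff_subset).union (Set.toFinite _)) ⟨(a, c), Or.inr (by simp)⟩
    (by
      rintro e (⟨he, -⟩ | rfl | rfl)
      · exact K.proper e he
      · exact hca.symm
      · exact hcb')
    (by
      rintro e (⟨he, he'⟩ | rfl | rfl) f (⟨hf, hf'⟩ | rfl | rfl) h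
      · exact K.fst_inj he hf h
      · exact absurd (K.fst_inj he hab h) he'
      · exact absurd h (hc1 e he)
      · exact absurd (K.fst_inj hf hab h.symm) hf'
      · rfl
      · exact absurd h.symm hca
      · exact absurd h.symm (hc1 f hf)
      · exact absurd h hca
      · rfl)
    (by
      rintro e (⟨he, he'⟩ | rfl | rfl) f (⟨hf, hf'⟩ | rfl | rfl) h
      · exact K.snd_inj he hf h
      · exact absurd h (hc2 e he)
      · exact absurd (K.snd_inj he hab h) he'
      · exact absurd h.symm (hc2 f hf)
      · rfl
      · exact absurd h hcb'
      · exact absurd (K.snd_inj hf hab h.symm) hf'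
      · exact absurd h.symm hcb'
      · rfl)
    (by
      have key : ∀ e ∈ K.edges, ∃ f ∈ (K.edges \ {(a, b)}) ∪ {(a, c), (c, b)}, f.1 = e.2 := by
        intro e he
        obtain ⟨f, ⟨hf, hfe⟩, -⟩ := K.next e he
        by_cases h : f = (a, b)
        · exact ⟨(a, c), Or.inr (by simp), by rw [← hfe, h]⟩
        · exact ⟨f, Or.inl ⟨hf, h⟩, hfe⟩
      rintro e (⟨he, he'⟩ | rfl | rfl)
      · exact key e he
      · exact ⟨(c, b), Or.inr (by simp), rfl⟩
      · exact key (a, b) hab)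
    (by
      have key : ∀ e ∈ K.edges, ∃ f ∈ (K.edges \ {(a, b)}) ∪ {(a, c), (c, b)}, f.2 = e.1 := by
        intro e he
        obtain ⟨f, ⟨hf, hfe⟩, -⟩ := K.prev e he
        by_cases h : f = (a, b)
        · exact ⟨(c, b), Or.inr (by simp), by rw [← hfe, h]⟩
        · exact ⟨f, Or.inl ⟨hf, h⟩, hfe⟩
      rintro e (⟨he, he'⟩ | rfl | rfl)
      · exact key e he
      · exact key (a, b) hab
      · exact ⟨(a, c), Or.inr (by simp), rfl⟩)
    (by
      have h12 : segment ℝ a c ∩ segment ℝ c b ⊆ ({a, c} : Set Space) ∩ {c, b} := fun x hx => by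
        obtain rfl := hacb hx
        simp
      rintro e (⟨he, he'⟩ | rfl | rfl) f (⟨hf, hf'⟩ | rfl | rfl) h
      · exact K.disjoint e he f hf h
      · rw [Set.inter_comm, Set.inter_comm ({_, _} : Set Space)]
        exact hd1 e he he'
      · rw [Set.inter_comm, Set.inter_comm ({_, _} : Set Space)]
        exact hd2 e he he'
      · exact hd1 f hf hf'
      · exact absurd rfl h
      · exact h12
      · exact hd2 f hf hf'
      · rw [Set.inter_comm, Set.inter_comm ({_, _} : Set Space)]
        exact h12
      · exact absurd rfl h)
  refine ⟨L, rfl, (toLink_eq_of_triangleMove ⟨a, b, c, hab, ?_, rfl⟩).symm⟩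
  exact Set.Subset.antisymm hull fun x hx =>
    ⟨segment_subset_convexHull (by simp) (by simp) hx, hsub _ hab hx⟩

/-! ### Isotopies of vertex maps -/

/-- The closed polygons with vertex map `p`, where `n v` is the vertex following `v`, are simple
and disjoint. -/
def Emb {V : Type} (n : Equiv.Perm V) (p : V → Space) : Prop :=
  (∀ v, n v ≠ v) ∧ ∀ v w, v ≠ w → ∀ s t : ℝ, 0 ≤ s → s ≤ 1 → 0 ≤ t → t ≤ 1 →
    (1 - s) • p v + s • p (n v) = (1 - t) • p w + t • p (n w) →
    (s = 1 ∧ t = 0 ∧ n v = w) ∨ (s = 0 ∧ t = 1 ∧ n w = v)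

theorem Emb.injective {V : Type} {n : Equiv.Perm V} {p : V → Space} (h : Emb n p) :
    Function.Injective p := by
  intro v w hvw
  by_contra hne
  rcases h.2 v w hne 0 0 le_rfl zero_le_one le_rfl zero_le_one (by simp [hvw]) with h | h
  · exact zero_ne_one h.1
  · exact zero_ne_one h.2.1

theorem Emb.not_two_cycle {V : Type} {n : Equiv.Perm V} {p : V → Space} (h : Emb n p) (v : V) :
    n (n v) ≠ v := by
  intro h2
  rcases h.2 v (n v) (h.1 v).symm (1 / 2) (1 / 2) (by norm_num) (by norm_num) (by norm_num)
    (by norm_num) (by rw [h2]; module) with h | h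
  · norm_num at h
  · norm_num at h

/-- The polygonal link with a given vertex map. -/
def polyOf {V : Type} [Finite V] [Nonempty V] (n : Equiv.Perm V) (p : V → Space) (h : Emb n p) :
    PolyLink :=
  PolyLink.ofInj (Set.range fun v => (p v, p (n v))) (Set.finite_range _) (Set.range_nonempty _)
    (by
      rintro e ⟨v, rfl⟩ h'
      exact h.1 v (h.injective h').symm)
    (by
      rintro e ⟨v, rfl⟩ f ⟨w, rfl⟩ h'
      rw [h.injective h'])
    (by
      rintro e ⟨v, rfl⟩ f ⟨w, rfl⟩ h'
      rw [n.injective (h.injective h')])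
    (by
      rintro e ⟨v, rfl⟩
      exact ⟨_, ⟨n v, rfl⟩, rfl⟩)
    (by
      rintro e ⟨v, rfl⟩
      exact ⟨_, ⟨n.symm v, rfl⟩, by simp⟩)
    (by
      rintro e ⟨v, rfl⟩ f ⟨w, rfl⟩ hne x ⟨hx, hx'⟩
      obtain ⟨s, hs, hs', rfl⟩ := mem_seg.1 hx
      obtain ⟨t, ht, ht', hst⟩ := mem_seg.1 hx'
      have hvw : v ≠ w := by rintro rfl; exact hne rfl
      rcases h.2 v w hvw s t hs hs' ht ht' hst.symm with ⟨rfl, rfl, rfl⟩ | ⟨rfl, rfl, rfl⟩ <;>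
      simp)

theorem polyOf_edges {V : Type} [Finite V] [Nonempty V] (n : Equiv.Perm V) (p : V → Space)
    (h : Emb n p) : (polyOf n p h).edges = Set.range fun v => (p v, p (n v)) := rfl

theorem mem_triangle {a b c x : Space} :
    x ∈ convexHull ℝ {a, b, c} ↔ ∃ s t : ℝ, 0 ≤ s ∧ s ≤ 1 ∧ 0 ≤ t ∧ t ≤ 1 ∧
      (1 - s) • a + s • ((1 - t) • b + t • c) = x := by
  rw [convexHull_insert (by simp), convexHull_pair, mem_convexJoin]
  constructor
  · rintro ⟨_, rfl, y, hy, hx⟩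
    obtain ⟨t, ht, ht', rfl⟩ := mem_seg.1 hy
    obtain ⟨s, hs, hs', rfl⟩ := mem_seg.1 hx
    exact ⟨s, t, hs, hs', ht, ht', rfl⟩
  · rintro ⟨s, t, hs, hs', ht, ht', rfl⟩
    exact ⟨a, rfl, _, mem_seg.2 ⟨t, ht, ht', rfl⟩, mem_seg.2 ⟨s, hs, hs', rfl⟩⟩

open Classical in
-- The motion is two triangle moves: `u` is inserted between `p v` and the next vertex, and then `p
-- v` is removed from between the previous vertex and `u`. The two triangles are swept out by the
-- moving edges, so the embeddings `H` keep them away from the other edges. The functional `f` keeps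
-- `u` off a plane containing the three old vertices, which controls how each triangle meets the
-- edges at `v`.
theorem toLink_move_vertex {V : Type} [Finite V] [Nonempty V] (n : Equiv.Perm V)
    (p p' : V → Space) (v : V) (u : Space) (hp'v : p' v = u) (hp'w : ∀ w, w ≠ v → p' w = p w)
    (H : ∀ s : ℝ, 0 ≤ s → s ≤ 1 → Emb n (Function.update p v ((1 - s) • p v + s • u)))
    (f : Space →ₗ[ℝ] ℝ) (ha : f (p (n.symm v)) = f (p v)) (hb : f (p (n v)) = f (p v))
    (hu : f u ≠ f (p v)) (h : Emb n p) (h' : Emb n p') :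
    (polyOf n p h).toLink = (polyOf n p' h').toLink := by
  set a := n.symm v with ha_def
  set b := n v with hb_def
  have hna : n a = v := by simp [a]
  have hbv : b ≠ v := h.1 v
  have hav : a ≠ v := fun e => h.1 a (by rw [hna, e])
  have hab : a ≠ b := fun e => h.not_two_cycle v (by rw [← hb_def, ← e, hna])
  have hnav : ∀ w, n w = v → w = a := fun w hw => by rw [ha_def, ← hw]; simp
  have e1 : (p v, p b) ∈ (polyOf n p h).edges := ⟨v, rfl⟩
  have hf1 : ∀ x ∈ segment ℝ (p a) (p v), f x = f (p v) := by
    intro x hx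
    obtain ⟨s, -, -, rfl⟩ := mem_seg.1 hx
    simp only [map_add, map_smul, ha, smul_eq_mul]; ring
  -- the pieces of the two triangles that avoid the edges not meeting `v`
  have avoid : ∀ (x : Space) (w : V) (s : ℝ), w ≠ v → n w ≠ v → 0 ≤ s → s ≤ 1 → ∀ τ : ℝ, 0 ≤ τ → τ ≤ 1 →
      x = (1 - τ) • ((1 - s) • p v + s • u) + τ • p b → x ∈ segment ℝ (p w) (p (n w)) →
      x = p b := by
    intro x w s hw hnw hs hs' τ hτ hτ' hx hxw
    obtain ⟨t, ht, ht', hxt⟩ := mem_seg.1 hxw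
    have := (H s hs hs').2 v w hw.symm τ t hτ hτ' ht ht' (by
      rw [Function.update_self, Function.update_of_ne hbv, Function.update_of_ne hw,
        Function.update_of_ne hnw, hxt, hx])
    rcases this with ⟨rfl, -, -⟩ | ⟨-, -, h3⟩
    · rw [hx]; simp
    · exact absurd h3 hnw
  have avoid' : ∀ (x : Space) (w : V) (s : ℝ), w ≠ v → w ≠ a → 0 ≤ s → s ≤ 1 → ∀ τ : ℝ, 0 ≤ τ → τ ≤ 1 →
      x = (1 - τ) • p a + τ • ((1 - s) • p v + s • u) → x ∈ segment ℝ (p w) (p (n w)) →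
      x = p a := by
    intro x w s hw hwa hs hs' τ hτ hτ' hx hxw
    obtain ⟨t, ht, ht', hxt⟩ := mem_seg.1 hxw
    have := (H s hs hs').2 a w hwa.symm τ t hτ hτ' ht ht' (by
      rw [hna, Function.update_self, Function.update_of_ne hav, Function.update_of_ne hw,
        Function.update_of_ne (fun e => hwa (hnav w e)), hxt, hx])
    rcases this with ⟨-, -, h3⟩ | ⟨rfl, -, -⟩
    · exact absurd (hna.symm.trans h3).symm hw
    · rw [hx]; simp
  obtain ⟨L, hL, hLK⟩ := exists_insert_vertex (polyOf n p h) (a := p v) (b := p b) (c := u) e1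
    (by
      rintro x ⟨hx, hx'⟩
      simp only [support, Set.mem_iUnion] at hx'
      obtain ⟨_, ⟨w, rfl⟩, hxw⟩ := hx'
      dsimp only at hxw
      rw [Set.insert_comm, mem_triangle] at hx
      obtain ⟨s, t, hs, hs', ht, ht', hx⟩ := hx
      by_cases hw : w = v
      · subst hw; exact hxw
      by_cases hwa : n w = v
      -- On the incoming edge `f` takes the value `f (p v)`, which in the triangle forces the
      -- coefficient `s * t` of `u` to vanish.
      · rw [hnav w hwa, hna] at hxw
        have := hf1 x hxw
        rw [← hx] at this
        simp only [map_add, map_smul, smul_eq_mul, hb] at this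
        have h2 : s * t * (f u - f (p v)) = 0 := by linarith
        rcases mul_eq_zero.1 h2 with h2 | h2
        · rw [segment_symm]
          refine mem_seg.2 ⟨s, hs, hs', ?_⟩
          rw [← hx]
          have h3 : (s * t) • (u - p v) = 0 := by rw [h2, zero_smul]
          rw [← sub_eq_zero, ← neg_eq_zero, ← h3]; module
        · exact absurd (sub_eq_zero.1 h2) hu
      · rw [avoid x w t hw hwa ht ht' (1 - s) (by linarith) (by linarith)
          (by rw [← hx]; module) hxw]
        exact right_mem_segment _ _ _)
    f hb.symm hu
  rw [← hLK]
  -- The removal of `p v` is the insertion of `p v` into the edge from `p a` to `u`, read backwards.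
  symm
  refine toLink_eq_of_triangleMove ⟨p a, u, p v, ?_, ?_, ?_⟩
  · exact ⟨a, by simp only [hna, hp'v, hp'w a hav]⟩
  · apply Set.Subset.antisymm
    · rintro x ⟨hx, hx'⟩
      simp only [support, Set.mem_iUnion] at hx'
      obtain ⟨_, ⟨w, rfl⟩, hxw⟩ := hx'
      dsimp only at hxw
      rw [mem_triangle] at hx
      obtain ⟨s, t, hs, hs', ht, ht', hx⟩ := hx
      by_cases hwa : w = a
      · rw [hwa, hna, hp'v, hp'w a hav] at hxw; exact hxw
      by_cases hw : w = v
      · rw [hw, hp'v, hp'w b hbv] at hxw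
        obtain ⟨r, hr, hr', hxr⟩ := mem_seg.1 hxw
        have h1 := congrArg f (hx.trans hxr.symm)
        simp only [map_add, map_smul, smul_eq_mul, hb, ha] at h1
        have h2 : (s * (1 - t) - (1 - r)) * (f u - f (p v)) = 0 := by linarith
        rcases mul_eq_zero.1 h2 with h2 | h2
        · have h3 : (1 - s) • p a + (s * t) • p v = r • p b := by
            have h4 := hx.trans hxr.symm
            have h5 : (1 - r) • u = (s * (1 - t)) • u := by rw [sub_eq_zero.1 h2]
            rw [h5] at h4
            have h6 : ((1 - s) • p a + (s * t) • p v - r • p b) =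
              (1 - s) • p a + s • ((1 - t) • u + t • p v) - ((s * (1 - t)) • u + r • p b) := by
              module
            rw [← sub_eq_zero, h6, h4, sub_self]
          rcases hr.eq_or_lt with hr0 | hr0
          · rw [← hxr, ← hr0]; simpa using right_mem_segment ℝ (p a) u
          -- Division by `r` would put `p b` on the edge from `p a` to `p v`, against the
          -- embeddedness of `p`.
          · exfalso
            have h4 : (1 - (s * t / r)) • p a + (s * t / r) • p v = p b := by
              have e : (1 - s * t / r) = (1 - s) / r := by field_simp; linarith
              rw [e, div_eq_inv_mul, div_eq_inv_mul, mul_smul, mul_smul, ← smul_add, h3, smul_smul,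
                inv_mul_cancel₀ hr0.ne', one_smul]
            have h5 := h.2 a b hab (s * t / r) 0 (by positivity)
              ((div_le_one hr0).2 (by nlinarith)) le_rfl zero_le_one (by
                rw [hna, h4]; simp)
            rcases h5 with ⟨-, -, h5⟩ | ⟨-, h5, -⟩
            · exact hbv (h5.symm.trans hna)
            · exact zero_ne_one h5
        · exact absurd (sub_eq_zero.1 h2) hu
      · have hnw : n w ≠ v := fun e => hwa (hnav w e)
        rw [hp'w w hw, hp'w _ hnw] at hxw
        rw [avoid' x w (1 - t) hw hwa (by linarith) (by linarith) s hs hs'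
          (by rw [← hx]; module) hxw]
        exact left_mem_segment _ _ _
    · intro x hx
      refine ⟨segment_subset_convexHull (by simp) (by simp) hx, ?_⟩
      simp only [support, Set.mem_iUnion]
      exact ⟨_, ⟨a, rfl⟩, by simpa only [hna, hp'v, hp'w a hav] using hx⟩
  · rw [hL]
    ext e
    simp only [polyOf_edges, Set.mem_union, Set.mem_sdiff, Set.mem_range, Set.mem_insert_iff,
      Set.mem_singleton_iff]
    constructor
    · rintro (⟨⟨w, rfl⟩, hne⟩ | rfl | rfl)
      · have hw : w ≠ v := by rintro rfl; exact hne rfl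
        by_cases hwa : w = a
        · subst hwa; right; left; rw [hna]
        · have hnw : n w ≠ v := fun e => hwa (hnav w e)
          left
          refine ⟨⟨w, by rw [hp'w w hw, hp'w _ hnw]⟩, fun e => ?_⟩
          exact hwa (h.injective (Prod.ext_iff.1 e).1)
      · exact Or.inr (Or.inr rfl)
      · exact Or.inl ⟨⟨v, by rw [hp'v, hp'w _ hbv]⟩,
          fun e => hab (h.injective (by
            have h1 := (Prod.ext_iff.1 e).1
            have h2 : p' v = p' a := by rw [hp'v, hp'w a hav]; exact h1
            exact absurd (h'.injective h2).symm hav))⟩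
    · rintro (⟨⟨w, rfl⟩, hne⟩ | rfl | rfl)
      · by_cases hw : w = v
        · subst hw; right; right; rw [hp'v, hp'w _ hbv]
        · have hwa : w ≠ a := by
            rintro rfl; exact hne (by rw [hna, hp'v, hp'w _ hw])
          have hnw : n w ≠ v := fun e => hwa (hnav w e)
          left
          refine ⟨⟨w, by rw [hp'w w hw, hp'w _ hnw]⟩, fun e => ?_⟩
          rw [hp'w w hw] at e
          exact hw (h.injective (Prod.ext_iff.1 e).1)
      · exact Or.inl ⟨⟨a, by rw [hna]⟩, fun e => hav (h.injective (Prod.ext_iff.1 e).1)⟩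
      · exact Or.inr (Or.inl rfl)

open Filter Topology in
-- For a single parameter the condition is open; compactness of the parameter set makes it open for
-- all parameters at once.
theorem isOpen_forall_ne {P : Type*} [TopologicalSpace P] {S : Set (ℝ × ℝ)}
    (hS : IsCompact S) {f g : P → ℝ × ℝ → Space} (hf : Continuous fun x : P × ℝ × ℝ => f x.1 x.2)
    (hg : Continuous fun x : P × ℝ × ℝ => g x.1 x.2) :
    IsOpen {p | ∀ x ∈ S, f p x ≠ g p x} := by
  rw [isOpen_iff_mem_nhds]
  intro p hp
  refine hS.eventually_forall_of_forall_eventually (P := fun p x => f p x ≠ g p x) fun y hy => ?_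
  exact (isOpen_ne_fun hf hg).mem_nhds (hp y hy)

/-- Consecutive edges meet only in their common vertex. -/
theorem adjacent_iff {a b c : Space} :
    (∀ s t : ℝ, 0 ≤ s → s ≤ 1 → 0 ≤ t → t ≤ 1 →
      (1 - s) • a + s • b = (1 - t) • b + t • c → s = 1 ∧ t = 0) ↔
    ∀ x ∈ Set.Icc (0 : ℝ) 1 ×ˢ {(0 : ℝ)}, x.1 • (a - b) ≠ (1 - x.1) • (c - b) := by
  constructor
  · rintro h ⟨x, y⟩ ⟨⟨h0, h1⟩, -⟩ he
    dsimp only at h0 h1 he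
    have := h (1 - x) (1 - x) (by linarith) (by linarith) (by linarith) (by linarith) (by
      rw [← sub_eq_zero]
      have h2 : x • (a - b) - (1 - x) • (c - b) = 0 := by rw [he, sub_self]
      rw [← h2]; module)
    linarith [this.1, this.2]
  · intro h s t hs hs' ht ht' he
    by_cases hst : 1 - s + t = 0
    · constructor <;> linarith
    · exfalso
      have hpos : 0 < 1 - s + t := lt_of_le_of_ne (by linarith) (Ne.symm hst)
      refine h ((1 - s) / (1 - s + t), 0) ⟨⟨div_nonneg (by linarith) hpos.le, ?_⟩, rfl⟩ ?_
      · exact (div_le_one hpos).2 (by linarith)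
      · have e : 1 - (1 - s) / (1 - s + t) = t / (1 - s + t) := by field_simp; ring
        dsimp only
        rw [e, div_eq_inv_mul, div_eq_inv_mul, mul_smul, mul_smul]
        congr 1
        rw [← sub_eq_zero] at he ⊢
        rw [← he]; module

/-- Each pair of edges imposes a non-incidence over a compact parameter set. For consecutive edges
this is true only after the common vertex has been divided out by `adjacent_iff`, and for a polygon
with two edges there are no embeddings at all. -/
theorem isOpen_emb {V : Type} [Finite V] (n : Equiv.Perm V) : IsOpen {p : V → Space | Emb n p} := by
  by_cases hn : ∀ v, n v ≠ v
  swap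
  · convert isOpen_empty
    ext p
    simp only [Set.mem_ofPred_eq, Set.mem_empty_iff_false, iff_false]
    exact fun h => hn h.1
  have hI : IsCompact (Set.Icc (0 : ℝ) 1 ×ˢ Set.Icc (0 : ℝ) 1) := isCompact_Icc.prod isCompact_Icc
  have hI0 : IsCompact (Set.Icc (0 : ℝ) 1 ×ˢ {(0 : ℝ)}) := isCompact_Icc.prod isCompact_singleton
  have : {p : V → Space | Emb n p} = ⋂ v, ⋂ w, {p | v ≠ w → ∀ s t : ℝ, 0 ≤ s → s ≤ 1 → 0 ≤ t →
      t ≤ 1 → (1 - s) • p v + s • p (n v) = (1 - t) • p w + t • p (n w) →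
      (s = 1 ∧ t = 0 ∧ n v = w) ∨ (s = 0 ∧ t = 1 ∧ n w = v)} := by
    ext p
    simp only [Emb, Set.mem_ofPred_eq, Set.mem_iInter]
    exact ⟨fun h => h.2, fun h => ⟨hn, h⟩⟩
  rw [this]
  refine isOpen_iInter_of_finite fun v => isOpen_iInter_of_finite fun w => ?_
  by_cases hvw : v = w
  · simp [hvw]
  by_cases h1 : n v = w
  · by_cases h2 : n w = v
    · convert isOpen_empty
      ext p
      simp only [Set.mem_ofPred_eq, Set.mem_empty_iff_false, iff_false]
      intro h
      rcases h hvw (1 / 2) (1 / 2) (by norm_num) (by norm_num) (by norm_num) (by norm_num)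
        (by rw [h1, h2]; module) with h | h <;> norm_num at h
    · convert isOpen_forall_ne (P := V → Space) hI0
        (f := fun p x => x.1 • (p v - p w)) (g := fun p x => (1 - x.1) • (p (n w) - p w))
        (by fun_prop) (by fun_prop) using 1
      ext p
      rw [Set.mem_ofPred_eq, Set.mem_ofPred_eq, ← adjacent_iff]
      simp [h1, h2, hvw]
  · by_cases h2 : n w = v
    · convert isOpen_forall_ne (P := V → Space) hI0
        (f := fun p x => x.1 • (p w - p v)) (g := fun p x => (1 - x.1) • (p (n v) - p v))
        (by fun_prop) (by fun_prop) using 1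
      ext p
      rw [Set.mem_ofPred_eq, Set.mem_ofPred_eq, ← adjacent_iff]
      simp only [h1, h2, hvw, ne_eq, not_false_eq_true, and_false, false_or, forall_const, and_true]
      constructor
      · intro h s t hs hs' ht ht' he
        exact (h t s ht ht' hs hs' he.symm).symm
      · intro h s t hs hs' ht ht' he
        exact (h t s ht ht' hs hs' he.symm).symm
    · convert isOpen_forall_ne (P := V → Space) hI
        (f := fun p x => (1 - x.1) • p v + x.1 • p (n v))
        (g := fun p x => (1 - x.2) • p w + x.2 • p (n w))
        (by fun_prop) (by fun_prop) using 1
      ext p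
      simp only [h1, h2, hvw, ne_eq, not_false_eq_true, and_false, or_self, forall_const,
        Set.mem_ofPred_eq, Set.mem_prod, Set.mem_Icc, Prod.forall]
      constructor
      · rintro h s t ⟨⟨a, b⟩, c, d⟩; exact h s t a b c d
      · intro h s t a b c d; exact h s t ⟨⟨a, b⟩, c, d⟩

/-- The two differences span at most a plane in three-space. -/
theorem exists_functional (a b c : Space) :
    ∃ f : Space →ₗ[ℝ] ℝ, f ≠ 0 ∧ f a = f b ∧ f c = f b := by
  classical
  have hlt : Submodule.span ℝ (({a - b, c - b} : Finset Space) : Set Space) < ⊤ := by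
    refine lt_top_iff_ne_top.2 fun h => ?_
    have h1 := finrank_span_finset_le_card (R := ℝ) ({a - b, c - b} : Finset Space)
    rw [Set.finrank, h, finrank_top] at h1
    have h2 : ({a - b, c - b} : Finset Space).card ≤ 2 := Finset.card_le_two
    simp at h1
    omega
  obtain ⟨f, hf, hle⟩ := Submodule.exists_le_ker_of_lt_top _ hlt
  refine ⟨f, hf, ?_, ?_⟩
  · have := hle (Submodule.subset_span (by simp : a - b ∈ _))
    rw [LinearMap.mem_ker, map_sub, sub_eq_zero] at this
    exact this
  · have := hle (Submodule.subset_span (by simp : c - b ∈ _))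
    rw [LinearMap.mem_ker, map_sub, sub_eq_zero] at this
    exact this

/-- Along a line through `x` in a direction on which neither functional vanishes, each plane is met
only once, while infinitely many points stay in `U`. -/
theorem exists_small_off_planes (f g : Space →ₗ[ℝ] ℝ) (hf : f ≠ 0) (hg : g ≠ 0) (x : Space)
    (c d : ℝ) (U : Set Space) (hU : IsOpen U) (hx : x ∈ U) : ∃ u ∈ U, f u ≠ c ∧ g u ≠ d := by
  obtain ⟨e1, h1⟩ : ∃ e, f e ≠ 0 := by
    by_contra! h; exact hf (LinearMap.ext h)
  obtain ⟨e2, h2⟩ : ∃ e, g e ≠ 0 := by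
    by_contra! h; exact hg (LinearMap.ext h)
  obtain ⟨e, hfe, hge⟩ : ∃ e, f e ≠ 0 ∧ g e ≠ 0 := by
    by_cases h3 : g e1 = 0
    · by_cases h4 : f e2 = 0
      · exact ⟨e1 + e2, by simpa [h4] using h1, by simpa [h3] using h2⟩
      · exact ⟨e2, h4, h2⟩
    · exact ⟨e1, h1, h3⟩
  have hcont : Continuous fun τ : ℝ => x + τ • e := by fun_prop
  have hopen : IsOpen ((fun τ : ℝ => x + τ • e) ⁻¹' U) := hU.preimage hcont
  have hinf : ((fun τ : ℝ => x + τ • e) ⁻¹' U).Infinite :=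
    infinite_of_mem_nhds 0 (hopen.mem_nhds (by simpa using hx))
  obtain ⟨τ, hτ, hτ'⟩ := (hinf.sdiff (Set.toFinite {(c - f x) / f e, (d - g x) / g e})).nonempty
  simp only [Set.mem_insert_iff, Set.mem_singleton_iff, not_or] at hτ'
  refine ⟨_, hτ, fun h => hτ'.1 ?_, fun h => hτ'.2 ?_⟩
  · rw [← h]; simp [hfe]
  · rw [← h]; simp [hge]

open Classical in
-- In the supremum metric the vertices can be replaced one at a time without leaving the ball, and
-- convexity of the ball supplies the embedded paths that `toLink_move_vertex` needs.
theorem toLink_eq_of_ball {V : Type} [Fintype V] [Nonempty V] (n : Equiv.Perm V)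
    (p : V → Space) (ε : ℝ) (hε : Metric.ball p ε ⊆ {p | Emb n p}) (q r : V → Space)
    (hq : q ∈ Metric.ball p ε) (hr : r ∈ Metric.ball p ε) :
    (polyOf n q (hε hq)).toLink = (polyOf n r (hε hr)).toLink := by
  have hconv : Convex ℝ (Metric.ball p ε) := convex_ball p ε
  -- one vertex at a time
  have one : ∀ (q r : V → Space) (hq : q ∈ Metric.ball p ε) (hr : r ∈ Metric.ball p ε) (v : V),
      (∀ w, w ≠ v → r w = q w) →
      (polyOf n q (hε hq)).toLink = (polyOf n r (hε hr)).toLink := by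
    intro q r hq hr v hqr
    obtain ⟨f, hf, hf1, hf2⟩ := exists_functional (q (n.symm v)) (q v) (q (n v))
    obtain ⟨g, hg, hg1, hg2⟩ := exists_functional (r (n.symm v)) (r v) (r (n v))
    have hU : IsOpen ((fun u => Function.update q v u) ⁻¹' Metric.ball p ε) :=
      Metric.isOpen_ball.preimage (by fun_prop)
    -- The vertex takes a detour through a point `u` outside a plane through its neighbourhood in
    -- `q` and outside one for `r`, since the direct move may be degenerate.
    obtain ⟨u, hu, huf, hug⟩ := exists_small_off_planes f g hf hg (q v) (f (q v)) (g (r v)) _ hU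
      (by simpa using hq)
    have hur : Function.update q v u = Function.update r v u := by
      ext1 w
      by_cases hw : w = v
      · subst hw; simp
      · simp [hw, hqr w hw]
    have seg : ∀ (q : V → Space), q ∈ Metric.ball p ε → Function.update q v u ∈ Metric.ball p ε →
        ∀ s : ℝ, 0 ≤ s → s ≤ 1 → Emb n (Function.update q v ((1 - s) • q v + s • u)) := by
      intro q hq hu s hs hs'
      refine hε ?_
      convert hconv hq hu (sub_nonneg.2 hs') hs (by ring) using 1
      ext1 w
      by_cases hw : w = v
      · subst hw; simp
      · simp only [Function.update_of_ne hw, Pi.add_apply, Pi.smul_apply]; module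
    rw [toLink_move_vertex n q (Function.update q v u) v u (by simp) (by simp +contextual)
      (seg q hq hu) f hf1 hf2 huf (hε hq) (hε hu),
      toLink_move_vertex n r (Function.update q v u) v u (by simp)
        (fun w hw => by rw [hur]; simp [hw])
      (seg r hr (hur ▸ hu)) g hg1 hg2 hug (hε hr) (hε hu)]
  have many : ∀ S : Finset V, ∃ h : S.piecewise r q ∈ Metric.ball p ε,
      (polyOf n q (hε hq)).toLink = (polyOf n (S.piecewise r q) (hε h)).toLink := by
    have hmem : ∀ S : Finset V, S.piecewise r q ∈ Metric.ball p ε := by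
      intro S
      have hε0 : 0 < ε := Metric.pos_of_mem_ball hq
      rw [Metric.mem_ball, dist_pi_lt_iff hε0] at hq hr ⊢
      intro v
      by_cases hv : v ∈ S <;> simp [hv, hq v, hr v]
    intro S
    refine ⟨hmem S, ?_⟩
    induction S using Finset.induction_on with
    | empty => simp
    | insert v S hv ih =>
      rw [ih]
      refine one _ _ (hmem S) (hmem _) v fun w hw => ?_
      simp [Finset.piecewise, hw]
  obtain ⟨h, h'⟩ := many Finset.univ
  rw [h']
  simp

/-- The isotopy class does not change along a family of embedded vertex maps. -/
theorem toLink_eq_of_family {V : Type} [Finite V] [Nonempty V] (n : Equiv.Perm V)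
    (p : ℝ → V → Space) (hp : Continuous p) (H : ∀ t, 0 ≤ t → t ≤ 1 → Emb n (p t)) :
    (polyOf n (p 0) (H 0 le_rfl zero_le_one)).toLink =
      (polyOf n (p 1) (H 1 zero_le_one le_rfl)).toLink := by
  have := Fintype.ofFinite V
  let F : unitInterval → Link := fun t => (polyOf n (p t) (H t t.2.1 t.2.2)).toLink
  -- A locally constant function on the connected interval has equal values at its ends.
  have hF : IsLocallyConstant F := by
    rw [IsLocallyConstant.iff_eventually_eq]
    intro t
    obtain ⟨ε, hε, hball⟩ := Metric.isOpen_iff.1 (isOpen_emb n) (p t) (H t t.2.1 t.2.2)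
    have hc : Continuous fun t : unitInterval => p t := hp.comp continuous_subtype_val
    filter_upwards [hc.continuousAt.preimage_mem_nhds (Metric.ball_mem_nhds _ hε)] with x hx
    exact toLink_eq_of_ball n (p t) ε hball _ _ hx (Metric.mem_ball_self hε)
  exact hF.apply_eq_of_preconnectedSpace 0 1

/-! ### Closed braids in pages

A closed braid has `M + 1` horizontal pages at heights `h 0 > ... > h M`, and two slanted
pages `M + 1` and `M + 2` behind it. The point with coordinates `x` and `z` in a page has first
coordinate `x` and distance from the axis increasing with `z`. -/

/-- The second coordinate of a point of page `l`. -/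
def pageY (M : ℕ) (h : ℕ → ℝ) (l : ℕ) (z : ℝ) : ℝ :=
  if l ≤ M then h l else if l = M + 1 then h M - 1 - 2 * z else h 0 + 1 + 2 * z

/-- The third coordinate of a point of page `l`. -/
def pageZ (M : ℕ) (l : ℕ) (z : ℝ) : ℝ := if l ≤ M then z else -1 - z

/-- The point with coordinates `x` and `z` in page `l`. -/
def pagePt (M : ℕ) (h : ℕ → ℝ) (l : ℕ) (x z : ℝ) : Space := ![x, pageY M h l z, pageZ M l z]

theorem pageY_front {M l : ℕ} (hl : l ≤ M) (h : ℕ → ℝ) (z : ℝ) : pageY M h l z = h l := if_pos hl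

theorem pageY_low (M : ℕ) (h : ℕ → ℝ) (z : ℝ) : pageY M h (M + 1) z = h M - 1 - 2 * z := by
  simp [pageY]

theorem pageY_high (M : ℕ) (h : ℕ → ℝ) (z : ℝ) : pageY M h (M + 2) z = h 0 + 1 + 2 * z := by
  simp [pageY]

theorem pageZ_front {M l : ℕ} (hl : l ≤ M) (z : ℝ) : pageZ M l z = z := if_pos hl

theorem pageZ_back {M l : ℕ} (hl : ¬l ≤ M) (z : ℝ) : pageZ M l z = -1 - z := if_neg hl

theorem pageZ_low (M : ℕ) (z : ℝ) : pageZ M (M + 1) z = -1 - z := by simp [pageZ]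

theorem pageZ_high (M : ℕ) (z : ℝ) : pageZ M (M + 2) z = -1 - z := by simp [pageZ]

/-- The page following page `l`. -/
def nextPage (M l : ℕ) : ℕ := if l = M + 2 then 0 else l + 1

/-- Two strands running between two pages are separated, either by their first coordinates or by
their distances from the axis. -/
def Separated (x x' z z' y y' w w' : ℝ) : Prop :=
  (x < y ∧ x < y' ∧ x' < y ∧ x' < y') ∨ (y < x ∧ y' < x ∧ y < x' ∧ y' < x') ∨
    (z < w ∧ z' < w') ∨ (w < z ∧ w' < z')

/-- Two strands between two parallel pages, given by the differences of their coordinates in the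
two pages, do not meet. -/
def Apart (dx dz dx' dz' : ℝ) : Prop :=
  ∀ s : ℝ, 0 ≤ s → s ≤ 1 → (1 - s) * dx + s * dx' = 0 → (1 - s) * dz + s * dz' ≠ 0

/-- The strands of a closed braid do not meet. -/
structure Braided {N : ℕ} (M : ℕ) (π : ℕ → Equiv.Perm (Fin (N + 1))) (h : ℕ → ℝ)
    (X Z : ℕ → Fin (N + 1) → ℝ) : Prop where
  decr : ∀ l < M, h (l + 1) < h l
  gt : ∀ l ≤ M, ∀ j, -1 < Z l j
  nonneg_zero : ∀ j, 0 ≤ Z 0 j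
  nonneg_last : ∀ j, 0 ≤ Z M j
  nonneg_low : ∀ j, 0 ≤ Z (M + 1) j
  nonneg_high : ∀ j, 0 ≤ Z (M + 2) j
  front : ∀ l < M, ∀ j k, j ≠ k → Apart (X l j - X l k) (Z l j - Z l k)
    (X (l + 1) (π l j) - X (l + 1) (π l k)) (Z (l + 1) (π l j) - Z (l + 1) (π l k))
  back : ∀ l, M ≤ l → l ≤ M + 2 → ∀ j k, j ≠ k →
    Separated (X l j) (X (nextPage M l) (π l j)) (Z l j) (Z (nextPage M l) (π l j))
      (X l k) (X (nextPage M l) (π l k)) (Z l k) (Z (nextPage M l) (π l k))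

theorem Braided.page_inj {N M : ℕ} {π : ℕ → Equiv.Perm (Fin (N + 1))} {h : ℕ → ℝ}
    {X Z : ℕ → Fin (N + 1) → ℝ} (H : Braided M π h X Z) {l : ℕ} (hl : l ≤ M + 2)
    {j k : Fin (N + 1)} (hx : X l j = X l k) (hz : Z l j = Z l k) : j = k := by
  by_contra hjk
  rcases lt_or_ge l M with hlM | hlM
  · exact H.front l hlM j k hjk 0 le_rfl zero_le_one (by simp [hx]) (by simp [hz])
  · rcases H.back l hlM hl j k hjk with h | h | h | h
    · exact absurd hx h.1.ne
    · exact absurd hx h.1.ne'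
    · exact absurd hz h.1.ne
    · exact absurd hz h.1.ne'

theorem Braided.anti {N M : ℕ} {π : ℕ → Equiv.Perm (Fin (N + 1))} {h : ℕ → ℝ}
    {X Z : ℕ → Fin (N + 1) → ℝ} (H : Braided M π h X Z) {l l' : ℕ} (hll : l < l') (hl : l' ≤ M) :
    h l' < h l := by
  induction l', hll using Nat.le_induction with
  | base => exact H.decr l hl
  | succ n hn ih => exact (H.decr n hl).trans (ih (by omega))

theorem convex_lt {a b c s : ℝ} (hs : 0 ≤ s) (hs' : s ≤ 1) (ha : a < c) (hb : b < c) :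
    (1 - s) * a + s * b < c := by
  rcases hs.eq_or_lt with rfl | h
  · simpa using ha
  · nlinarith

theorem convex_le {a b c s : ℝ} (hs : 0 ≤ s) (hs' : s ≤ 1) (ha : a ≤ c) (hb : b ≤ c) :
    (1 - s) * a + s * b ≤ c := by
  nlinarith

theorem lt_convex {a b c s : ℝ} (hs : 0 ≤ s) (hs' : s ≤ 1) (ha : c < a) (hb : c < b) :
    c < (1 - s) * a + s * b := by
  rcases hs.eq_or_lt with rfl | h
  · simpa using ha
  · nlinarith

theorem le_convex {a b c s : ℝ} (hs : 0 ≤ s) (hs' : s ≤ 1) (ha : c ≤ a) (hb : c ≤ b) :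
    c ≤ (1 - s) * a + s * b := by
  nlinarith

/-- Strands in different sectors meet only in a common page. -/
theorem Braided.sector_sep {N M : ℕ} {π : ℕ → Equiv.Perm (Fin (N + 1))} {h : ℕ → ℝ}
    {X Z : ℕ → Fin (N + 1) → ℝ} (H : Braided M π h X Z) {l l' : ℕ} (hll : l < l')
    (hl' : l' ≤ M + 2) {j j' k k' : Fin (N + 1)} {s t : ℝ} (hs : 0 ≤ s) (hs1 : s ≤ 1)
    (ht : 0 ≤ t) (ht1 : t ≤ 1)
    (hy : (1 - s) * pageY M h l (Z l j) + s * pageY M h (nextPage M l) (Z (nextPage M l) j') =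
      (1 - t) * pageY M h l' (Z l' k) + t * pageY M h (nextPage M l') (Z (nextPage M l') k'))
    (hz : (1 - s) * pageZ M l (Z l j) + s * pageZ M (nextPage M l) (Z (nextPage M l) j') =
      (1 - t) * pageZ M l' (Z l' k) + t * pageZ M (nextPage M l') (Z (nextPage M l') k')) :
    (s = 1 ∧ t = 0 ∧ l' = l + 1) ∨ (s = 0 ∧ t = 1 ∧ l = 0 ∧ l' = M + 2) := by
  have hn : nextPage M l = l + 1 := if_neg (by omega)
  rw [hn] at hy hz
  have h0M : h M ≤ h 0 := by
    rcases Nat.eq_zero_or_pos M with h0 | h0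
    · rw [h0]
    · exact (H.anti h0 le_rfl).le
  have eq_of_le : ∀ a b : ℕ, a ≤ b → b ≤ M → h a ≤ h b → a = b := by
    intro a b hab hb hle
    by_contra hne
    exact absurd (H.anti (lt_of_le_of_ne hab hne) hb) (not_lt.2 hle)
  have mono : ∀ a b : ℕ, a ≤ b → b ≤ M → h b ≤ h a := by
    intro a b hab hb
    rcases hab.eq_or_lt with rfl | hlt
    · exact le_rfl
    · exact (H.anti hlt hb).le
  rcases lt_or_ge l M with hlM | hlM
  · rw [pageY_front hlM.le, pageY_front hlM] at hy
    rw [pageZ_front hlM.le, pageZ_front hlM] at hz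
    have hd := H.decr l hlM
    rcases lt_or_ge l' M with hl'M | hl'M
    -- Two front sectors occupy different ranges of heights.
    · have hn' : nextPage M l' = l' + 1 := if_neg (by omega)
      rw [hn', pageY_front hl'M.le, pageY_front hl'M] at hy
      have hd' := H.decr l' hl'M
      have h1 := mono (l + 1) l' hll hl'M.le
      left
      have hs0 : s = 1 := by
        by_contra hne
        have : 0 < 1 - s := by
          rcases hs1.lt_or_eq with h | h
          · linarith
          · exact absurd h hne
        nlinarith
      subst hs0
      have ht0 : t = 0 := by
        by_contra hne
        have : 0 < t := lt_of_le_of_ne ht (Ne.symm hne)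
        nlinarith
      subst ht0
      refine ⟨rfl, rfl, (eq_of_le (l + 1) l' hll hl'M.le (by linarith)).symm⟩
    obtain rfl | rfl | rfl : l' = M ∨ l' = M + 1 ∨ l' = M + 2 := by omega
    · have hn' : nextPage l' l' = l' + 1 := if_neg (by omega)
      rw [hn', pageY_front le_rfl, pageY_low] at hy
      have h1 := mono (l + 1) l' hll le_rfl
      have h2 := H.nonneg_low k'
      left
      have hs0 : s = 1 := by
        by_contra hne
        have : 0 < 1 - s := by
          rcases hs1.lt_or_eq with h | h
          · linarith
          · exact absurd h hne
        nlinarith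
      subst hs0
      have ht0 : t = 0 := by
        by_contra hne
        have : 0 < t := lt_of_le_of_ne ht (Ne.symm hne)
        nlinarith
      subst ht0
      refine ⟨rfl, rfl, (eq_of_le (l + 1) l' hll le_rfl (by linarith)).symm⟩
    · have hn' : nextPage M (M + 1) = M + 2 := if_neg (by omega)
      rw [hn', pageZ_low, pageZ_high] at hz
      -- Front points have third coordinate above `-1`, points between the two back pages at most
      -- `-1`.
      have h1 := lt_convex hs hs1 (H.gt l hlM.le j) (H.gt (l + 1) hlM j')
      have h2 := convex_le (c := -1) ht ht1 (a := -1 - Z (M + 1) k) (b := -1 - Z (M + 2) k')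
        (by linarith [H.nonneg_low k]) (by linarith [H.nonneg_high k'])
      linarith
    · have hn' : nextPage M (M + 2) = 0 := if_pos rfl
      rw [hn', pageY_high, pageY_front (Nat.zero_le _)] at hy
      have h1 := mono 0 l (Nat.zero_le _) hlM.le
      have h2 := H.nonneg_high k
      right
      have ht0 : t = 1 := by
        by_contra hne
        have : 0 < 1 - t := by
          rcases ht1.lt_or_eq with h | h
          · linarith
          · exact absurd h hne
        nlinarith
      subst ht0
      have hs0 : s = 0 := by
        by_contra hne
        have : 0 < s := lt_of_le_of_ne hs (Ne.symm hne)
        nlinarith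
      subst hs0
      exact ⟨rfl, rfl, (eq_of_le 0 l (Nat.zero_le _) hlM.le (by linarith)).symm, rfl⟩
  obtain rfl | rfl : l = M ∨ l = M + 1 := by omega
  · rw [pageY_front le_rfl, pageY_low] at hy
    rw [pageZ_front le_rfl, pageZ_low] at hz
    have h1 := H.nonneg_last j
    have h2 := H.nonneg_low j'
    obtain rfl | rfl : l' = l + 1 ∨ l' = l + 2 := by omega
    · have hn' : nextPage l (l + 1) = l + 2 := if_neg (by omega)
      rw [hn', pageY_low, pageY_high] at hy
      rw [hn', pageZ_low, pageZ_high] at hz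
      have h3 := H.nonneg_low k
      have h4 := H.nonneg_high k'
      left
      -- This combination of the two coordinate equations is a sum of two nonnegative terms, so each
      -- of them vanishes. The same device settles the remaining pairs of sectors.
      have e : (1 - s) * (1 + 2 * Z l j) + t * (h 0 - h l + 2 + 4 * Z (l + 2) k') = 0 := by
        linear_combination 2 * hz - hy
      have e1 : 0 ≤ (1 - s) * (1 + 2 * Z l j) := mul_nonneg (by linarith) (by linarith)
      have e2 : 0 ≤ t * (h 0 - h l + 2 + 4 * Z (l + 2) k') := mul_nonneg ht (by linarith)
      have e3 : (1 - s) * (1 + 2 * Z l j) = 0 := by linarith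
      have e4 : t * (h 0 - h l + 2 + 4 * Z (l + 2) k') = 0 := by linarith
      refine ⟨?_, ?_, rfl⟩
      · rcases mul_eq_zero.1 e3 with h | h <;> linarith
      · rcases mul_eq_zero.1 e4 with h | h <;> linarith
    · have hn' : nextPage l (l + 2) = 0 := if_pos rfl
      rw [hn', pageY_high, pageY_front (Nat.zero_le _)] at hy
      have h3 := H.nonneg_high k
      right
      have e : s * (1 + 2 * Z (l + 1) j') + (1 - t) * (1 + 2 * Z (l + 2) k) + (h 0 - h l) = 0 := by
        linear_combination -hy
      have e1 : 0 ≤ s * (1 + 2 * Z (l + 1) j') := mul_nonneg hs (by linarith)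
      have e2 : 0 ≤ (1 - t) * (1 + 2 * Z (l + 2) k) := mul_nonneg (by linarith) (by linarith)
      have e3 : s * (1 + 2 * Z (l + 1) j') = 0 := by linarith
      have e4 : (1 - t) * (1 + 2 * Z (l + 2) k) = 0 := by linarith
      refine ⟨?_, ?_, (eq_of_le 0 l (Nat.zero_le _) le_rfl (by linarith)).symm, rfl⟩
      · rcases mul_eq_zero.1 e3 with h | h <;> linarith
      · rcases mul_eq_zero.1 e4 with h | h <;> linarith
  · obtain rfl : l' = M + 2 := by omega
    have hn' : nextPage M (M + 2) = 0 := if_pos rfl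
    simp only [hn', show M + 1 + 1 = M + 2 from rfl, pageY_low, pageY_high,
      pageY_front (Nat.zero_le _)] at hy
    simp only [hn', show M + 1 + 1 = M + 2 from rfl, pageZ_low, pageZ_high,
      pageZ_front (Nat.zero_le _)] at hz
    have h1 := H.nonneg_low j
    have h2 := H.nonneg_high j'
    have h3 := H.nonneg_high k
    have h4 := H.nonneg_zero k'
    left
    have e : (1 - s) * (h 0 - h M + 2 + 4 * Z (M + 1) j) + t * (1 + 2 * Z 0 k') = 0 := by
      linear_combination -hy - 2 * hz
    have e1 : 0 ≤ (1 - s) * (h 0 - h M + 2 + 4 * Z (M + 1) j) :=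
      mul_nonneg (by linarith) (by linarith)
    have e2 : 0 ≤ t * (1 + 2 * Z 0 k') := mul_nonneg ht (by linarith)
    have e3 : (1 - s) * (h 0 - h M + 2 + 4 * Z (M + 1) j) = 0 := by linarith
    have e4 : t * (1 + 2 * Z 0 k') = 0 := by linarith
    refine ⟨?_, ?_, rfl⟩
    · rcases mul_eq_zero.1 e3 with h | h <;> linarith
    · rcases mul_eq_zero.1 e4 with h | h <;> linarith

/-- Between the last front page and the lower back page, a strand that is farther out at both ends
stays farther out. The height equation gives `t ≤ s`; the depth equation then leaves only `s = t`
and contradicts one of the strict inequalities. -/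
theorem le_of_strands {h z z' w w' s t : ℝ} (hz : 0 ≤ z) (hz' : 0 ≤ z')
    (h1 : z < w) (h2 : z' < w') (hs : 0 ≤ s) (hs1 : s ≤ 1) (ht : 0 ≤ t) (ht1 : t ≤ 1)
    (e1 : (1 - s) * h + s * (h - 1 - 2 * z') = (1 - t) * h + t * (h - 1 - 2 * w'))
    (e2 : (1 - s) * z + s * (-1 - z') = (1 - t) * w + t * (-1 - w')) : False := by
  have e3 : s * (1 + 2 * z') = t * (1 + 2 * w') := by linear_combination -e1
  have hts : t ≤ s := by
    by_contra! hlt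
    nlinarith [mul_nonneg hs hz', mul_nonneg ht (h2.le.trans' hz')]
  have e4 : (1 - s) * z - (1 - t) * w = (s - t) / 2 := by linear_combination e2 + e3 / 2
  have e5 : (1 - s) * z ≤ (1 - t) * z := mul_le_mul_of_nonneg_right (by linarith) hz
  have e6 : (1 - t) * z ≤ (1 - t) * w := mul_le_mul_of_nonneg_left h1.le (by linarith)
  have hst : s = t := by linarith
  subst hst
  have e7 : (1 - s) * (w - z) = 0 := by linarith
  rcases mul_eq_zero.1 e7 with h0 | h0
  · obtain rfl : s = 1 := by linarith
    linarith
  · linarith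

/-- The analogue for the sector between the two back pages, which are `H` apart on the axis. Adding
and subtracting the two equations gives one comparison for each order of `s` and `t`. -/
theorem le_of_strands_back {H z z' w w' s t : ℝ} (hH : 0 < H) (hz : 0 ≤ z) (hz' : 0 ≤ z')
    (h1 : z < w) (h2 : z' < w') (hs : 0 ≤ s) (hs1 : s ≤ 1) (ht : 0 ≤ t) (ht1 : t ≤ 1)
    (e1 : s * H - 2 * (1 - s) * z + 2 * s * z' = t * H - 2 * (1 - t) * w + 2 * t * w')
    (e2 : (1 - s) * z + s * z' = (1 - t) * w + t * w') : False := by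
  have e3 : s * H + 4 * (s * z') = t * H + 4 * (t * w') := by linear_combination e1 + 2 * e2
  have e4 : s * H - 4 * ((1 - s) * z) = t * H - 4 * ((1 - t) * w) := by
    linear_combination e1 - 2 * e2
  rcases lt_trichotomy s t with h | rfl | h
  · have a1 : s * H < t * H := mul_lt_mul_of_pos_right h hH
    have a2 : s * z' ≤ t * w' := mul_le_mul h.le h2.le hz' ht
    linarith
  · have a1 : s * (w' - z') = 0 := by linarith
    have a2 : (1 - s) * (w - z) = 0 := by linarith
    rcases mul_eq_zero.1 a1 with rfl | h0
    · linarith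
    · linarith
  · have a1 : t * H < s * H := mul_lt_mul_of_pos_right h hH
    have a2 : (1 - s) * z ≤ (1 - t) * w := mul_le_mul (by linarith) h1.le hz (by linarith)
    linarith

/-- Two strands in the same sector do not meet. -/
theorem Braided.same_sector {N M : ℕ} {π : ℕ → Equiv.Perm (Fin (N + 1))} {h : ℕ → ℝ}
    {X Z : ℕ → Fin (N + 1) → ℝ} (H : Braided M π h X Z) {l : ℕ}
    (hl : l ≤ M + 2) {j k : Fin (N + 1)} (hjk : j ≠ k) {s t : ℝ} (hs : 0 ≤ s) (hs1 : s ≤ 1)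
    (ht : 0 ≤ t) (ht1 : t ≤ 1)
    (hx : (1 - s) * X l j + s * X (nextPage M l) (π l j) =
      (1 - t) * X l k + t * X (nextPage M l) (π l k))
    (hy : (1 - s) * pageY M h l (Z l j) +
        s * pageY M h (nextPage M l) (Z (nextPage M l) (π l j)) =
      (1 - t) * pageY M h l (Z l k) + t * pageY M h (nextPage M l) (Z (nextPage M l) (π l k)))
    (hz : (1 - s) * pageZ M l (Z l j) + s * pageZ M (nextPage M l) (Z (nextPage M l) (π l j)) =
      (1 - t) * pageZ M l (Z l k) + t * pageZ M (nextPage M l) (Z (nextPage M l) (π l k))) :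
    False := by
  have h0M : h M ≤ h 0 := by
    rcases Nat.eq_zero_or_pos M with h0 | h0
    · rw [h0]
    · exact (H.anti h0 le_rfl).le
  rcases lt_or_ge l M with hlM | hlM
  · have hn : nextPage M l = l + 1 := if_neg (by omega)
    rw [hn] at hx hy hz
    simp only [pageY_front hlM.le, pageY_front (Nat.succ_le_of_lt hlM)] at hy
    simp only [pageZ_front hlM.le, pageZ_front (Nat.succ_le_of_lt hlM)] at hz
    have hd := H.decr l hlM
    -- Consecutive front pages are parallel, so equal heights mean equal parameters.
    have hst : s = t := by
      have : (s - t) * (h l - h (l + 1)) = 0 := by linear_combination -hy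
      rcases mul_eq_zero.1 this with h | h <;> linarith
    subst hst
    exact H.front l hlM j k hjk s hs hs1 (by linear_combination hx) (by linear_combination hz)
  rcases H.back l hlM hl j k hjk with h1 | h1 | h1
  · obtain ⟨a, b, c, d⟩ := h1
    have e1 := convex_lt hs hs1 (lt_min a b) (lt_min c d)
    have e2 := le_convex ht ht1 (min_le_left (X l k) (X (nextPage M l) (π l k)))
      (min_le_right _ _)
    linarith
  · obtain ⟨a, b, c, d⟩ := h1
    have e1 := lt_convex hs hs1 (max_lt a b) (max_lt c d)
    have e2 := convex_le ht ht1 (le_max_left (X l k) (X (nextPage M l) (π l k)))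
      (le_max_right _ _)
    linarith
  obtain rfl | rfl | rfl : l = M ∨ l = M + 1 ∨ l = M + 2 := by omega
  · have hn : nextPage l l = l + 1 := if_neg (by omega)
    rw [hn] at hy hz h1
    simp only [pageY_front le_rfl, pageZ_front le_rfl, pageY_low, pageZ_low] at hy hz
    rcases h1 with ⟨a, b⟩ | ⟨a, b⟩
    · exact le_of_strands (H.nonneg_last j) (H.nonneg_low _) a b hs hs1 ht ht1 hy hz
    · exact le_of_strands (H.nonneg_last k) (H.nonneg_low _) a b ht ht1 hs hs1 hy.symm hz.symm
  · have hn : nextPage M (M + 1) = M + 2 := if_neg (by omega)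
    rw [hn] at hy hz h1
    simp only [pageY_high, pageZ_high, pageY_low, pageZ_low] at hy hz
    rcases h1 with ⟨a, b⟩ | ⟨a, b⟩
    · exact le_of_strands_back (H := h 0 - h M + 2) (by linarith) (H.nonneg_low j)
        (H.nonneg_high _) a b hs hs1 ht ht1 (by linear_combination hy) (by linear_combination -hz)
    · exact le_of_strands_back (H := h 0 - h M + 2) (by linarith) (H.nonneg_low k)
        (H.nonneg_high _) a b ht ht1 hs hs1 (by linear_combination -hy) (by linear_combination hz)
  · have hn : nextPage M (M + 2) = 0 := if_pos rfl
    rw [hn] at hy hz h1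
    simp only [pageY_high, pageZ_high, pageY_front (Nat.zero_le _), pageZ_front (Nat.zero_le _)]
      at hy hz
    -- The sector from the upper back page to the first page is the mirror image of the one in
    -- `le_of_strands`, traversed backwards.
    rcases h1 with ⟨a, b⟩ | ⟨a, b⟩
    · exact le_of_strands (h := 0) (s := 1 - s) (t := 1 - t) (H.nonneg_zero _) (H.nonneg_high j)
        b a (by linarith) (by linarith) (by linarith) (by linarith)
        (by linear_combination -hy) (by linear_combination hz)
    · exact le_of_strands (h := 0) (s := 1 - t) (t := 1 - s) (H.nonneg_zero _) (H.nonneg_high k)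
        b a (by linarith) (by linarith) (by linarith) (by linarith)
        (by linear_combination hy) (by linear_combination -hz)

/-- The successor of a vertex of a closed braid. -/
def pageNext {N : ℕ} (M : ℕ) (π : ℕ → Equiv.Perm (Fin (N + 1))) :
    Equiv.Perm (Fin (M + 3) × Fin (N + 1)) :=
  Equiv.prodShear (finRotate (M + 3)) fun l => π l

/-- The vertex map of a closed braid. -/
def pageMap {N : ℕ} (M : ℕ) (h : ℕ → ℝ) (X Z : ℕ → Fin (N + 1) → ℝ) :
    Fin (M + 3) × Fin (N + 1) → Space :=
  fun v => pagePt M h v.1 (X v.1 v.2) (Z v.1 v.2)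

theorem val_finRotate (M : ℕ) (l : Fin (M + 3)) :
    ((finRotate (M + 3) l : Fin (M + 3)) : ℕ) = nextPage M l := by
  rw [coe_finRotate, nextPage]
  have : l = Fin.last (M + 2) ↔ (l : ℕ) = M + 2 := by rw [Fin.ext_iff]; rfl
  simp only [this]

/-- Strands in one sector are disjoint by `Braided.same_sector`. Strands in different sectors can
meet only in a common page, and there positions have distinct coordinates, so the common point is a
common vertex. -/
theorem Braided.emb {N M : ℕ} {π : ℕ → Equiv.Perm (Fin (N + 1))} {h : ℕ → ℝ}
    {X Z : ℕ → Fin (N + 1) → ℝ} (H : Braided M π h X Z) :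
    Emb (pageNext M π) (pageMap M h X Z) := by
  have hlt : ∀ l : Fin (M + 3), (l : ℕ) ≤ M + 2 := fun l => Nat.lt_succ_iff.1 l.2
  have hval : ∀ v : Fin (M + 3) × Fin (N + 1),
      (((pageNext M π v).1 : Fin (M + 3)) : ℕ) = nextPage M v.1 := fun v => val_finRotate M v.1
  -- strands in different sectors
  have key : ∀ v w : Fin (M + 3) × Fin (N + 1), (v.1 : ℕ) < w.1 → ∀ s t : ℝ, 0 ≤ s → s ≤ 1 →
      0 ≤ t → t ≤ 1 → (1 - s) • pageMap M h X Z v + s • pageMap M h X Z (pageNext M π v) =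
        (1 - t) • pageMap M h X Z w + t • pageMap M h X Z (pageNext M π w) →
      (s = 1 ∧ t = 0 ∧ pageNext M π v = w) ∨ (s = 0 ∧ t = 1 ∧ pageNext M π w = v) := by
    intro v w hvw s t hs hs1 ht ht1 he
    have hx := congrFun he 0
    have hy := congrFun he 1
    have hz := congrFun he 2
    simp only [pageMap, pagePt, Pi.add_apply, Pi.smul_apply, smul_eq_mul, Matrix.cons_val,
      hval] at hx hy hz
    rcases H.sector_sep hvw (hlt _) hs hs1 ht ht1 hy hz with ⟨rfl, rfl, h1⟩ | ⟨rfl, rfl, h1, h2⟩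
    · left
      refine ⟨rfl, rfl, ?_⟩
      have hn : nextPage M v.1 = w.1 := by rw [h1]; exact if_neg (by have := hlt w.1; omega)
      rw [hn] at hx hy hz
      refine Prod.ext (Fin.ext (by rw [hval, hn])) (H.page_inj (hlt w.1) ?_ ?_)
      · linarith
      · have hl := hlt w.1
        by_cases hc : (w.1 : ℕ) ≤ M
        · rw [pageZ_front hc, pageZ_front hc] at hz; linarith
        · simp only [pageZ_back hc] at hz; linarith
    · right
      refine ⟨rfl, rfl, ?_⟩
      have hn : nextPage M w.1 = v.1 := by rw [h1, h2]; exact if_pos rfl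
      rw [hn] at hx hy hz
      refine Prod.ext (Fin.ext (by rw [hval, hn])) (H.page_inj (hlt v.1) ?_ ?_)
      · linarith
      · rw [h1, pageZ_front (Nat.zero_le _), pageZ_front (Nat.zero_le _)] at hz
        rw [h1]; linarith
  refine ⟨fun v hv => ?_, fun v w hvw s t hs hs1 ht ht1 he => ?_⟩
  · have := congrArg (fun v : Fin (M + 3) × Fin (N + 1) => (v.1 : ℕ)) hv
    rw [hval, nextPage] at this
    split_ifs at this <;> omega
  · rcases lt_trichotomy (v.1 : ℕ) w.1 with h1 | h1 | h1
    · exact key v w h1 s t hs hs1 ht ht1 he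
    · exfalso
      have h1' := Fin.ext h1
      obtain ⟨l, j⟩ := v
      obtain ⟨l', k⟩ := w
      obtain rfl : l = l' := h1'
      have hjk : j ≠ k := by rintro rfl; exact hvw rfl
      have hx := congrFun he 0
      have hy := congrFun he 1
      have hz := congrFun he 2
      simp only [pageMap, pagePt, Pi.add_apply, Pi.smul_apply, smul_eq_mul, Matrix.cons_val,
        hval] at hx hy hz
      exact H.same_sector (hlt l) hjk hs hs1 ht ht1 hx hy hz
    · exact (key w v h1 t s ht ht1 hs hs1 he.symm).symm.imp (fun h => ⟨h.2.1, h.1, h.2.2⟩)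
        fun h => ⟨h.2.1, h.1, h.2.2⟩

/-- The closed braid as a polygonal link. -/
def Braided.poly {N M : ℕ} {π : ℕ → Equiv.Perm (Fin (N + 1))} {h : ℕ → ℝ}
    {X Z : ℕ → Fin (N + 1) → ℝ} (H : Braided M π h X Z) : PolyLink :=
  polyOf (pageNext M π) (pageMap M h X Z) H.emb

/-- The edges of a closed braid. -/
def pageEdges {N : ℕ} (M : ℕ) (π : ℕ → Equiv.Perm (Fin (N + 1))) (h : ℕ → ℝ)
    (X Z : ℕ → Fin (N + 1) → ℝ) : Set (Space × Space) :=
  {e | ∃ l ≤ M + 2, ∃ j, e = (pagePt M h l (X l j) (Z l j),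
    pagePt M h (nextPage M l) (X (nextPage M l) (π l j)) (Z (nextPage M l) (π l j)))}

theorem Braided.poly_edges {N M : ℕ} {π : ℕ → Equiv.Perm (Fin (N + 1))} {h : ℕ → ℝ}
    {X Z : ℕ → Fin (N + 1) → ℝ} (H : Braided M π h X Z) :
    H.poly.edges = pageEdges M π h X Z := by
  ext e
  simp only [Braided.poly, polyOf_edges, Set.mem_range, pageEdges, Set.mem_ofPred_eq, pageMap,
    pageNext, Prod.exists, Equiv.prodShear_apply, val_finRotate]
  constructor
  · rintro ⟨l, j, rfl⟩
    exact ⟨l, Nat.lt_succ_iff.1 l.2, j, rfl⟩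
  · rintro ⟨l, hl, j, rfl⟩
    exact ⟨⟨l, Nat.lt_succ_iff.2 hl⟩, j, rfl⟩

/-- Linear deformations of closed braids are isotopies. -/
theorem Braided.toLink_eq {N M : ℕ} {π : ℕ → Equiv.Perm (Fin (N + 1))} {h h' : ℕ → ℝ}
    {X Z X' Z' : ℕ → Fin (N + 1) → ℝ} (H : Braided M π h X Z) (H' : Braided M π h' X' Z')
    (hf : ∀ t, 0 ≤ t → t ≤ 1 → ∀ l < M, ∀ j k, j ≠ k →
      Apart ((1 - t) * (X l j - X l k) + t * (X' l j - X' l k))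
        ((1 - t) * (Z l j - Z l k) + t * (Z' l j - Z' l k))
        ((1 - t) * (X (l + 1) (π l j) - X (l + 1) (π l k)) +
          t * (X' (l + 1) (π l j) - X' (l + 1) (π l k)))
        ((1 - t) * (Z (l + 1) (π l j) - Z (l + 1) (π l k)) +
          t * (Z' (l + 1) (π l j) - Z' (l + 1) (π l k))))
    (hb : ∀ t, 0 ≤ t → t ≤ 1 → ∀ l, M ≤ l → l ≤ M + 2 → ∀ j k, j ≠ k →
      let x := fun l j => (1 - t) * X l j + t * X' l j
      let z := fun l j => (1 - t) * Z l j + t * Z' l j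
      Separated (x l j) (x (nextPage M l) (π l j)) (z l j) (z (nextPage M l) (π l j))
        (x l k) (x (nextPage M l) (π l k)) (z l k) (z (nextPage M l) (π l k))) :
    H.poly.toLink = H'.poly.toLink := by
  -- All conditions on a closed braid except the two about pairs of strands are convex, so they
  -- persist along the linear family.
  have Ht : ∀ t, 0 ≤ t → t ≤ 1 → Braided M π (fun l => (1 - t) * h l + t * h' l)
      (fun l j => (1 - t) * X l j + t * X' l j) (fun l j => (1 - t) * Z l j + t * Z' l j) := by
    intro t ht ht1
    refine ⟨?_, ?_, ?_, ?_, ?_, ?_, ?_, ?_⟩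
    · intro l hl
      have h1 := H.decr l hl
      have h2 := H'.decr l hl
      have := lt_convex ht ht1 (sub_pos.2 h1) (sub_pos.2 h2)
      linarith
    · exact fun l hl j => lt_convex ht ht1 (H.gt l hl j) (H'.gt l hl j)
    · exact fun j => le_convex ht ht1 (H.nonneg_zero j) (H'.nonneg_zero j)
    · exact fun j => le_convex ht ht1 (H.nonneg_last j) (H'.nonneg_last j)
    · exact fun j => le_convex ht ht1 (H.nonneg_low j) (H'.nonneg_low j)
    · exact fun j => le_convex ht ht1 (H.nonneg_high j) (H'.nonneg_high j)
    · intro l hl j k hjk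
      have := hf t ht ht1 l hl j k hjk
      convert this using 1 <;> ring
    · exact fun l hl hl' j k hjk => hb t ht ht1 l hl hl' j k hjk
  have hcont : Continuous fun t : ℝ => pageMap M (fun l => (1 - t) * h l + t * h' l)
      (fun l (j : Fin (N + 1)) => (1 - t) * X l j + t * X' l j)
      (fun l j => (1 - t) * Z l j + t * Z' l j) := by
    refine continuous_pi fun v => continuous_pi fun i => ?_
    simp only [pageMap, pagePt, pageY, pageZ]
    fin_cases i
    · simp only [Fin.zero_eta, Matrix.cons_val_zero]; fun_prop
    · simp only [Fin.mk_one, Matrix.cons_val_one, Matrix.cons_val_zero]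
      split_ifs <;> fun_prop
    · simp only [Fin.reduceFinMk, Matrix.cons_val]
      split_ifs <;> fun_prop
  have := toLink_eq_of_family (pageNext M π) _ hcont fun t ht ht1 => (Ht t ht ht1).emb
  convert this using 2
  · refine PolyLink.ext_edges ?_
    simp only [Braided.poly, polyOf_edges]
    simp
  · refine PolyLink.ext_edges ?_
    simp only [Braided.poly, polyOf_edges]
    simp

/-! ### Closures of padded braid words -/

/-- A half-plane with one of its two boundary rays. -/
def InCone (σ κ x z : ℝ) : Prop := 0 < σ * x ∨ (x = 0 ∧ 0 < κ * z)

theorem InCone.convex {σ κ x z x' z' t : ℝ} (h : InCone σ κ x z) (h' : InCone σ κ x' z')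
    (ht : 0 ≤ t) (ht1 : t ≤ 1) : InCone σ κ ((1 - t) * x + t * x') ((1 - t) * z + t * z') := by
  rcases ht.eq_or_lt with rfl | ht0
  · simpa using h
  rcases ht1.eq_or_lt with rfl | ht1
  · simpa using h'
  have e : 0 < 1 - t := by linarith
  rcases h with h | ⟨rfl, h⟩ <;> rcases h' with h' | ⟨rfl, h'⟩
  · left; have := mul_pos e h; have := mul_pos ht0 h'; linarith
  · left; have := mul_pos e h; linarith
  · left; have := mul_pos ht0 h'; linarith
  · right; have := mul_pos e h; have := mul_pos ht0 h'; constructor <;> linarith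

/-- The cone is convex and does not contain the origin, so a difference of two strands that starts
and ends in it never vanishes. -/
theorem InCone.apart {σ κ x z x' z' : ℝ} (h : InCone σ κ x z) (h' : InCone σ κ x' z') :
    Apart x z x' z' := by
  intro s hs hs1 hx hz
  rcases h.convex h' hs hs1 with h | h
  · rw [hx, mul_zero] at h; exact lt_irrefl _ h
  · rw [hz, mul_zero] at h; exact lt_irrefl _ h.2

/-- A letter of a padded braid word: a letter of a braid word or a trivial one. -/
abbrev Letter (N : ℕ) : Type := Option (Fin N × Bool)

/-- The permutation of strand positions effected by a letter of a padded word. -/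
def padPerm {N : ℕ} : Letter N → Equiv.Perm (Fin (N + 1))
  | none => 1
  | some a => letterPerm a

open Classical in
/-- The height of the middle of the strand that starts at position `j`. -/
noncomputable def padLift {N : ℕ} (g : Letter N) (j : Fin (N + 1)) : ℝ :=
  match g with
  | none => 0
  | some a => if j = letterOver a then 1 else 0

theorem padLift_nonneg {N : ℕ} (g : Letter N) (j : Fin (N + 1)) : 0 ≤ padLift g j := by
  unfold padLift; split <;> [skip; split_ifs] <;> norm_num

theorem letterPerm_cases {N : ℕ} (g : Fin N × Bool) (j : Fin (N + 1)) :
    ((j : ℕ) = g.1 ∧ ((letterPerm g j : Fin (N + 1)) : ℕ) = g.1 + 1) ∨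
    ((j : ℕ) = g.1 + 1 ∧ ((letterPerm g j : Fin (N + 1)) : ℕ) = g.1) ∨
    ((j : ℕ) ≠ g.1 ∧ (j : ℕ) ≠ g.1 + 1 ∧ letterPerm g j = j) := by
  obtain ⟨i, s⟩ := g
  by_cases hj : j = i.castSucc
  · left; simp [letterPerm, hj]
  · by_cases hj' : j = i.succ
    · right; left; simp [letterPerm, hj']
    · right; right
      refine ⟨fun h => hj (Fin.ext h), fun h => hj' (Fin.ext h), ?_⟩
      simp [letterPerm, Equiv.swap_apply_of_ne_of_ne hj hj']

/-- Two strands at a letter either keep their order or cross. -/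
theorem letter_pair {N : ℕ} (g : Letter N) {j k : Fin (N + 1)} (hjk : j ≠ k) :
    (j < k ∧ padPerm g j < padPerm g k) ∨ (k < j ∧ padPerm g k < padPerm g j) ∨
    (padPerm g j = k ∧ padPerm g k = j ∧ ((padLift g j = 1 ∧ padLift g k = 0) ∨
      (padLift g j = 0 ∧ padLift g k = 1))) := by
  rcases g with _ | ⟨i, b⟩
  · rcases lt_or_gt_of_ne hjk with h | h
    · exact Or.inl ⟨h, h⟩
    · exact Or.inr (Or.inl ⟨h, h⟩)
  · have hne : (j : ℕ) ≠ k := fun h => hjk (Fin.ext h)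
    have hj := letterPerm_cases (i, b) j
    have hk := letterPerm_cases (i, b) k
    simp only [padPerm, Fin.lt_def, Fin.ext_iff] at hj hk ⊢
    by_cases hs : ((j : ℕ) = i ∧ (k : ℕ) = i + 1) ∨ ((j : ℕ) = i + 1 ∧ (k : ℕ) = i)
    · right; right
      refine ⟨by omega, by omega, ?_⟩
      simp only [padLift, letterOver, Fin.ext_iff]
      rcases hs with ⟨h1, h2⟩ | ⟨h1, h2⟩ <;> cases b <;> simp [h1, h2]
    · omega

/-- The permutation between pages `l` and `l + 1` of the closure of a padded word. -/
def wordPerm {N : ℕ} (m : ℕ) (g : ℕ → Letter N) (l : ℕ) : Equiv.Perm (Fin (N + 1)) :=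
  if l < 2 * m ∧ l % 2 = 1 then padPerm (g (l / 2)) else 1

/-- The first coordinates of the points of the closure of a padded word. -/
noncomputable def wordX {N : ℕ} (m : ℕ) (g : ℕ → Letter N) (l : ℕ) (j : Fin (N + 1)) : ℝ :=
  if l < 2 * m ∧ l % 2 = 1 then ((j : ℝ) + (padPerm (g (l / 2)) j : ℝ)) / 2 else j

/-- The lifts of the points of the closure of a padded word. -/
noncomputable def wordZ {N : ℕ} (m : ℕ) (g : ℕ → Letter N) (l : ℕ) (j : Fin (N + 1)) : ℝ :=
  if l < 2 * m ∧ l % 2 = 1 then padLift (g (l / 2)) j else 0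

/-- The heights of the pages of the closure of a padded word. -/
noncomputable def wordH (l : ℕ) : ℝ := -(l : ℝ) / 2

section
variable {N : ℕ} (m : ℕ) (g : ℕ → Letter N)

theorem wordPerm_even {l : ℕ} (h : l % 2 = 0) : wordPerm m g l = 1 := if_neg (by omega)
theorem wordX_even {l : ℕ} (h : l % 2 = 0) (j : Fin (N + 1)) : wordX m g l j = j :=
  if_neg (by omega)
theorem wordZ_even {l : ℕ} (h : l % 2 = 0) (j : Fin (N + 1)) : wordZ m g l j = 0 :=
  if_neg (by omega)
theorem wordPerm_ge {l : ℕ} (h : 2 * m ≤ l) : wordPerm m g l = 1 := if_neg (by omega)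
theorem wordX_ge {l : ℕ} (h : 2 * m ≤ l) (j : Fin (N + 1)) : wordX m g l j = j :=
  if_neg (by omega)
theorem wordZ_ge {l : ℕ} (h : 2 * m ≤ l) (j : Fin (N + 1)) : wordZ m g l j = 0 :=
  if_neg (by omega)

theorem wordPerm_odd {q : ℕ} (h : q < m) : wordPerm m g (2 * q + 1) = padPerm (g q) := by
  rw [wordPerm, if_pos (by omega)]; congr 2; omega
theorem wordX_odd {q : ℕ} (h : q < m) (j : Fin (N + 1)) :
    wordX m g (2 * q + 1) j = ((j : ℝ) + (padPerm (g q) j : ℝ)) / 2 := by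
  rw [wordX, if_pos (by omega), show (2 * q + 1) / 2 = q by omega]
theorem wordZ_odd {q : ℕ} (h : q < m) (j : Fin (N + 1)) :
    wordZ m g (2 * q + 1) j = padLift (g q) j := by
  rw [wordZ, if_pos (by omega), show (2 * q + 1) / 2 = q by omega]

theorem wordZ_nonneg (l : ℕ) (j : Fin (N + 1)) : 0 ≤ wordZ m g l j := by
  unfold wordZ; split_ifs
  · exact padLift_nonneg _ _
  · exact le_rfl

end

theorem fin_cast_lt {n : ℕ} {j k : Fin n} (h : j < k) : (j : ℝ) < k := by exact_mod_cast h

/-- A cone that contains the differences of the coordinates of two strands before and in the middle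
of a letter, and one for the second half of the letter. -/
theorem letter_cone {N : ℕ} (g : Letter N) {j k : Fin (N + 1)} (hjk : j ≠ k) {κ : ℝ}
    (hκ : padPerm g j = k → padPerm g k = j → 0 < κ * (padLift g j - padLift g k)) :
    (∃ σ, 0 < σ * ((j : ℝ) - k) ∧
      InCone σ κ (((j : ℝ) + padPerm g j) / 2 - ((k : ℝ) + padPerm g k) / 2)
        (padLift g j - padLift g k)) ∧
    ∃ σ, 0 < σ * ((padPerm g j : ℝ) - padPerm g k) ∧
      InCone σ κ (((j : ℝ) + padPerm g j) / 2 - ((k : ℝ) + padPerm g k) / 2)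
        (padLift g j - padLift g k) := by
  have hne : (j : ℝ) - k ≠ 0 := sub_ne_zero.2 fun h => hjk (finVal_inj h)
  rcases letter_pair g hjk with ⟨h1, h2⟩ | ⟨h1, h2⟩ | ⟨h1, h2, -⟩
  · have a := fin_cast_lt h1
    have b := fin_cast_lt h2
    exact ⟨⟨-1, by linarith, Or.inl (by linarith)⟩, ⟨-1, by linarith, Or.inl (by linarith)⟩⟩
  · have a := fin_cast_lt h1
    have b := fin_cast_lt h2
    exact ⟨⟨1, by linarith, Or.inl (by linarith)⟩, ⟨1, by linarith, Or.inl (by linarith)⟩⟩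
  · have h := hκ h1 h2
    rw [h1, h2]
    have hs : 0 < ((j : ℝ) - k) * (j - k) := mul_self_pos.2 hne
    exact ⟨⟨(j : ℝ) - k, hs, Or.inr ⟨by ring, h⟩⟩, ⟨(k : ℝ) - j, by linarith, Or.inr ⟨by ring, h⟩⟩⟩

/-- This is the hypothesis of `letter_cone` for the undeformed letter, with κ the difference of the
lifts themselves. -/
theorem letter_pair_sign {N : ℕ} (g : Letter N) {j k : Fin (N + 1)} (hjk : j ≠ k)
    (h : padPerm g j = k) (h' : padPerm g k = j) :
    0 < (padLift g j - padLift g k) * (padLift g j - padLift g k) := by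
  rcases letter_pair g hjk with ⟨h1, h2⟩ | ⟨h1, h2⟩ | ⟨-, -, h3⟩
  · rw [h, h'] at h2; exact absurd h1 h2.asymm
  · rw [h, h'] at h2; exact absurd h1 h2.asymm
  · rcases h3 with ⟨h1, h2⟩ | ⟨h1, h2⟩ <;> rw [h1, h2] <;> norm_num

theorem separated_fin {n : ℕ} {j k : Fin n} (hjk : j ≠ k) (z z' w w' : ℝ) :
    Separated j j z z' k k w w' := by
  rcases lt_or_gt_of_ne hjk with h | h
  · have := fin_cast_lt h; exact Or.inl ⟨this, this, this, this⟩
  · have := fin_cast_lt h; exact Or.inr (Or.inl ⟨this, this, this, this⟩)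

theorem nextPage_front {M l : ℕ} (h : l < M) : nextPage M l = l + 1 := if_neg (by omega)

theorem wordX_back {N : ℕ} (m : ℕ) (g : ℕ → Letter N) {l : ℕ} (h : 2 * m ≤ l)
    (j : Fin (N + 1)) : wordX m g (nextPage (2 * m) l) j = j := by
  unfold nextPage; split_ifs
  · exact wordX_even m g rfl j
  · exact wordX_ge m g (by omega) j

/-- The closure of a padded word is a closed braid. -/
theorem braided_word {N : ℕ} (m : ℕ) (g : ℕ → Letter N) :
    Braided (2 * m) (wordPerm m g) wordH (wordX m g) (wordZ m g) where
  decr := fun l _ => by unfold wordH; push_cast; linarith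
  gt := fun l _ j => by linarith [wordZ_nonneg m g l j]
  nonneg_zero := wordZ_nonneg m g 0
  nonneg_last := wordZ_nonneg m g _
  nonneg_low := wordZ_nonneg m g _
  nonneg_high := wordZ_nonneg m g _
  front := by
    intro l hl j k hjk
    obtain ⟨h1, h2⟩ := letter_cone (g (l / 2)) hjk (κ := padLift (g (l / 2)) j -
      padLift (g (l / 2)) k) (letter_pair_sign (g (l / 2)) hjk)
    obtain ⟨q, rfl | rfl⟩ : ∃ q, l = 2 * q ∨ l = 2 * q + 1 := ⟨l / 2, by omega⟩
    · have hq : q < m := by omega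
      rw [wordPerm_even m g (by omega), wordX_even m g (by omega), wordX_even m g (by omega),
        wordZ_even m g (by omega), wordZ_even m g (by omega)]
      simp only [Equiv.Perm.coe_one, id, wordX_odd m g hq, wordZ_odd m g hq]
      rw [show 2 * q / 2 = q by omega] at h1
      obtain ⟨σ, h3, h4⟩ := h1
      exact InCone.apart (Or.inl h3) h4
    · have hq : q < m := by omega
      rw [wordPerm_odd m g hq]
      simp only [wordX_odd m g hq, wordZ_odd m g hq, show 2 * q + 1 + 1 = 2 * (q + 1) by ring,
        wordX_even m g (Nat.mul_mod_right 2 (q + 1)), wordZ_even m g (Nat.mul_mod_right 2 (q + 1))]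
      rw [show (2 * q + 1) / 2 = q by omega] at h2
      obtain ⟨σ, h3, h4⟩ := h2
      exact InCone.apart h4 (Or.inl h3)
  back := by
    intro l hl hl' j k hjk
    rw [wordPerm_ge m g hl, wordX_ge m g hl, wordX_ge m g hl, wordX_back m g hl,
      wordX_back m g hl]
    exact separated_fin hjk _ _ _ _

/-- The closure of the padded word with the letters `g 0, ..., g (m - 1)`. -/
noncomputable def wordLink {N : ℕ} (m : ℕ) (g : ℕ → Letter N) : Link :=
  (braided_word m g).poly.toLink

/-- The lifts on the odd pages are left free, so that both `wordZ` and the lifts `skeinZ` adapted to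
the skein relation are covered. -/
theorem pageEdges_lift {N : ℕ} (m : ℕ) (g : ℕ → Letter N) {Z : ℕ → Fin (N + 1) → ℝ}
    (hZ : ∀ l, l % 2 = 0 ∨ 2 * m ≤ l → ∀ j, Z l j = 0) :
    pageEdges (2 * m) (wordPerm m g) wordH (wordX m g) Z =
    {e | ∃ q < m, ∃ j : Fin (N + 1),
      e = (![(j : ℝ), -(q : ℝ), 0], ![((j : ℝ) + padPerm (g q) j) / 2, -(q : ℝ) - 1 / 2,
        Z (2 * q + 1) j]) ∨
      e = (![((j : ℝ) + padPerm (g q) j) / 2, -(q : ℝ) - 1 / 2, Z (2 * q + 1) j],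
        ![(padPerm (g q) j : ℝ), -((q + 1 : ℕ) : ℝ), 0])} ∪
    {e | ∃ j : Fin (N + 1), e = (levelPt m j, lowPt m j) ∨ e = (lowPt m j, highPt j) ∨
      e = (highPt j, levelPt 0 j)} := by
  have hev : ∀ q, q ≤ m → ∀ j : Fin (N + 1), pagePt (2 * m) wordH (2 * q) (wordX m g (2 * q) j)
      (Z (2 * q) j) = ![(j : ℝ), -(q : ℝ), 0] := by
    intro q hq j
    rw [wordX_even m g (by omega), hZ _ (by omega), pagePt, pageY_front (by omega),
      pageZ_front (by omega)]
    congr 2; simp [wordH]; ring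
  have hodd : ∀ q, q < m → ∀ j : Fin (N + 1), pagePt (2 * m) wordH (2 * q + 1)
      (wordX m g (2 * q + 1) j) (Z (2 * q + 1) j) =
      ![((j : ℝ) + padPerm (g q) j) / 2, -(q : ℝ) - 1 / 2, Z (2 * q + 1) j] := by
    intro q hq j
    rw [wordX_odd m g hq, pagePt, pageY_front (by omega),
      pageZ_front (by omega)]
    congr 2; simp [wordH]; ring
  have hlow : ∀ j : Fin (N + 1), pagePt (2 * m) wordH (2 * m + 1)
      (wordX m g (2 * m + 1) j) (Z (2 * m + 1) j) = lowPt m j := by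
    intro j
    rw [wordX_ge m g (by omega), hZ _ (by omega), pagePt, pageY_low, pageZ_low, lowPt]
    congr 2 <;> simp [wordH]; ring
  have hhigh : ∀ j : Fin (N + 1), pagePt (2 * m) wordH (2 * m + 2)
      (wordX m g (2 * m + 2) j) (Z (2 * m + 2) j) = highPt j := by
    intro j
    rw [wordX_ge m g (by omega), hZ _ (by omega), pagePt, pageY_high, pageZ_high, highPt]
    congr 2 <;> simp [wordH]
  ext e
  simp only [pageEdges, Set.mem_ofPred_eq, Set.mem_union]
  constructor
  · rintro ⟨l, hl, j, rfl⟩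
    rcases lt_or_ge l (2 * m) with h | h
    · left
      rw [nextPage_front h]
      obtain ⟨q, rfl | rfl⟩ : ∃ q, l = 2 * q ∨ l = 2 * q + 1 := ⟨l / 2, by omega⟩
      · refine ⟨q, by omega, j, Or.inl ?_⟩
        rw [wordPerm_even m g (by omega), hev q (by omega), Equiv.Perm.coe_one, id,
          hodd q (by omega)]
      · refine ⟨q, by omega, j, Or.inr ?_⟩
        rw [wordPerm_odd m g (by omega), hodd q (by omega),
          show 2 * q + 1 + 1 = 2 * (q + 1) by ring, hev (q + 1) (by omega)]
    · right
      rw [wordPerm_ge m g h, Equiv.Perm.coe_one, id]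
      refine ⟨j, ?_⟩
      obtain rfl | rfl | rfl : l = 2 * m ∨ l = 2 * m + 1 ∨ l = 2 * m + 2 := by omega
      · left
        rw [show nextPage (2 * m) (2 * m) = 2 * m + 1 from if_neg (by omega), hev m le_rfl, hlow]
        rfl
      · right; left
        rw [show nextPage (2 * m) (2 * m + 1) = 2 * m + 2 from if_neg (by omega), hlow, hhigh]
      · right; right
        rw [show nextPage (2 * m) (2 * m + 2) = 2 * 0 from if_pos rfl, hhigh, hev 0 (by omega)]
        rfl
  · rintro (⟨q, hq, j, rfl | rfl⟩ | ⟨j, rfl | rfl | rfl⟩)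
    · refine ⟨2 * q, by omega, j, ?_⟩
      rw [nextPage_front (by omega), wordPerm_even m g (by omega), hev q (by omega),
        Equiv.Perm.coe_one, id, hodd q (by omega)]
    · refine ⟨2 * q + 1, by omega, j, ?_⟩
      rw [nextPage_front (by omega), wordPerm_odd m g (by omega), hodd q (by omega),
          show 2 * q + 1 + 1 = 2 * (q + 1) by ring, hev (q + 1) (by omega)]
    · refine ⟨2 * m, by omega, j, ?_⟩
      rw [wordPerm_ge m g (by omega), Equiv.Perm.coe_one, id,
        show nextPage (2 * m) (2 * m) = 2 * m + 1 from if_neg (by omega), hev m le_rfl, hlow]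
      rfl
    · refine ⟨2 * m + 1, by omega, j, ?_⟩
      rw [wordPerm_ge m g (by omega), Equiv.Perm.coe_one, id,
        show nextPage (2 * m) (2 * m + 1) = 2 * m + 2 from if_neg (by omega), hlow, hhigh]
    · refine ⟨2 * m + 2, by omega, j, ?_⟩
      rw [wordPerm_ge m g (by omega), Equiv.Perm.coe_one, id,
        show nextPage (2 * m) (2 * m + 2) = 2 * 0 from if_pos rfl, hhigh, hev 0 (by omega)]
      rfl

theorem pageEdges_word {N : ℕ} (m : ℕ) (g : ℕ → Letter N) :
    pageEdges (2 * m) (wordPerm m g) wordH (wordX m g) (wordZ m g) =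
    {e | ∃ q < m, ∃ j : Fin (N + 1),
      e = (![(j : ℝ), -(q : ℝ), 0], ![((j : ℝ) + padPerm (g q) j) / 2, -(q : ℝ) - 1 / 2,
        padLift (g q) j]) ∨
      e = (![((j : ℝ) + padPerm (g q) j) / 2, -(q : ℝ) - 1 / 2, padLift (g q) j],
        ![(padPerm (g q) j : ℝ), -((q + 1 : ℕ) : ℝ), 0])} ∪
    {e | ∃ j : Fin (N + 1), e = (levelPt m j, lowPt m j) ∨ e = (lowPt m j, highPt j) ∨
      e = (highPt j, levelPt 0 j)} := by
  rw [pageEdges_lift m g fun l hl j => by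
    rcases hl with h | h
    · exact wordZ_even m g h j
    · exact wordZ_ge m g h j]
  congr 1
  ext e
  refine exists_congr fun q => and_congr_right fun hq => exists_congr fun j => ?_
  rw [wordZ_odd m g hq]

/-- Letter `q` owns the pages `2 * q`, at its beginning, and `2 * q + 1`, at its middle; with page
heights `-l / 2` the two polygons have literally the same edges. -/
theorem braidClosure_eq_wordLink {N : ℕ} (w : BraidWord N) :
    braidClosure w = wordLink w.length fun l => w[l]? := by
  refine congrArg PolyLink.toLink (PolyLink.ext_edges ?_)
  rw [Braided.poly_edges, pageEdges_word]
  change closureEdges w = _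
  rw [closureEdges]
  congr 1
  ext e
  simp only [Set.mem_ofPred_eq]
  constructor
  · rintro ⟨l, j, h⟩
    refine ⟨l, l.2, j, ?_⟩
    rw [List.getElem?_eq_getElem l.2]
    exact h
  · rintro ⟨q, hq, j, h⟩
    refine ⟨⟨q, hq⟩, j, ?_⟩
    rw [List.getElem?_eq_getElem hq] at h
    exact h

/-! ### Replacing subwords whose strands lie in layers -/

theorem pageEdges_subset {N M : ℕ} {π π' : ℕ → Equiv.Perm (Fin (N + 1))} {h : ℕ → ℝ}
    {X Z X' Z' : ℕ → Fin (N + 1) → ℝ}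
    (H : ∀ l ≤ M + 2, ∀ j, ∃ k, X l j = X' l k ∧ Z l j = Z' l k ∧
      X (nextPage M l) (π l j) = X' (nextPage M l) (π' l k) ∧
      Z (nextPage M l) (π l j) = Z' (nextPage M l) (π' l k)) :
    pageEdges M π h X Z ⊆ pageEdges M π' h X' Z' := by
  rintro e ⟨l, hl, j, rfl⟩
  obtain ⟨k, h1, h2, h3, h4⟩ := H l hl j
  exact ⟨l, hl, k, by rw [h1, h2, h3, h4]⟩

/-- The strands of the letters `a, ..., a + r - 1` can be arranged in layers, `lam q j` being the
layer of the strand at position `j` before letter `q`, such that the overcrossing strand of each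
of these letters lies in the higher layer. -/
structure Layered {N : ℕ} (a r : ℕ) (g : ℕ → Letter N) (lam : ℕ → Fin (N + 1) → ℝ) : Prop where
  inj : ∀ q, a ≤ q → q ≤ a + r → Function.Injective (lam q)
  nonneg : ∀ q, a ≤ q → q ≤ a + r → ∀ j, 0 ≤ lam q j
  transport : ∀ q, a ≤ q → q < a + r → ∀ j, lam (q + 1) (padPerm (g q) j) = lam q j
  above : ∀ q, a ≤ q → q < a + r → ∀ j k, j ≠ k → padPerm (g q) j = k → padPerm (g q) k = j →
    0 < (lam q j - lam q k) * (padLift (g q) j - padLift (g q) k)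

open Classical in
/-- First coordinates after moving the strands of a subword into layers. -/
noncomputable def layX {N : ℕ} (m a r : ℕ) (g : ℕ → Letter N) (l : ℕ) (j : Fin (N + 1)) : ℝ :=
  if 2 * a < l ∧ l < 2 * (a + r) then 0 else wordX m g l j

open Classical in
/-- Lifts after moving the strands of a subword into layers. -/
noncomputable def layZ {N : ℕ} (m a r : ℕ) (g : ℕ → Letter N) (lam : ℕ → Fin (N + 1) → ℝ)
    (l : ℕ) (j : Fin (N + 1)) : ℝ :=
  if 2 * a < l ∧ l < 2 * (a + r) then lam (l / 2) j else wordZ m g l j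

section
variable {N : ℕ} {m a r : ℕ} {g : ℕ → Letter N} {lam : ℕ → Fin (N + 1) → ℝ}

theorem layX_in {l : ℕ} (h : 2 * a < l) (h' : l < 2 * (a + r)) (j : Fin (N + 1)) :
    layX m a r g l j = 0 := if_pos ⟨h, h'⟩

theorem layZ_in {l : ℕ} (h : 2 * a < l) (h' : l < 2 * (a + r)) (j : Fin (N + 1)) :
    layZ m a r g lam l j = lam (l / 2) j := if_pos ⟨h, h'⟩

theorem layX_out {l : ℕ} (h : l ≤ 2 * a ∨ 2 * (a + r) ≤ l) (j : Fin (N + 1)) :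
    layX m a r g l j = wordX m g l j := if_neg (by omega)

theorem layZ_out {l : ℕ} (h : l ≤ 2 * a ∨ 2 * (a + r) ≤ l) (j : Fin (N + 1)) :
    layZ m a r g lam l j = wordZ m g l j := if_neg (by omega)

/-- The differences of the coordinates of two strands in two consecutive pages lie in a cone, before
and after moving the strands into layers. -/
theorem Layered.cone (H : Layered a r g lam) {l : ℕ} (hl : l < 2 * m)
    {j k : Fin (N + 1)} (hjk : j ≠ k) : ∃ σ κ,
    InCone σ κ (wordX m g l j - wordX m g l k) (wordZ m g l j - wordZ m g l k) ∧
    InCone σ κ (layX m a r g l j - layX m a r g l k)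
      (layZ m a r g lam l j - layZ m a r g lam l k) ∧
    InCone σ κ
      (wordX m g (l + 1) (wordPerm m g l j) - wordX m g (l + 1) (wordPerm m g l k))
      (wordZ m g (l + 1) (wordPerm m g l j) - wordZ m g (l + 1) (wordPerm m g l k)) ∧
    InCone σ κ
      (layX m a r g (l + 1) (wordPerm m g l j) - layX m a r g (l + 1) (wordPerm m g l k))
      (layZ m a r g lam (l + 1) (wordPerm m g l j) -
        layZ m a r g lam (l + 1) (wordPerm m g l k)) := by
  obtain ⟨q, hq⟩ : ∃ q, q = l / 2 := ⟨_, rfl⟩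
  have hqm : q < m := by omega
  by_cases hw : a ≤ q ∧ q < a + r
  · have hκ : lam q j - lam q k ≠ 0 :=
      sub_ne_zero.2 fun h => hjk (H.inj q hw.1 hw.2.le h)
    have hκ2 := mul_self_pos.2 hκ
    -- Inside the subword κ is the difference of the layers. A crossing pair is ordered by its lifts
    -- as by its layers, so the differences before the move lie in the same cone as those after it,
    -- where the first coordinates coincide.
    obtain ⟨⟨σ, a1, a2⟩, ⟨τ, b1, b2⟩⟩ := letter_cone (g q) hjk (κ := lam q j - lam q k)
      (H.above q hw.1 hw.2 j k hjk)
    obtain rfl | rfl : l = 2 * q ∨ l = 2 * q + 1 := by omega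
    · refine ⟨σ, lam q j - lam q k, ?_⟩
      simp only [wordPerm_even m g (Nat.mul_mod_right 2 q),
        wordX_even m g (Nat.mul_mod_right 2 q), wordZ_even m g (Nat.mul_mod_right 2 q),
        wordX_odd m g hqm, wordZ_odd m g hqm, Equiv.Perm.coe_one, id,
        layX_in (show 2 * a < 2 * q + 1 by omega) (show 2 * q + 1 < 2 * (a + r) by omega),
        layZ_in (show 2 * a < 2 * q + 1 by omega) (show 2 * q + 1 < 2 * (a + r) by omega)]
      refine ⟨Or.inl a1, ?_, a2, Or.inr ⟨by ring, ?_⟩⟩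
      · by_cases h0 : q = a
        · rw [layX_out (by omega), layX_out (by omega), wordX_even m g (by omega),
            wordX_even m g (by omega)]
          exact Or.inl a1
        · rw [layX_in (by omega) (by omega), layX_in (by omega) (by omega),
            layZ_in (by omega) (by omega), layZ_in (by omega) (by omega),
            show 2 * q / 2 = q by omega]
          exact Or.inr ⟨by ring, hκ2⟩
      · rw [show (2 * q + 1) / 2 = q by omega]; exact hκ2
    · refine ⟨τ, lam q j - lam q k, ?_⟩
      simp only [wordPerm_odd m g hqm, show 2 * q + 1 + 1 = 2 * (q + 1) by ring,
        wordX_even m g (Nat.mul_mod_right 2 (q + 1)), wordZ_even m g (Nat.mul_mod_right 2 (q + 1)),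
        wordX_odd m g hqm, wordZ_odd m g hqm,
        layX_in (show 2 * a < 2 * q + 1 by omega) (show 2 * q + 1 < 2 * (a + r) by omega),
        layZ_in (show 2 * a < 2 * q + 1 by omega) (show 2 * q + 1 < 2 * (a + r) by omega)]
      refine ⟨b2, Or.inr ⟨by ring, ?_⟩, Or.inl b1, ?_⟩
      · rw [show (2 * q + 1) / 2 = q by omega]; exact hκ2
      · by_cases h0 : q + 1 = a + r
        · rw [layX_out (by omega), layX_out (by omega), wordX_even m g (by omega),
            wordX_even m g (by omega)]
          exact Or.inl b1
        · rw [layX_in (by omega) (by omega), layX_in (by omega) (by omega),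
            layZ_in (by omega) (by omega), layZ_in (by omega) (by omega),
            show 2 * (q + 1) / 2 = q + 1 by omega, H.transport q hw.1 hw.2,
            H.transport q hw.1 hw.2]
          exact Or.inr ⟨by ring, hκ2⟩
  · rw [layX_out (by omega), layX_out (by omega), layZ_out (by omega), layZ_out (by omega),
      layX_out (by omega), layX_out (by omega), layZ_out (by omega), layZ_out (by omega)]
    obtain ⟨⟨σ, a1, a2⟩, ⟨τ, b1, b2⟩⟩ := letter_cone (g q) hjk (letter_pair_sign (g q) hjk)
    obtain rfl | rfl : l = 2 * q ∨ l = 2 * q + 1 := by omega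
    · refine ⟨σ, padLift (g q) j - padLift (g q) k, ?_⟩
      simp only [wordPerm_even m g (Nat.mul_mod_right 2 q),
        wordX_even m g (Nat.mul_mod_right 2 q), wordZ_even m g (Nat.mul_mod_right 2 q),
        wordX_odd m g hqm, wordZ_odd m g hqm, Equiv.Perm.coe_one, id]
      exact ⟨Or.inl a1, Or.inl a1, a2, a2⟩
    · refine ⟨τ, padLift (g q) j - padLift (g q) k, ?_⟩
      simp only [wordPerm_odd m g hqm, show 2 * q + 1 + 1 = 2 * (q + 1) by ring,
        wordX_even m g (Nat.mul_mod_right 2 (q + 1)), wordZ_even m g (Nat.mul_mod_right 2 (q + 1)),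
        wordX_odd m g hqm, wordZ_odd m g hqm]
      exact ⟨b2, b2, Or.inl b1, Or.inl b1⟩

theorem layX_back (har : a + r ≤ m) {l : ℕ} (h : 2 * m ≤ l) (j : Fin (N + 1)) :
    layX m a r g (nextPage (2 * m) l) j = j := by
  rw [layX_out (by unfold nextPage; split_ifs <;> omega), wordX_back m g h]

/-- The closed braid with the strands of a subword in layers. -/
theorem Layered.braided (H : Layered a r g lam) (har : a + r ≤ m) :
    Braided (2 * m) (wordPerm m g) wordH (layX m a r g) (layZ m a r g lam) := by
  have hZ : ∀ l j, 0 ≤ layZ m a r g lam l j := by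
    intro l j
    unfold layZ; split_ifs with h
    · exact H.nonneg _ (by omega) (by omega) j
    · exact wordZ_nonneg m g l j
  refine ⟨(braided_word m g).decr, fun l _ j => by linarith [hZ l j], hZ 0, hZ _, hZ _, hZ _,
    ?_, ?_⟩
  · intro l hl j k hjk
    obtain ⟨σ, κ, -, h1, -, h2⟩ := H.cone hl hjk
    exact h1.apart h2
  · intro l hl hl' j k hjk
    rw [layX_back har hl, layX_back har hl, layX_out (by omega), layX_out (by omega),
      wordPerm_ge m g hl, wordX_ge m g hl, wordX_ge m g hl]
    exact separated_fin hjk _ _ _ _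

/-- Cones are convex in the deformation parameter as well as along the strand, so the linear
deformation into layers creates no collision. -/
theorem Layered.toLink_eq (H : Layered a r g lam) (har : a + r ≤ m) :
    wordLink m g = (H.braided har).poly.toLink := by
  refine (braided_word m g).toLink_eq (H.braided har) ?_ ?_
  · intro t ht ht1 l hl j k hjk
    obtain ⟨σ, κ, h1, h2, h3, h4⟩ := H.cone hl hjk
    exact (h1.convex h2 ht ht1).apart (h3.convex h4 ht ht1)
  · intro t ht ht1 l hl hl' j k hjk
    dsimp only
    simp only [layX_back har hl, layX_out (Or.inr (show 2 * (a + r) ≤ l by omega)),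
      wordPerm_ge m g hl, wordX_ge m g hl, wordX_back m g hl, Equiv.Perm.coe_one, id]
    have e : ∀ x : ℝ, (1 - t) * x + t * x = x := fun x => by ring
    simp only [e]
    exact separated_fin hjk _ _ _ _

/-- The layers are only permuted along the subword. Two words with the same initial layers therefore
occupy the same layers in every page. -/
theorem Layered.exists_perm (H : Layered a r g lam) {q : ℕ} (hq : a ≤ q) (hq' : q ≤ a + r) :
    ∃ ρ : Equiv.Perm (Fin (N + 1)), ∀ j, lam q (ρ j) = lam a j := by
  induction q, hq using Nat.le_induction with
  | base => exact ⟨1, fun j => rfl⟩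
  | succ n hn ih =>
    obtain ⟨ρ, hρ⟩ := ih (by omega)
    refine ⟨ρ.trans (padPerm (g n)), fun j => ?_⟩
    rw [Equiv.trans_apply, H.transport n hn (by omega), hρ]

/-- Inside the subword all first coordinates are zero after the move, so a strand is determined by
its layer and the crossings have become invisible. What remains of the subword is where each layer
enters and leaves. -/
theorem Layered.edges_subset {g' : ℕ → Letter N} {lam' : ℕ → Fin (N + 1) → ℝ}
    (H : Layered a r g lam) (H' : Layered a r g' lam') (har : a + r ≤ m)
    (hout : ∀ q, q < a ∨ a + r ≤ q → g q = g' q) (h0 : lam a = lam' a)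
    (h1 : lam (a + r) = lam' (a + r)) :
    pageEdges (2 * m) (wordPerm m g) wordH (layX m a r g) (layZ m a r g lam) ⊆
      pageEdges (2 * m) (wordPerm m g') wordH (layX m a r g') (layZ m a r g' lam') := by
  -- pages outside the subword
  have hX : ∀ l j, l ≤ 2 * a ∨ 2 * (a + r) ≤ l → layX m a r g l j = layX m a r g' l j := by
    intro l j hl
    rw [layX_out hl, layX_out hl, wordX, wordX]
    split_ifs with h
    · rw [hout (l / 2) (by omega)]
    · rfl
  have hZ : ∀ l j, l ≤ 2 * a ∨ 2 * (a + r) ≤ l →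
      layZ m a r g lam l j = layZ m a r g' lam' l j := by
    intro l j hl
    rw [layZ_out hl, layZ_out hl, wordZ, wordZ]
    split_ifs with h
    · rw [hout (l / 2) (by omega)]
    · rfl
  refine pageEdges_subset fun l hl j => ?_
  rcases lt_or_ge l (2 * m) with hlm | hlm
  swap
  · refine ⟨j, hX _ _ (by omega), hZ _ _ (by omega), ?_, ?_⟩ <;>
      rw [wordPerm_ge m g hlm, wordPerm_ge m g' hlm]
    · exact hX _ _ (by unfold nextPage; split_ifs <;> omega)
    · exact hZ _ _ (by unfold nextPage; split_ifs <;> omega)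
  rw [nextPage_front hlm]
  by_cases hw : 2 * a ≤ l ∧ l < 2 * (a + r)
  swap
  · have : wordPerm m g l = wordPerm m g' l := by
      rw [wordPerm, wordPerm]
      split_ifs with h
      · rw [hout (l / 2) (by omega)]
      · rfl
    rw [this]
    exact ⟨j, hX _ _ (by omega), hZ _ _ (by omega), hX _ _ (by omega), hZ _ _ (by omega)⟩
  obtain ⟨q, hq⟩ : ∃ q, q = l / 2 := ⟨_, rfl⟩
  -- a strand of the other word in the same layer
  have hlam : ∃ k, lam' q k = lam q j := by
    obtain ⟨ρ, hρ⟩ := H.exists_perm (q := q) (by omega) (by omega)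
    obtain ⟨ρ', hρ'⟩ := H'.exists_perm (q := q) (by omega) (by omega)
    refine ⟨ρ' (ρ.symm j), ?_⟩
    rw [hρ', ← h0, ← hρ]; simp
  obtain rfl | rfl : l = 2 * q ∨ l = 2 * q + 1 := by omega
  · rw [wordPerm_even m g (by omega), wordPerm_even m g' (by omega)]
    by_cases hqa : q = a
    · subst hqa
      refine ⟨j, hX _ _ (by omega), hZ _ _ (by omega), ?_, ?_⟩
      · rw [layX_in (by omega) (by omega), layX_in (by omega) (by omega)]
      · rw [layZ_in (by omega) (by omega), layZ_in (by omega) (by omega),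
          show (2 * q + 1) / 2 = q by omega, h0]
    · obtain ⟨k, hk⟩ := hlam
      refine ⟨k, ?_, ?_, ?_, ?_⟩
      · rw [layX_in (by omega) (by omega), layX_in (by omega) (by omega)]
      · rw [layZ_in (by omega) (by omega), layZ_in (by omega) (by omega),
          show 2 * q / 2 = q by omega, hk]
      · rw [layX_in (by omega) (by omega), layX_in (by omega) (by omega)]
      · rw [layZ_in (by omega) (by omega), layZ_in (by omega) (by omega),
          show (2 * q + 1) / 2 = q by omega, Equiv.Perm.coe_one, id, id, hk]
  · have hqm : q < m := by omega
    rw [wordPerm_odd m g hqm, wordPerm_odd m g' hqm, show 2 * q + 1 + 1 = 2 * (q + 1) by ring]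
    by_cases hqa : q + 1 = a + r
    · obtain ⟨k, hk⟩ := (padPerm (g' q)).surjective (padPerm (g q) j)
      refine ⟨k, ?_, ?_, ?_, ?_⟩
      · rw [layX_in (by omega) (by omega), layX_in (by omega) (by omega)]
      · rw [layZ_in (by omega) (by omega), layZ_in (by omega) (by omega),
          show (2 * q + 1) / 2 = q by omega, ← H.transport q (by omega) (by omega),
          ← H'.transport q (by omega) (by omega), hk, hqa, h1]
      · rw [hk]; exact hX _ _ (by omega)
      · rw [hk]; exact hZ _ _ (by omega)
    · obtain ⟨k, hk⟩ := hlam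
      refine ⟨k, ?_, ?_, ?_, ?_⟩
      · rw [layX_in (by omega) (by omega), layX_in (by omega) (by omega)]
      · rw [layZ_in (by omega) (by omega), layZ_in (by omega) (by omega),
          show (2 * q + 1) / 2 = q by omega, hk]
      · rw [layX_in (by omega) (by omega), layX_in (by omega) (by omega)]
      · rw [layZ_in (by omega) (by omega), layZ_in (by omega) (by omega),
          show 2 * (q + 1) / 2 = q + 1 by omega, H.transport q (by omega) (by omega),
          H'.transport q (by omega) (by omega), hk]

/-- A subword can be replaced by another one with the same layers. -/
theorem Layered.wordLink_eq {g' : ℕ → Letter N} {lam' : ℕ → Fin (N + 1) → ℝ}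
    (H : Layered a r g lam) (H' : Layered a r g' lam') (har : a + r ≤ m)
    (hout : ∀ q, q < a ∨ a + r ≤ q → g q = g' q) (h0 : lam a = lam' a)
    (h1 : lam (a + r) = lam' (a + r)) : wordLink m g = wordLink m g' := by
  rw [H.toLink_eq har, H'.toLink_eq har]
  refine congrArg PolyLink.toLink (PolyLink.ext_edges ?_)
  rw [Braided.poly_edges, Braided.poly_edges]
  exact Set.Subset.antisymm (H.edges_subset H' har hout h0 h1)
    (H'.edges_subset H har (fun q hq => (hout q hq).symm) h0.symm h1.symm)

end

/-! ### Relations between padded words -/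

/-- The letters of a padded word, continued by trivial letters. -/
def padFn {N : ℕ} (w : List (Letter N)) (q : ℕ) : Letter N := (w[q]?).getD none

/-- The link that is the closure of a padded word. -/
noncomputable def padLink {N : ℕ} (w : List (Letter N)) : Link := wordLink w.length (padFn w)

theorem padFn_append_left {N : ℕ} (A B : List (Letter N)) {q : ℕ} (h : q < A.length) :
    padFn (A ++ B) q = padFn A q := by rw [padFn, padFn, List.getElem?_append_left h]

theorem padFn_append_right {N : ℕ} (A B : List (Letter N)) {q : ℕ} (h : A.length ≤ q) :
    padFn (A ++ B) q = padFn B (q - A.length) := by rw [padFn, padFn, List.getElem?_append_right h]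

theorem padPerm_padPerm {N : ℕ} (g : Letter N) (j : Fin (N + 1)) : padPerm g (padPerm g j) = j := by
  cases g <;> simp [padPerm, letterPerm]

/-- The overcrossing strand of a letter lies in the higher layer. -/
def LetterAbove {N : ℕ} (g : Letter N) (f : Fin (N + 1) → ℝ) : Prop :=
  match g with
  | none => True
  | some (i, true) => f i.castSucc < f i.succ
  | some (i, false) => f i.succ < f i.castSucc

/-- The overcrossing strands of the letters of a word lie in the higher layers. -/
def ListAbove {N : ℕ} : List (Letter N) → (Fin (N + 1) → ℝ) → Prop
  | [], _ => True
  | g :: u, f => LetterAbove g f ∧ ListAbove u fun j => f (padPerm g j)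

/-- The layers of the strands after a word. -/
def layersAfter {N : ℕ} : List (Letter N) → (Fin (N + 1) → ℝ) → Fin (N + 1) → ℝ
  | [], f => f
  | g :: u, f => layersAfter u fun j => f (padPerm g j)

theorem LetterAbove.pos {N : ℕ} {g : Letter N} {f : Fin (N + 1) → ℝ} (h : LetterAbove g f)
    {j k : Fin (N + 1)} (hjk : j ≠ k) (h1 : padPerm g j = k) :
    0 < (f j - f k) * (padLift g j - padLift g k) := by
  rcases g with _ | ⟨i, b⟩
  · exact absurd h1 hjk
  · have hne : i.castSucc ≠ i.succ := Fin.castSucc_lt_succ.ne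
    have hcases : (j = i.castSucc ∧ k = i.succ) ∨ (j = i.succ ∧ k = i.castSucc) := by
      have := letterPerm_cases (i, b) j
      rw [show letterPerm (i, b) j = k from h1] at this
      simp only [Fin.ext_iff, Fin.val_castSucc, Fin.val_succ] at this ⊢
      rcases this with h | h | h
      · exact Or.inl h
      · exact Or.inr h
      · exact absurd (Fin.ext h.2.2.symm) hjk
    rcases hcases with ⟨rfl, rfl⟩ | ⟨rfl, rfl⟩ <;> cases b <;>
      simp only [LetterAbove, padLift, letterOver, hne, hne.symm, if_true, if_false,
        Bool.false_eq_true] at h ⊢ <;> linarith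

theorem layersAfter_take_succ {N : ℕ} (u : List (Letter N)) (f : Fin (N + 1) → ℝ) {q : ℕ}
    (hq : q < u.length) (j : Fin (N + 1)) :
    layersAfter (u.take (q + 1)) f j = layersAfter (u.take q) f (padPerm (padFn u q) j) := by
  induction u generalizing f q with
  | nil => simp at hq
  | cons g u ih =>
    cases q with
    | zero => simp [layersAfter, padFn]
    | succ q =>
      simp only [List.take_succ_cons, layersAfter]
      rw [ih _ (by simpa using hq)]
      simp [padFn]

theorem ListAbove.letterAbove {N : ℕ} (u : List (Letter N)) (f : Fin (N + 1) → ℝ)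
    (h : ListAbove u f) {q : ℕ} (hq : q < u.length) :
    LetterAbove (padFn u q) (layersAfter (u.take q) f) := by
  induction u generalizing f q with
  | nil => simp at hq
  | cons g u ih =>
    cases q with
    | zero => exact h.1
    | succ q => exact ih _ h.2 (by simpa using hq)

theorem layersAfter_injective {N : ℕ} (u : List (Letter N)) (f : Fin (N + 1) → ℝ)
    (h : Function.Injective f) : Function.Injective (layersAfter u f) := by
  induction u generalizing f with
  | nil => exact h
  | cons g u ih => exact ih _ (h.comp (padPerm g).injective)

theorem layersAfter_nonneg {N : ℕ} (u : List (Letter N)) (f : Fin (N + 1) → ℝ)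
    (h : ∀ j, 0 ≤ f j) (j : Fin (N + 1)) : 0 ≤ layersAfter u f j := by
  induction u generalizing f with
  | nil => exact h j
  | cons g u ih => exact ih _ fun j => h _

/-- Conditions that can be checked letter by letter on a concrete word yield layers for it in any
context `A`, `B`. -/
theorem ListAbove.layered {N : ℕ} {u : List (Letter N)} {f : Fin (N + 1) → ℝ}
    (h : ListAbove u f) (hf : Function.Injective f) (hf0 : ∀ j, 0 ≤ f j)
    (A B : List (Letter N)) : Layered A.length u.length (padFn (A ++ (u ++ B)))
      fun q => layersAfter (u.take (q - A.length)) f := by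
  have hg : ∀ q, A.length ≤ q → q < A.length + u.length →
      padFn (A ++ (u ++ B)) q = padFn u (q - A.length) := by
    intro q h1 h2
    rw [padFn_append_right _ _ h1, padFn_append_left _ _ (by omega)]
  refine ⟨fun q _ _ => layersAfter_injective _ _ hf, fun q _ _ => layersAfter_nonneg _ _ hf0,
    ?_, ?_⟩
  · intro q h1 h2 j
    rw [hg q h1 h2, show q + 1 - A.length = (q - A.length) + 1 by omega,
      layersAfter_take_succ _ _ (by omega), padPerm_padPerm]
  · intro q h1 h2 j k hjk h3 _
    rw [hg q h1 h2] at h3 ⊢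
    exact (h.letterAbove u f (q := q - A.length) (by omega)).pos hjk h3

/-- A subword can be replaced by another one of the same length with the same layers. -/
theorem padLink_replace {N : ℕ} {u v : List (Letter N)} (f : Fin (N + 1) → ℝ)
    (hf : Function.Injective f) (hf0 : ∀ j, 0 ≤ f j) (hlen : u.length = v.length)
    (hu : ListAbove u f) (hv : ListAbove v f) (huv : layersAfter u f = layersAfter v f)
    (A B : List (Letter N)) : padLink (A ++ (u ++ B)) = padLink (A ++ (v ++ B)) := by
  have h1 := hu.layered hf hf0 A B
  have h2 := hv.layered hf hf0 A B
  rw [← hlen] at h2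
  have hm : (A ++ (v ++ B)).length = (A ++ (u ++ B)).length := by simp [hlen]
  rw [padLink, padLink, hm]
  refine h1.wordLink_eq h2 (by simp) ?_ ?_ ?_
  · rintro q (hq | hq)
    · rw [padFn_append_left _ _ hq, padFn_append_left _ _ hq]
    · rw [padFn_append_right _ _ (by omega), padFn_append_right _ _ (by omega),
        padFn_append_right _ _ (by omega), padFn_append_right _ _ (by omega), hlen]
  · simp [layersAfter]
  · simp only [Nat.add_sub_cancel_left]
    rw [List.take_length, hlen, List.take_length, huv]

theorem val_injective {N : ℕ} : Function.Injective fun j : Fin (N + 1) => (j : ℝ) :=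
  fun _ _ h => finVal_inj h

theorem sub_val_injective {N : ℕ} : Function.Injective fun j : Fin (N + 1) => (N : ℝ) - j :=
  fun _ _ h => finVal_inj (by simpa using h)

theorem val_nonneg {N : ℕ} (j : Fin (N + 1)) : (0 : ℝ) ≤ j := Nat.cast_nonneg _

theorem sub_val_nonneg {N : ℕ} (j : Fin (N + 1)) : (0 : ℝ) ≤ (N : ℝ) - j := by
  have : (j : ℕ) ≤ N := Nat.lt_succ_iff.1 j.2
  have : ((j : ℕ) : ℝ) ≤ N := by exact_mod_cast this
  linarith

section
variable {N : ℕ} (A B : List (Letter N))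

/-- The same strand is on top in both letters, so the two strands can be layered, with layers
increasing from left to right or from right to left according to the sign. The right side has two
trivial letters because the comparison requires equal lengths. -/
theorem padLink_cancel (i : Fin N) (b : Bool) :
    padLink (A ++ ([some (i, b), some (i, !b)] ++ B)) = padLink (A ++ ([none, none] ++ B)) := by
  have hlt : ((i.castSucc : Fin (N + 1)) : ℝ) < (i.succ : Fin (N + 1)) :=
    fin_cast_lt Fin.castSucc_lt_succ
  cases b
  · refine padLink_replace (u := [some (i, false), some (i, true)]) (v := [none, none]) _ sub_val_injective sub_val_nonneg rfl ?_ ?_ ?_ A B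
    · simp only [ListAbove, LetterAbove, padPerm, letterPerm, Equiv.swap_apply_left,
        Equiv.swap_apply_right, and_true]
      constructor <;> linarith
    · simp [ListAbove, LetterAbove]
    · simp [layersAfter, padPerm, letterPerm]
  · refine padLink_replace (u := [some (i, true), some (i, false)]) (v := [none, none]) _ val_injective val_nonneg rfl ?_ ?_ ?_ A B
    · simp only [ListAbove, LetterAbove, padPerm, letterPerm, Equiv.swap_apply_left,
        Equiv.swap_apply_right, and_true]
      constructor <;> linarith
    · simp [ListAbove, LetterAbove]
    · simp [layersAfter, padPerm, letterPerm]

theorem padLink_swap_none (g : Letter N) :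
    padLink (A ++ ([none, g] ++ B)) = padLink (A ++ ([g, none] ++ B)) := by
  rcases g with _ | ⟨i, b⟩
  · rfl
  have hlt : ((i.castSucc : Fin (N + 1)) : ℝ) < (i.succ : Fin (N + 1)) :=
    fin_cast_lt Fin.castSucc_lt_succ
  cases b
  · refine padLink_replace (u := [none, some (i, false)]) (v := [some (i, false), none]) _ sub_val_injective sub_val_nonneg rfl ?_ ?_ rfl A B
    · simp only [ListAbove, LetterAbove, padPerm, Equiv.Perm.coe_one, id, true_and, and_true]
      linarith
    · simp only [ListAbove, LetterAbove, and_true]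
      linarith
  · refine padLink_replace (u := [none, some (i, true)]) (v := [some (i, true), none]) _ val_injective val_nonneg rfl ?_ ?_ rfl A B
    · simpa only [ListAbove, LetterAbove, padPerm, Equiv.Perm.coe_one, id, true_and, and_true]
    · simpa only [ListAbove, LetterAbove, and_true]

/-- Both words are positive, so layers that increase from left to right fit both, and the two
disjoint transpositions commute. -/
theorem padLink_comm (i j : Fin N) (hij : (i : ℕ) + 2 ≤ j) :
    padLink (A ++ ([some (i, true), some (j, true)] ++ B)) =
      padLink (A ++ ([some (j, true), some (i, true)] ++ B)) := by
  have hi : ((i.castSucc : Fin (N + 1)) : ℝ) < (i.succ : Fin (N + 1)) :=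
    fin_cast_lt Fin.castSucc_lt_succ
  have hj : ((j.castSucc : Fin (N + 1)) : ℝ) < (j.succ : Fin (N + 1)) :=
    fin_cast_lt Fin.castSucc_lt_succ
  have h1 : i.castSucc ≠ j.castSucc := by simp [Fin.ext_iff]; omega
  have h2 : i.castSucc ≠ j.succ := by simp [Fin.ext_iff]; omega
  have h3 : i.succ ≠ j.castSucc := by simp [Fin.ext_iff]; omega
  have h4 : i.succ ≠ j.succ := by simp [Fin.ext_iff]; omega
  refine padLink_replace (u := [some (i, true), some (j, true)]) (v := [some (j, true), some (i, true)]) _ val_injective val_nonneg rfl ?_ ?_ ?_ A B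
  · simp only [ListAbove, LetterAbove, padPerm, letterPerm, and_true]
    rw [Equiv.swap_apply_of_ne_of_ne h1.symm h3.symm, Equiv.swap_apply_of_ne_of_ne h2.symm h4.symm]
    exact ⟨hi, hj⟩
  · simp only [ListAbove, LetterAbove, padPerm, letterPerm, and_true]
    rw [Equiv.swap_apply_of_ne_of_ne h1 h2, Equiv.swap_apply_of_ne_of_ne h3 h4]
    exact ⟨hj, hi⟩
  · ext1 x
    simp only [layersAfter, padPerm, letterPerm]
    rw [← Equiv.Perm.mul_apply, ← Equiv.Perm.mul_apply,
      (Equiv.Perm.disjoint_swap_swap (by simp [h1, h2, h3, h4, Fin.castSucc_lt_succ.ne])).commute.eq]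

/-- On either side each pair of the three strands crosses once, with the strand that starts farther
right on top. Layers that increase from left to right fit both sides, and only the equality of the
two permutations has to be checked. -/
theorem padLink_braid (i j : Fin N) (hij : (i : ℕ) + 1 = j) :
    padLink (A ++ ([some (i, true), some (j, true), some (i, true)] ++ B)) =
      padLink (A ++ ([some (j, true), some (i, true), some (j, true)] ++ B)) := by
  have hi : ((i.castSucc : Fin (N + 1)) : ℝ) < (i.succ : Fin (N + 1)) :=
    fin_cast_lt Fin.castSucc_lt_succ
  have hj : ((j.castSucc : Fin (N + 1)) : ℝ) < (j.succ : Fin (N + 1)) :=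
    fin_cast_lt Fin.castSucc_lt_succ
  have e : j.castSucc = i.succ := by simp [Fin.ext_iff]; omega
  have h2 : i.castSucc ≠ j.succ := by simp [Fin.ext_iff]; omega
  have h4 : i.succ ≠ j.succ := by simp [Fin.ext_iff]; omega
  have h5 : i.castSucc ≠ i.succ := Fin.castSucc_lt_succ.ne
  rw [e] at hj
  refine padLink_replace (u := [some (i, true), some (j, true), some (i, true)]) (v := [some (j, true), some (i, true), some (j, true)]) _ val_injective val_nonneg rfl ?_ ?_ ?_ A B
  · simp only [ListAbove, LetterAbove, padPerm, letterPerm, and_true, e, Equiv.swap_apply_left,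
      Equiv.swap_apply_right, Equiv.swap_apply_of_ne_of_ne h2.symm h4.symm,
      Equiv.swap_apply_of_ne_of_ne h5 h2]
    exact ⟨hi, hi.trans hj, hj⟩
  · simp only [ListAbove, LetterAbove, padPerm, letterPerm, and_true, e, Equiv.swap_apply_left,
      Equiv.swap_apply_right, Equiv.swap_apply_of_ne_of_ne h2.symm h4.symm,
      Equiv.swap_apply_of_ne_of_ne h5 h2]
    exact ⟨hj, hi.trans hj, hi⟩
  · ext1 x
    simp only [layersAfter, padPerm, letterPerm, e]
    have h6 := Equiv.swap_mul_swap_mul_swap h4.symm h2.symm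
    have h7 := Equiv.swap_mul_swap_mul_swap h5 h2
    rw [Equiv.swap_comm i.succ i.castSucc, Equiv.swap_comm j.succ i.succ] at h6
    have h8 := DFunLike.congr_fun (h6.trans ((Equiv.swap_comm _ _).trans h7.symm)) x
    simp only [Equiv.Perm.mul_apply] at h8
    rw [h8]

end

/-! ### Removing collinear vertices -/

/-- The variant of `exists_remove_vertex` for edge sets given by insertion. The hull condition also
shows that the two removed edges are not repeated in `E`, because they contain `c`, which is neither
`a` nor `b`. -/
theorem exists_remove_insert (K : PolyLink) {a b c : Space} {E : Set (Space × Space)}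
    (hK : K.edges = insert (a, c) (insert (c, b) E))
    (hull : ∀ e ∈ E, convexHull ℝ {a, b, c} ∩ segment ℝ e.1 e.2 ⊆ {a, b}) :
    ∃ L : PolyLink, L.edges = insert (a, b) E ∧ L.toLink = K.toLink := by
  have hac : (a, c) ∈ K.edges := by rw [hK]; simp
  have hcb : (c, b) ∈ K.edges := by rw [hK]; simp
  have hc : c ∉ ({a, b} : Set Space) := by
    rintro (h | h)
    · exact K.proper _ hac h.symm
    · exact K.proper _ hcb h
  have h1 : (a, c) ∉ E := fun h => hc (hull _ h
    ⟨subset_convexHull ℝ _ (by simp), right_mem_segment ℝ _ _⟩)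
  have h2 : (c, b) ∉ E := fun h => hc (hull _ h
    ⟨subset_convexHull ℝ _ (by simp), left_mem_segment ℝ _ _⟩)
  obtain ⟨L, hL, hLK⟩ := exists_remove_vertex K hac hcb fun e he h h' => by
    rw [hK] at he
    rcases he with rfl | rfl | he
    · exact absurd rfl h
    · exact absurd rfl h'
    · exact hull e he
  refine ⟨L, ?_, hLK⟩
  rw [hL, hK]
  ext e
  simp only [Set.mem_union, Set.mem_sdiff, Set.mem_insert_iff, Set.mem_singleton_iff]
  constructor
  · tauto
  · rintro (h | h)
    · exact Or.inr h
    · refine Or.inl ⟨Or.inr (Or.inr h), ?_⟩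
      rintro (rfl | rfl)
      · exact h1 h
      · exact h2 h

theorem exists_merge_insert (K : PolyLink) {a b c : Space} {E : Set (Space × Space)}
    (hK : K.edges = insert (a, c) (insert (c, b) E)) (hc : c ∈ segment ℝ a b)
    (ha : ∀ e ∈ E, e.1 ≠ a ∧ e.1 ≠ c) :
    ∃ L : PolyLink, L.edges = insert (a, b) E ∧ L.toLink = K.toLink := by
  have hac : (a, c) ∈ K.edges := by rw [hK]; simp
  have hcb : (c, b) ∈ K.edges := by rw [hK]; simp
  obtain ⟨L, hL, hLK⟩ := exists_merge K hac hcb hc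
  refine ⟨L, ?_, hLK⟩
  rw [hL, hK]
  ext e
  simp only [Set.mem_union, Set.mem_sdiff, Set.mem_insert_iff, Set.mem_singleton_iff]
  constructor
  · tauto
  · rintro (h | h)
    · exact Or.inr h
    · refine Or.inl ⟨Or.inr (Or.inr h), ?_⟩
      rintro (rfl | rfl)
      · exact (ha _ h).1 rfl
      · exact (ha _ h).2 rfl

/-- The edges of a path with `n + 1` vertices. -/
def pathEdges (v : ℕ → Space) (n : ℕ) : Set (Space × Space) := {e | ∃ l < n, e = (v l, v (l + 1))}

theorem pathEdges_succ (v : ℕ → Space) (n : ℕ) :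
    pathEdges v (n + 1) = insert (v n, v (n + 1)) (pathEdges v n) := by
  ext e
  simp only [pathEdges, Set.mem_ofPred_eq, Set.mem_insert_iff]
  constructor
  · rintro ⟨l, hl, rfl⟩
    rcases (Nat.lt_succ_iff.1 hl).eq_or_lt with rfl | h
    · exact Or.inl rfl
    · exact Or.inr ⟨l, h, rfl⟩
  · rintro (rfl | ⟨l, hl, rfl⟩)
    · exact ⟨n, by omega, rfl⟩
    · exact ⟨l, by omega, rfl⟩

/-- The vertices are removed from the far end of the path, so that each is always adjacent to `b`
when its turn comes. -/
theorem exists_merge_path (n : ℕ) (v : ℕ → Space) (K : PolyLink) {b : Space}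
    {E : Set (Space × Space)} (hK : K.edges = E ∪ insert (v n, b) (pathEdges v n))
    (hv : ∀ l < n, v (l + 1) ∈ segment ℝ (v l) b) (hE : ∀ e ∈ E, ∀ l ≤ n, e.1 ≠ v l)
    (hinj : ∀ l ≤ n, ∀ l' ≤ n, v l = v l' → l = l') :
    ∃ L : PolyLink, L.edges = insert (v 0, b) E ∧ L.toLink = K.toLink := by
  induction n generalizing K with
  | zero =>
    refine ⟨K, ?_, rfl⟩
    rw [hK]
    ext e
    simp [pathEdges]
  | succ n ih =>
    rw [pathEdges_succ] at hK
    obtain ⟨L, hL, hLK⟩ := exists_merge_insert K (a := v n) (b := b) (c := v (n + 1))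
      (E := E ∪ pathEdges v n) (by rw [hK]; ext e; simp only [Set.mem_union, Set.mem_insert_iff]; tauto)
      (hv n (by omega)) (by
        rintro e (he | ⟨l, hl, rfl⟩)
        · exact ⟨hE e he n (by omega), hE e he (n + 1) le_rfl⟩
        · exact ⟨fun h => absurd (hinj _ (by omega) _ (by omega) h) (by omega),
            fun h => absurd (hinj _ (by omega) _ (by omega) h) (by omega)⟩)
    obtain ⟨L', hL', hLK'⟩ := ih L
      (by rw [hL]; ext e; simp only [Set.mem_union, Set.mem_insert_iff]; tauto)
      (fun l hl => hv l (by omega)) (fun e he l hl => hE e he l (by omega))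
      fun l hl l' hl' => hinj l (by omega) l' (by omega)
    exact ⟨L', hL', hLK'.trans hLK⟩

/-- Straight paths can be replaced by single edges. -/
theorem exists_merge_paths {ι : Type*} [DecidableEq ι] (S : Finset ι) (n : ℕ) (v : ι → ℕ → Space)
    (b : ι → Space) (K : PolyLink) {E : Set (Space × Space)}
    (hK : K.edges = E ∪ {e | ∃ i ∈ S, e ∈ insert (v i n, b i) (pathEdges (v i) n)})
    (hv : ∀ i ∈ S, ∀ l < n, v i (l + 1) ∈ segment ℝ (v i l) (b i))
    (hE : ∀ e ∈ E, ∀ i ∈ S, ∀ l ≤ n, e.1 ≠ v i l)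
    (hinj : ∀ i ∈ S, ∀ j ∈ S, ∀ l ≤ n, ∀ l' ≤ n, v i l = v j l' → i = j ∧ l = l') :
    ∃ L : PolyLink, L.edges = E ∪ {e | ∃ i ∈ S, e = (v i 0, b i)} ∧ L.toLink = K.toLink := by
  induction S using Finset.induction_on generalizing K E with
  | empty =>
    refine ⟨K, ?_, rfl⟩
    rw [hK]; simp
  | insert i S hi ih =>
    obtain ⟨L, hL, hLK⟩ := exists_merge_path n (v i) K (b := b i)
      (E := E ∪ {e | ∃ j ∈ S, e ∈ insert (v j n, b j) (pathEdges (v j) n)})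
      (by
        rw [hK]; ext e
        simp only [Set.mem_union, Set.mem_ofPred_eq, Finset.exists_mem_insert]
        rw [or_assoc, or_comm (b := e ∈ insert _ _)]) (hv i (by simp))
      (by
        rintro e (he | ⟨j, hj, rfl | ⟨l', hl', rfl⟩⟩) l hl h
        · exact hE e he i (by simp) l hl h
        · obtain ⟨rfl, -⟩ := hinj j (by simp [hj]) i (by simp) _ le_rfl _ hl h
          exact hi hj
        · obtain ⟨rfl, -⟩ := hinj j (by simp [hj]) i (by simp) _ hl'.le _ hl h
          exact hi hj)
      (fun l hl l' hl' h => (hinj i (by simp) i (by simp) l hl l' hl' h).2)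
    obtain ⟨L', hL', hLK'⟩ := ih L (E := insert (v i 0, b i) E)
      (by rw [hL]; ext e; simp only [Set.mem_union, Set.mem_insert_iff]; tauto)
      (fun j hj => hv j (by simp [hj]))
      (by
        rintro e (rfl | he) j hj l hl h
        · obtain ⟨rfl, -⟩ := hinj i (by simp) j (by simp [hj]) _ (Nat.zero_le _) _ hl h
          exact hi hj
        · exact hE e he j (by simp [hj]) l hl h)
      (fun j hj k hk => hinj j (by simp [hj]) k (by simp [hk]))
    refine ⟨L', ?_, hLK'.trans hLK⟩
    rw [hL']
    ext e
    simp only [Set.mem_union, Set.mem_insert_iff, Set.mem_ofPred_eq, Finset.exists_mem_insert]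
    tauto

/-! ### Removing trivial letters -/

theorem Braided.pagePt_inj {N M : ℕ} {π : ℕ → Equiv.Perm (Fin (N + 1))} {h : ℕ → ℝ}
    {X Z : ℕ → Fin (N + 1) → ℝ} (H : Braided M π h X Z) {l l' : ℕ} (hl : l ≤ M + 2)
    (hl' : l' ≤ M + 2) {j k : Fin (N + 1)}
    (he : pagePt M h l (X l j) (Z l j) = pagePt M h l' (X l' k) (Z l' k)) : l = l' ∧ j = k := by
  have := H.emb.injective (a₁ := (⟨l, Nat.lt_succ_iff.2 hl⟩, j))
    (a₂ := (⟨l', Nat.lt_succ_iff.2 hl'⟩, k)) he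
  simpa using this

/-- A deformation of the interior pages of a closed braid. -/
theorem Braided.exists_slide {N M : ℕ} {π : ℕ → Equiv.Perm (Fin (N + 1))} {h h' : ℕ → ℝ}
    {X Z X' Z' : ℕ → Fin (N + 1) → ℝ} (H : Braided M π h X Z) (decr : ∀ l < M, h' (l + 1) < h' l)
    (gt : ∀ l ≤ M, ∀ j, -1 < Z' l j)
    (hback : ∀ l, l = 0 ∨ M ≤ l → X' l = X l ∧ Z' l = Z l)
    (hfront : ∀ l < M, (X' l = X l ∧ Z' l = Z l ∧ X' (l + 1) = X (l + 1) ∧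
      Z' (l + 1) = Z (l + 1)) ∨ ∀ j k, j ≠ k → ∃ σ κ,
      InCone σ κ (X l j - X l k) (Z l j - Z l k) ∧
      InCone σ κ (X' l j - X' l k) (Z' l j - Z' l k) ∧
      InCone σ κ (X (l + 1) (π l j) - X (l + 1) (π l k)) (Z (l + 1) (π l j) - Z (l + 1) (π l k)) ∧
      InCone σ κ (X' (l + 1) (π l j) - X' (l + 1) (π l k))
        (Z' (l + 1) (π l j) - Z' (l + 1) (π l k))) :
    ∃ H' : Braided M π h' X' Z', H.poly.toLink = H'.poly.toLink := by
  have hn : ∀ l, M ≤ l → nextPage M l = 0 ∨ M ≤ nextPage M l := by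
    intro l hl; unfold nextPage; split_ifs <;> omega
  refine ⟨⟨decr, gt, ?_, ?_, ?_, ?_, ?_, ?_⟩, H.toLink_eq _ ?_ ?_⟩
  · rw [(hback 0 (Or.inl rfl)).2]; exact H.nonneg_zero
  · rw [(hback M (Or.inr le_rfl)).2]; exact H.nonneg_last
  · rw [(hback (M + 1) (Or.inr (by omega))).2]; exact H.nonneg_low
  · rw [(hback (M + 2) (Or.inr (by omega))).2]; exact H.nonneg_high
  · intro l hl j k hjk
    rcases hfront l hl with ⟨h1, h2, h3, h4⟩ | hc
    · rw [h1, h2, h3, h4]; exact H.front l hl j k hjk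
    · obtain ⟨σ, κ, -, h2, -, h4⟩ := hc j k hjk
      exact h2.apart h4
  · intro l hl hl' j k hjk
    rw [(hback l (Or.inr hl)).1, (hback l (Or.inr hl)).2, (hback _ (hn l hl)).1,
      (hback _ (hn l hl)).2]
    exact H.back l hl hl' j k hjk
  · have e : ∀ t x : ℝ, (1 - t) * x + t * x = x := fun t x => by ring
    intro t ht ht1 l hl j k hjk
    rcases hfront l hl with ⟨h1, h2, h3, h4⟩ | hc
    · rw [h1, h2, h3, h4, e, e, e, e]; exact H.front l hl j k hjk
    · obtain ⟨σ, κ, h1, h2, h3, h4⟩ := hc j k hjk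
      exact (h1.convex h2 ht ht1).apart (h3.convex h4 ht ht1)
  · have e : ∀ t x : ℝ, (1 - t) * x + t * x = x := fun t x => by ring
    intro t ht ht1 l hl hl' j k hjk
    dsimp only
    rw [(hback l (Or.inr hl)).1, (hback l (Or.inr hl)).2, (hback _ (hn l hl)).1,
      (hback _ (hn l hl)).2]
    simp only [e]
    exact H.back l hl hl' j k hjk

/-- The heights of the pages after sliding the pages of a trivial letter into the preceding
letter. -/
noncomputable def slideH (a l : ℕ) : ℝ :=
  if l ≤ 2 * a + 1 then wordH l else if 2 * a + 4 ≤ l then wordH (l - 2)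
    else if l = 2 * a + 2 then -(a : ℝ) - 2 / 3 else -(a : ℝ) - 5 / 6

/-- The coordinates of the pages after sliding the pages of a trivial letter into the preceding
letter, where `s` is the permutation of that letter. -/
noncomputable def slide {N : ℕ} (a : ℕ) (s : Equiv.Perm (Fin (N + 1)))
    (X : ℕ → Fin (N + 1) → ℝ) (l : ℕ) (j : Fin (N + 1)) : ℝ :=
  if l = 2 * a + 2 then 2 / 3 * X (2 * a + 1) (s j) + 1 / 3 * X (2 * a + 4) j
  else if l = 2 * a + 3 then 1 / 3 * X (2 * a + 1) (s j) + 2 / 3 * X (2 * a + 4) j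
  else X l j

theorem slide_two {N : ℕ} (a : ℕ) (s : Equiv.Perm (Fin (N + 1))) (X : ℕ → Fin (N + 1) → ℝ)
    (j : Fin (N + 1)) : slide a s X (2 * a + 2) j =
      2 / 3 * X (2 * a + 1) (s j) + 1 / 3 * X (2 * a + 4) j := if_pos rfl

theorem slide_three {N : ℕ} (a : ℕ) (s : Equiv.Perm (Fin (N + 1))) (X : ℕ → Fin (N + 1) → ℝ)
    (j : Fin (N + 1)) : slide a s X (2 * a + 3) j =
      1 / 3 * X (2 * a + 1) (s j) + 2 / 3 * X (2 * a + 4) j := by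
  rw [slide, if_neg (by omega), if_pos rfl]

theorem slide_out {N : ℕ} (a : ℕ) (s : Equiv.Perm (Fin (N + 1))) (X : ℕ → Fin (N + 1) → ℝ) {l : ℕ}
    (h : l ≠ 2 * a + 2) (h' : l ≠ 2 * a + 3) : slide a s X l = X l := by
  ext j; rw [slide, if_neg h, if_neg h']

section
variable {N m a : ℕ} {g g' : ℕ → Letter N}

/-- The two pages of the trivial letter move up into the second half of letter `a`, to one third and
two thirds of the way between its middle page and the page after the trivial letter; all later pages
close up. Their points then lie inside straight segments. The differences of coordinates stay in the
cones of letter `a`. -/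
theorem exists_slide_none (ha : a < m) (h1 : g (a + 1) = none) :
    ∃ H : Braided (2 * (m + 1)) (wordPerm (m + 1) g) (slideH a)
      (slide a (padPerm (g a)) (wordX (m + 1) g)) (slide a (padPerm (g a)) (wordZ (m + 1) g)),
      wordLink (m + 1) g = H.poly.toLink := by
  have hZ : ∀ l j, 0 ≤ slide a (padPerm (g a)) (wordZ (m + 1) g) l j := by
    intro l j
    have h0 := wordZ_nonneg (m + 1) g
    unfold slide
    split_ifs
    · have := h0 (2 * a + 1) (padPerm (g a) j); have := h0 (2 * a + 4) j; positivity
    · have := h0 (2 * a + 1) (padPerm (g a) j); have := h0 (2 * a + 4) j; positivity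
    · exact h0 l j
  refine (braided_word (m + 1) g).exists_slide ?_ (fun l _ j => by linarith [hZ l j]) ?_ ?_
  · intro l hl
    unfold slideH wordH
    rcases lt_or_ge l (2 * a + 1) with h | h
    · rw [if_pos (by omega), if_pos (by omega)]; push_cast; linarith
    rcases le_or_gt (2 * a + 4) l with h' | h'
    · rw [if_neg (by omega), if_pos (by omega), if_neg (by omega), if_pos (by omega),
        show l + 1 - 2 = l - 2 + 1 by omega]
      push_cast; linarith
    obtain rfl | rfl | rfl : l = 2 * a + 1 ∨ l = 2 * a + 2 ∨ l = 2 * a + 3 := by omega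
    · rw [if_neg (by omega), if_neg (by omega), if_pos (by omega), if_pos (by omega)]
      push_cast; linarith
    · rw [if_neg (by omega), if_neg (by omega), if_neg (by omega), if_neg (by omega),
        if_neg (by omega), if_pos (by omega)]
      linarith
    · rw [if_neg (by omega), if_pos (by omega), if_neg (by omega), if_neg (by omega),
        if_neg (by omega), show 2 * a + 3 + 1 - 2 = 2 * a + 2 by omega]
      push_cast; linarith
  · rintro l hl
    rw [slide_out _ _ _ (by omega) (by omega), slide_out _ _ _ (by omega) (by omega)]
    exact ⟨rfl, rfl⟩
  · intro l hl
    by_cases hs : l = 2 * a + 1 ∨ l = 2 * a + 2 ∨ l = 2 * a + 3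
    swap
    · left
      rw [slide_out _ _ _ (by omega) (by omega), slide_out _ _ _ (by omega) (by omega),
        slide_out _ _ _ (by omega) (by omega), slide_out _ _ _ (by omega) (by omega)]
      exact ⟨rfl, rfl, rfl, rfl⟩
    right
    -- the positions of the strands after the letter
    have key : ∀ j k : Fin (N + 1), j ≠ k → ∃ σ κ : ℝ,
        InCone σ κ (wordX (m + 1) g (2 * a + 1) (padPerm (g a) j) -
          wordX (m + 1) g (2 * a + 1) (padPerm (g a) k))
          (wordZ (m + 1) g (2 * a + 1) (padPerm (g a) j) -
            wordZ (m + 1) g (2 * a + 1) (padPerm (g a) k)) ∧ 0 < σ * ((j : ℝ) - k) := by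
      intro j k hjk
      have hjk' : padPerm (g a) j ≠ padPerm (g a) k := (padPerm (g a)).injective.ne hjk
      obtain ⟨-, σ, h2, h3⟩ := letter_cone (g a) hjk' (letter_pair_sign (g a) hjk')
      rw [padPerm_padPerm, padPerm_padPerm] at h2
      refine ⟨σ, padLift (g a) (padPerm (g a) j) - padLift (g a) (padPerm (g a) k), ?_, h2⟩
      rw [wordX_odd _ _ (by omega), wordX_odd _ _ (by omega), wordZ_odd _ _ (by omega),
        wordZ_odd _ _ (by omega)]
      exact h3
    have hX2 : ∀ j, wordX (m + 1) g (2 * a + 2) j = j := fun j =>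
      wordX_even _ _ (by omega) j
    have hZ2 : ∀ j, wordZ (m + 1) g (2 * a + 2) j = 0 := fun j =>
      wordZ_even _ _ (by omega) j
    have hX3 : ∀ j, wordX (m + 1) g (2 * a + 3) j = j := fun j => by
      rw [show 2 * a + 3 = 2 * (a + 1) + 1 by ring, wordX_odd _ _ (by omega), h1]
      simp [padPerm]
    have hZ3 : ∀ j, wordZ (m + 1) g (2 * a + 3) j = 0 := fun j => by
      rw [show 2 * a + 3 = 2 * (a + 1) + 1 by ring, wordZ_odd _ _ (by omega), h1]
      rfl
    have hX4 : ∀ j, wordX (m + 1) g (2 * a + 4) j = j := fun j =>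
      wordX_even _ _ (by omega) j
    have hZ4 : ∀ j, wordZ (m + 1) g (2 * a + 4) j = 0 := fun j =>
      wordZ_even _ _ (by omega) j
    -- A point that has been slid is a convex combination of a point in the middle page and one at
    -- an integral position, and for both the differences lie in the cone.
    have mid : ∀ (t : ℝ), 0 ≤ t → t ≤ 1 → ∀ {j k : Fin (N + 1)} {σ κ x x' z z' : ℝ},
        InCone σ κ (x - x') (z - z') → 0 < σ * ((j : ℝ) - k) →
        InCone σ κ (((1 - t) * x + t * j) - ((1 - t) * x' + t * k))
          (((1 - t) * z + t * 0) - ((1 - t) * z' + t * 0)) := by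
      intro t ht ht1 j k σ κ x x' z z' h h'
      have := h.convex (x' := (j : ℝ) - k) (z' := 0) (Or.inl h') ht ht1
      convert this using 1 <;> ring
    rcases hs with rfl | rfl | rfl
    · intro j k hjk
      have hp : wordPerm (m + 1) g (2 * a + 1) = padPerm (g a) := wordPerm_odd _ _ (by omega)
      obtain ⟨σ, κ, c1, c2⟩ := key (padPerm (g a) j) (padPerm (g a) k)
        ((padPerm (g a)).injective.ne hjk)
      have c3 := mid (1 / 3) (by norm_num) (by norm_num) c1 c2
      simp only [padPerm_padPerm] at c1 c3
      refine ⟨σ, κ, c1, ?_, ?_, ?_⟩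
      · rw [slide_out _ _ _ (by omega) (by omega), slide_out _ _ _ (by omega) (by omega)]
        exact c1
      · rw [hX2, hX2, hp]; exact Or.inl c2
      · rw [slide_two, slide_two, slide_two, slide_two, hp, hX4, hX4, hZ4, hZ4]
        simp only [padPerm_padPerm]
        convert c3 using 1 <;> ring
    · intro j k hjk
      rw [wordPerm_even _ _ (by omega)]
      obtain ⟨σ, κ, c1, c2⟩ := key j k hjk
      have c3 := mid (1 / 3) (by norm_num) (by norm_num) c1 c2
      have c4 := mid (2 / 3) (by norm_num) (by norm_num) c1 c2
      refine ⟨σ, κ, ?_, ?_, ?_, ?_⟩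
      · rw [hX2, hX2]; exact Or.inl c2
      · rw [slide_two, slide_two, slide_two, slide_two, hX4, hX4, hZ4, hZ4]
        convert c3 using 1 <;> ring
      · simp only [Equiv.Perm.coe_one, id]
        rw [hX3, hX3]; exact Or.inl c2
      · simp only [Equiv.Perm.coe_one, id]
        rw [slide_three, slide_three, slide_three, slide_three, hX4, hX4, hZ4, hZ4]
        convert c4 using 1 <;> ring
    · intro j k hjk
      have hp : wordPerm (m + 1) g (2 * a + 3) = 1 := by
        rw [show 2 * a + 3 = 2 * (a + 1) + 1 by ring, wordPerm_odd _ _ (by omega), h1]; rfl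
      rw [hp]
      obtain ⟨σ, κ, c1, c2⟩ := key j k hjk
      have c4 := mid (2 / 3) (by norm_num) (by norm_num) c1 c2
      refine ⟨σ, κ, ?_, ?_, ?_, ?_⟩
      · rw [hX3, hX3]; exact Or.inl c2
      · rw [slide_three, slide_three, slide_three, slide_three, hX4, hX4, hZ4, hZ4]
        convert c4 using 1 <;> ring
      · simp only [Equiv.Perm.coe_one, id]
        rw [hX4, hX4]; exact Or.inl c2
      · simp only [Equiv.Perm.coe_one, id]
        rw [slide_out _ _ _ (by omega) (by omega), slide_out _ _ _ (by omega) (by omega), hX4, hX4]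
        exact Or.inl c2

/-- The page of a closed braid corresponding to page `l` after removing the pages of a trivial
letter. -/
def skipPage (a l : ℕ) : ℕ := if l ≤ 2 * a + 1 then l else l + 2

/-- Once the two pages of the trivial letter are skipped, the picture after the slide agrees point
by point with the closure of the shorter word. -/
theorem slide_pagePt (ha : a < m) (h0 : ∀ q ≤ a, g q = g' q) (h2 : ∀ q, a < q → g (q + 1) = g' q)
    (l : ℕ) (j : Fin (N + 1)) :
    pagePt (2 * (m + 1)) (slideH a) (skipPage a l)
      (slide a (padPerm (g a)) (wordX (m + 1) g) (skipPage a l) j)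
      (slide a (padPerm (g a)) (wordZ (m + 1) g) (skipPage a l) j) =
    pagePt (2 * m) wordH l (wordX m g' l j) (wordZ m g' l j) := by
  have hs : ∀ X : ℕ → Fin (N + 1) → ℝ,
      slide a (padPerm (g a)) X (skipPage a l) = X (skipPage a l) := fun X => by
    unfold skipPage; split_ifs <;> exact slide_out _ _ _ (by omega) (by omega)
  have hX : wordX (m + 1) g (skipPage a l) j = wordX m g' l j := by
    unfold skipPage wordX
    split_ifs with c1 c2 c3 c3 c2 c3 c3
    all_goals first | omega | rfl | skip
    · rw [h0 _ (by omega)]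
    · rw [show (l + 2) / 2 = l / 2 + 1 by omega, h2 _ (by omega)]
  have hZ : wordZ (m + 1) g (skipPage a l) j = wordZ m g' l j := by
    unfold skipPage wordZ
    split_ifs with c1 c2 c3 c3 c2 c3 c3
    all_goals first | omega | rfl | skip
    · rw [h0 _ (by omega)]
    · rw [show (l + 2) / 2 = l / 2 + 1 by omega, h2 _ (by omega)]
  rw [hs, hs, hX, hZ, pagePt, pagePt]
  have hH : ∀ l, slideH a (skipPage a l) = wordH l := by
    intro l
    unfold slideH skipPage
    split_ifs
    all_goals first | omega | rfl
  have hM : slideH a (2 * (m + 1)) = wordH (2 * m) := by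
    rw [← hH (2 * m), skipPage, if_neg (by omega)]; rfl
  have h00 : slideH a 0 = wordH 0 := by rw [← hH 0, skipPage, if_pos (by omega)]
  have hY : ∀ z, pageY (2 * (m + 1)) (slideH a) (skipPage a l) z = pageY (2 * m) wordH l z := by
    intro z
    unfold pageY
    rw [hH, hM, h00]
    unfold skipPage
    split_ifs
    all_goals first | omega | rfl
  have hZ' : ∀ z, pageZ (2 * (m + 1)) (skipPage a l) z = pageZ (2 * m) l z := by
    intro z
    unfold pageZ skipPage
    split_ifs
    all_goals first | omega | rfl
  rw [hY, hZ']

/-- After the slide the pages of the trivial letter carry only vertices inside straight segments.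
Merging them leaves the closure of the shorter word, with pages renumbered by `skipPage`. -/
theorem wordLink_remove (ha : a < m) (h0 : ∀ q ≤ a, g q = g' q) (h1 : g (a + 1) = none)
    (h2 : ∀ q, a < q → g (q + 1) = g' q) : wordLink (m + 1) g = wordLink m g' := by
  obtain ⟨s, hs⟩ : ∃ s, s = padPerm (g a) := ⟨_, rfl⟩
  obtain ⟨X, hX⟩ : ∃ X, X = slide a s (wordX (m + 1) g) := ⟨_, rfl⟩
  obtain ⟨Z, hZ⟩ : ∃ Z, Z = slide a s (wordZ (m + 1) g) := ⟨_, rfl⟩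
  obtain ⟨P, hP⟩ : ∃ P : ℕ → Fin (N + 1) → Space, P = fun l j =>
    pagePt (2 * (m + 1)) (slideH a) l (X l j) (Z l j) := ⟨_, rfl⟩
  obtain ⟨K, hK, hinj, hKL⟩ : ∃ K : PolyLink, K.edges = {e | ∃ l ≤ 2 * (m + 1) + 2, ∃ j,
      e = (P l j, P (nextPage (2 * (m + 1)) l) (wordPerm (m + 1) g l j))} ∧
      (∀ l l' j k, l ≤ 2 * (m + 1) + 2 → l' ≤ 2 * (m + 1) + 2 → P l j = P l' k →
        l = l' ∧ j = k) ∧ wordLink (m + 1) g = K.toLink := by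
    obtain ⟨H, hH⟩ := exists_slide_none ha h1
    rw [hP, hX, hZ, hs]
    exact ⟨H.poly, H.poly_edges, fun l l' j k hl hl' h => H.pagePt_inj hl hl' h, hH⟩
  rw [hKL]
  -- The path `v j` ends at position `j` after letter `a`, so in the middle page of that letter,
  -- where strands are named by their start, it sits at `s j`.
  let v : Fin (N + 1) → ℕ → Space := fun j l =>
    if l = 0 then P (2 * a + 1) (s j) else P (2 * a + 1 + l) j
  let E : Set (Space × Space) := {e | ∃ l ≤ 2 * (m + 1) + 2, (l < 2 * a + 1 ∨ 2 * a + 4 ≤ l) ∧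
    ∃ j, e = (P l j, P (nextPage (2 * (m + 1)) l) (wordPerm (m + 1) g l j))}
  have p1 : wordPerm (m + 1) g (2 * a + 1) = s := by
    rw [hs]; exact wordPerm_odd _ _ (by omega)
  have p2 : wordPerm (m + 1) g (2 * a + 2) = 1 := wordPerm_even _ _ (by omega)
  have p3 : wordPerm (m + 1) g (2 * a + 3) = 1 := by
    rw [show 2 * a + 3 = 2 * (a + 1) + 1 by ring, wordPerm_odd _ _ (by omega), h1]; rfl
  have hv : ∀ j l, ∃ j', v j l = P (2 * a + 1 + l) j' := by
    intro j l
    by_cases hl : l = 0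
    · exact ⟨s j, by simp [v, hl]⟩
    · exact ⟨j, by simp [v, hl]⟩
  obtain ⟨L, hL, hLK⟩ := exists_merge_paths Finset.univ 2 v (fun j => P (2 * a + 4) j) K
    (E := E) (by
      rw [hK]
      ext e
      simp only [Set.mem_ofPred_eq, Set.mem_union, Finset.mem_univ, true_and,
        Set.mem_insert_iff, pathEdges, E]
      constructor
      · rintro ⟨l, hl, j, rfl⟩
        by_cases hc : l < 2 * a + 1 ∨ 2 * a + 4 ≤ l
        · exact Or.inl ⟨l, hl, hc, j, rfl⟩
        right
        rw [nextPage_front (by omega)]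
        obtain rfl | rfl | rfl : l = 2 * a + 1 ∨ l = 2 * a + 2 ∨ l = 2 * a + 3 := by omega
        · refine ⟨s j, Or.inr ⟨0, by omega, ?_⟩⟩
          rw [p1]
          simp [v, hs, padPerm_padPerm]
        · refine ⟨j, Or.inr ⟨1, by omega, ?_⟩⟩
          rw [p2]
          simp [v]
        · refine ⟨j, Or.inl ?_⟩
          rw [p3]
          simp [v]
      · rintro (⟨l, hl, -, j, rfl⟩ | ⟨j, rfl | ⟨l, hl, rfl⟩⟩)
        · exact ⟨l, hl, j, rfl⟩
        · refine ⟨2 * a + 3, by omega, j, ?_⟩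
          rw [nextPage_front (by omega), p3]
          simp [v]
        · obtain rfl | rfl : l = 0 ∨ l = 1 := by omega
          · refine ⟨2 * a + 1, by omega, s j, ?_⟩
            rw [nextPage_front (by omega), p1]
            simp [v, hs, padPerm_padPerm]
          · refine ⟨2 * a + 2, by omega, j, ?_⟩
            rw [nextPage_front (by omega), p2]
            simp [v])
    (by
      intro j _ l hl
      have hY : ∀ i, 2 * a + 1 ≤ i → i ≤ 2 * a + 4 → ∀ k, P i k = ![X i k, slideH a i, Z i k] := by
        intro i hi hi' k
        simp only [hP, pagePt, pageY_front (show i ≤ 2 * (m + 1) by omega),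
          pageZ_front (show i ≤ 2 * (m + 1) by omega)]
      have hh1 : slideH a (2 * a + 1) = -(a : ℝ) - 1 / 2 := by
        rw [slideH, if_pos le_rfl, wordH]; push_cast; ring
      have hh2 : slideH a (2 * a + 2) = -(a : ℝ) - 2 / 3 := by
        rw [slideH, if_neg (by omega), if_neg (by omega), if_pos rfl]
      have hh3 : slideH a (2 * a + 3) = -(a : ℝ) - 5 / 6 := by
        rw [slideH, if_neg (by omega), if_neg (by omega), if_neg (by omega)]
      have hh4 : slideH a (2 * a + 4) = -(a : ℝ) - 1 := by
        rw [slideH, if_neg (by omega), if_pos le_rfl, wordH,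
          show 2 * a + 4 - 2 = 2 * a + 2 by omega]
        push_cast; ring
      have hX1 : X (2 * a + 1) = wordX (m + 1) g (2 * a + 1) := by
        rw [hX]; exact slide_out _ _ _ (by omega) (by omega)
      have hX4 : X (2 * a + 4) = wordX (m + 1) g (2 * a + 4) := by
        rw [hX]; exact slide_out _ _ _ (by omega) (by omega)
      have hZ1 : Z (2 * a + 1) = wordZ (m + 1) g (2 * a + 1) := by
        rw [hZ]; exact slide_out _ _ _ (by omega) (by omega)
      have hZ4 : Z (2 * a + 4) = wordZ (m + 1) g (2 * a + 4) := by
        rw [hZ]; exact slide_out _ _ _ (by omega) (by omega)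
      have hX2 : X (2 * a + 2) j = 2 / 3 * X (2 * a + 1) (s j) + 1 / 3 * X (2 * a + 4) j := by
        rw [hX1, hX4, hX]; exact slide_two _ _ _ _
      have hZ2 : Z (2 * a + 2) j = 2 / 3 * Z (2 * a + 1) (s j) + 1 / 3 * Z (2 * a + 4) j := by
        rw [hZ1, hZ4, hZ]; exact slide_two _ _ _ _
      have hX3 : X (2 * a + 3) j = 1 / 3 * X (2 * a + 1) (s j) + 2 / 3 * X (2 * a + 4) j := by
        rw [hX1, hX4, hX]; exact slide_three _ _ _ _
      have hZ3 : Z (2 * a + 3) j = 1 / 3 * Z (2 * a + 1) (s j) + 2 / 3 * Z (2 * a + 4) j := by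
        rw [hZ1, hZ4, hZ]; exact slide_three _ _ _ _
      rw [mem_seg]
      obtain rfl | rfl : l = 0 ∨ l = 1 := by omega
      · refine ⟨1 / 3, by norm_num, by norm_num, ?_⟩
        simp only [v, if_pos, Nat.zero_add, Nat.one_ne_zero, if_false,
          hY _ (show 2 * a + 1 ≤ 2 * a + 1 by omega) (by omega),
          hY _ (show 2 * a + 1 ≤ 2 * a + 4 by omega) (by omega),
          show 2 * a + 1 + 1 = 2 * a + 2 by ring,
          hY _ (show 2 * a + 1 ≤ 2 * a + 2 by omega) (by omega), hh1, hh2, hh4, hX2, hZ2]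
        rw [space_eq_iff]
        refine ⟨?_, ?_, ?_⟩ <;>
          simp only [Pi.add_apply, Pi.smul_apply, smul_eq_mul, Matrix.cons_val] <;> ring
      · refine ⟨1 / 2, by norm_num, by norm_num, ?_⟩
        simp only [v, Nat.one_ne_zero, if_false, Nat.reduceAdd, OfNat.ofNat_ne_zero,
          show 2 * a + 1 + 1 = 2 * a + 2 by ring, show 2 * a + 1 + 2 = 2 * a + 3 by ring,
          hY _ (show 2 * a + 1 ≤ 2 * a + 4 by omega) (by omega),
          hY _ (show 2 * a + 1 ≤ 2 * a + 3 by omega) (by omega),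
          hY _ (show 2 * a + 1 ≤ 2 * a + 2 by omega) (by omega), hh3, hh2, hh4, hX2, hZ2, hX3, hZ3]
        rw [space_eq_iff]
        refine ⟨?_, ?_, ?_⟩ <;>
          simp only [Pi.add_apply, Pi.smul_apply, smul_eq_mul, Matrix.cons_val] <;> ring)
    (by
      rintro e ⟨l, hl, hc, j, rfl⟩ k - l' hl' h
      obtain ⟨k', hk'⟩ := hv k l'
      rw [hk'] at h
      have := (hinj _ _ _ _ hl (by omega) h).1
      omega)
    (by
      intro j _ k _ l hl l' hl' h
      obtain ⟨j', hj'⟩ := hv j l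
      obtain ⟨k', hk'⟩ := hv k l'
      have h3 := h
      rw [hj', hk'] at h3
      obtain rfl : l = l' := by have := (hinj _ _ _ _ (by omega) (by omega) h3).1; omega
      refine ⟨?_, rfl⟩
      by_cases h0 : l = 0
      · subst h0
        simp only [v, if_true] at h
        exact s.injective (hinj _ _ _ _ (by omega) (by omega) h).2
      · simp only [v, h0, if_false] at h
        exact (hinj _ _ _ _ (by omega) (by omega) h).2)
  rw [← hLK]
  refine congrArg PolyLink.toLink (PolyLink.ext_edges ?_)
  rw [hL, Braided.poly_edges]
  have hpt : ∀ l j, P (skipPage a l) j = pagePt (2 * m) wordH l (wordX m g' l j) (wordZ m g' l j) :=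
    fun l j => by
    rw [hP, hX, hZ, hs]; exact slide_pagePt ha h0 h2 l j
  have hperm : ∀ l, wordPerm (m + 1) g (skipPage a l) = wordPerm m g' l := by
    intro l
    unfold skipPage wordPerm
    split_ifs with c1 c2 c3 c3 c2 c3 c3
    all_goals first | omega | rfl | skip
    · rw [h0 _ (by omega)]
    · rw [show (l + 2) / 2 = l / 2 + 1 by omega, h2 _ (by omega)]
  have hnext : ∀ l, l ≤ 2 * m + 2 → l ≠ 2 * a + 1 →
      nextPage (2 * (m + 1)) (skipPage a l) = skipPage a (nextPage (2 * m) l) := by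
    intro l hl hl'
    unfold skipPage nextPage
    split_ifs <;> omega
  ext e
  simp only [pageEdges, Set.mem_ofPred_eq, Set.mem_union, Finset.mem_univ, true_and, E]
  simp only [← hpt, ← hperm]
  constructor
  · rintro (⟨l, hl, hc | hc, j, rfl⟩ | ⟨j, rfl⟩)
    · have : skipPage a l = l := if_pos (by omega)
      refine ⟨l, by omega, j, ?_⟩
      rw [← hnext l (by omega) (by omega), this]
    · have : skipPage a (l - 2) = l := by rw [skipPage, if_neg (by omega)]; omega
      refine ⟨l - 2, by omega, j, ?_⟩
      rw [← hnext (l - 2) (by omega) (by omega), this]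
    · refine ⟨2 * a + 1, by omega, s j, ?_⟩
      have e1 : skipPage a (2 * a + 1) = 2 * a + 1 := if_pos le_rfl
      have e2 : skipPage a (2 * a + 2) = 2 * a + 4 := if_neg (by omega)
      rw [nextPage_front (by omega), e1, e2, p1, hs, padPerm_padPerm]
      simp [v, hs]
  · rintro ⟨l, hl, j, rfl⟩
    by_cases hc : l = 2 * a + 1
    · right
      subst hc
      refine ⟨s j, ?_⟩
      have e1 : skipPage a (2 * a + 1) = 2 * a + 1 := if_pos le_rfl
      have e2 : skipPage a (2 * a + 2) = 2 * a + 4 := if_neg (by omega)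
      rw [nextPage_front (by omega), e1, e2, p1]
      simp [v, hs, padPerm_padPerm]
    · left
      rw [← hnext l hl hc]
      refine ⟨skipPage a l, ?_, ?_, j, rfl⟩ <;> unfold skipPage <;> split_ifs <;> omega

end

/-- A trivial letter can be removed. -/
theorem padLink_remove_none {N : ℕ} (A B : List (Letter N)) (g : Letter N) :
    padLink (A ++ ([g, none] ++ B)) = padLink (A ++ ([g] ++ B)) := by
  have e1 : (A ++ ([g, none] ++ B)).length = (A ++ ([g] ++ B)).length + 1 := by simp; omega
  rw [padLink, padLink, e1]
  refine wordLink_remove (a := A.length) (by simp) ?_ ?_ ?_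
  · intro q hq
    rcases hq.lt_or_eq with h | rfl
    · rw [padFn_append_left _ _ h, padFn_append_left _ _ h]
    · rw [padFn_append_right _ _ le_rfl, padFn_append_right _ _ le_rfl]
      simp [padFn]
  · rw [padFn_append_right _ _ (by omega)]
    simp [padFn]
  · intro q hq
    obtain ⟨r, rfl⟩ : ∃ r, q = A.length + (r + 1) := ⟨q - A.length - 1, by omega⟩
    rw [padFn_append_right A ([g, none] ++ B) (by omega),
      padFn_append_right A ([g] ++ B) (by omega),
      show A.length + (r + 1) + 1 - A.length = r + 2 by omega,
      show A.length + (r + 1) - A.length = r + 1 by omega]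
    simp [padFn]

/-! ### Conjugation -/

/-- The last and the first letter of a word with `r + 2` letters can be arranged in layers, `f`
being the layers of the strands before the last letter. -/
structure BackLayered {N : ℕ} (r : ℕ) (g : ℕ → Letter N) (f : Fin (N + 1) → ℝ) : Prop where
  inj : Function.Injective f
  nonneg : ∀ j, 0 ≤ f j
  last : LetterAbove (g (r + 1)) f
  first : LetterAbove (g 0) fun j => f (padPerm (g (r + 1)) j)
  closed : ∀ j, f (padPerm (g (r + 1)) (padPerm (g 0) j)) = f j

/-- First coordinates after moving the strands of the last and the first letter into layers. -/
noncomputable def backX {N : ℕ} (r : ℕ) (g : ℕ → Letter N) (l : ℕ) (j : Fin (N + 1)) : ℝ :=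
  if 2 ≤ l ∧ l ≤ 2 * r + 2 then wordX (r + 2) g l j else 0

/-- Lifts after moving the strands of the last and the first letter into layers. -/
noncomputable def backZ {N : ℕ} (r : ℕ) (g : ℕ → Letter N) (f : Fin (N + 1) → ℝ) (l : ℕ)
    (j : Fin (N + 1)) : ℝ :=
  if 2 ≤ l ∧ l ≤ 2 * r + 2 then wordZ (r + 2) g l j
  else if l = 2 * r + 3 then f j else f (padPerm (g (r + 1)) j)

section
variable {N r : ℕ} {g : ℕ → Letter N} {f : Fin (N + 1) → ℝ}

theorem backX_in {l : ℕ} (h : 2 ≤ l ∧ l ≤ 2 * r + 2) : backX r g l = wordX (r + 2) g l := by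
  ext j; exact if_pos h

theorem backZ_in {l : ℕ} (h : 2 ≤ l ∧ l ≤ 2 * r + 2) : backZ r g f l = wordZ (r + 2) g l := by
  ext j; exact if_pos h

theorem backX_out {l : ℕ} (h : ¬(2 ≤ l ∧ l ≤ 2 * r + 2)) (j : Fin (N + 1)) :
    backX r g l j = 0 := if_neg h

theorem backZ_out {l : ℕ} (h : l < 2 ∨ 2 * r + 4 ≤ l) (j : Fin (N + 1)) :
    backZ r g f l j = f (padPerm (g (r + 1)) j) := by
  rw [backZ, if_neg (by omega), if_neg (by omega)]

theorem backZ_last (j : Fin (N + 1)) : backZ r g f (2 * r + 3) j = f j := by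
  rw [backZ, if_neg (by omega), if_pos rfl]

theorem BackLayered.zero_le (H : BackLayered r g f) (l : ℕ) (j : Fin (N + 1)) :
    0 ≤ backZ r g f l j := by
  unfold backZ
  split_ifs
  · exact wordZ_nonneg _ _ _ _
  · exact H.nonneg _
  · exact H.nonneg _

/-- Near the last letter κ is a difference of values of `f`, near the first letter a difference of
the layers transported through the last letter; in both places the overcrossing strand is in the
higher layer. All other pages are unchanged. -/
theorem BackLayered.cone (H : BackLayered r g f) {l : ℕ} (hl : l < 2 * (r + 2)) :
    (backX r g l = wordX (r + 2) g l ∧ backZ r g f l = wordZ (r + 2) g l ∧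
      backX r g (l + 1) = wordX (r + 2) g (l + 1) ∧
      backZ r g f (l + 1) = wordZ (r + 2) g (l + 1)) ∨ ∀ j k, j ≠ k → ∃ σ κ,
      InCone σ κ (wordX (r + 2) g l j - wordX (r + 2) g l k)
        (wordZ (r + 2) g l j - wordZ (r + 2) g l k) ∧
      InCone σ κ (backX r g l j - backX r g l k) (backZ r g f l j - backZ r g f l k) ∧
      InCone σ κ
        (wordX (r + 2) g (l + 1) (wordPerm (r + 2) g l j) -
          wordX (r + 2) g (l + 1) (wordPerm (r + 2) g l k))
        (wordZ (r + 2) g (l + 1) (wordPerm (r + 2) g l j) -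
          wordZ (r + 2) g (l + 1) (wordPerm (r + 2) g l k)) ∧
      InCone σ κ
        (backX r g (l + 1) (wordPerm (r + 2) g l j) - backX r g (l + 1) (wordPerm (r + 2) g l k))
        (backZ r g f (l + 1) (wordPerm (r + 2) g l j) -
          backZ r g f (l + 1) (wordPerm (r + 2) g l k)) := by
  set f' : Fin (N + 1) → ℝ := fun j => f (padPerm (g (r + 1)) j) with hf'
  have hpos : ∀ {x : ℝ}, x ≠ 0 → 0 < x * x := fun h => mul_self_pos.2 h
  have hf'inj : Function.Injective f' := H.inj.comp (padPerm _).injective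
  by_cases hs : l = 0 ∨ l = 1 ∨ l = 2 * r + 2 ∨ l = 2 * r + 3
  swap
  · exact Or.inl ⟨backX_in (by omega), backZ_in (by omega), backX_in (by omega),
      backZ_in (by omega)⟩
  right
  intro j k hjk
  have hκ' : f' j - f' k ≠ 0 := sub_ne_zero.2 (hf'inj.ne hjk)
  have hκ : f j - f k ≠ 0 := sub_ne_zero.2 (H.inj.ne hjk)
  obtain ⟨⟨σ, a1, a2⟩, ⟨τ, b1, b2⟩⟩ := letter_cone (g 0) hjk (κ := f' j - f' k)
    fun h _ => H.first.pos hjk h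
  obtain ⟨⟨σ', c1, c2⟩, ⟨τ', d1, d2⟩⟩ := letter_cone (g (r + 1)) hjk (κ := f j - f k)
    fun h _ => H.last.pos hjk h
  have x1 : ∀ j : Fin (N + 1), wordX (r + 2) g 1 j = ((j : ℝ) + padPerm (g 0) j) / 2 :=
    wordX_odd (r + 2) g (q := 0) (by omega)
  have z1 : ∀ j : Fin (N + 1), wordZ (r + 2) g 1 j = padLift (g 0) j :=
    wordZ_odd (r + 2) g (q := 0) (by omega)
  have p1 : wordPerm (r + 2) g 1 = padPerm (g 0) := wordPerm_odd (r + 2) g (q := 0) (by omega)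
  have x3 : ∀ j : Fin (N + 1), wordX (r + 2) g (2 * r + 3) j =
      ((j : ℝ) + padPerm (g (r + 1)) j) / 2 := wordX_odd (r + 2) g (q := r + 1) (by omega)
  have z3 : ∀ j : Fin (N + 1), wordZ (r + 2) g (2 * r + 3) j = padLift (g (r + 1)) j :=
    wordZ_odd (r + 2) g (q := r + 1) (by omega)
  have p3 : wordPerm (r + 2) g (2 * r + 3) = padPerm (g (r + 1)) :=
    wordPerm_odd (r + 2) g (q := r + 1) (by omega)
  rcases hs with rfl | rfl | rfl | rfl
  · refine ⟨σ, f' j - f' k, ?_⟩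
    simp only [wordPerm_even (r + 2) g (Nat.zero_mod 2), wordX_even (r + 2) g (Nat.zero_mod 2),
      wordZ_even (r + 2) g (Nat.zero_mod 2), Nat.zero_add, Equiv.Perm.coe_one, id, x1, z1,
      backX_out (show ¬(2 ≤ 0 ∧ 0 ≤ 2 * r + 2) by omega),
      backX_out (show ¬(2 ≤ 1 ∧ 1 ≤ 2 * r + 2) by omega),
      backZ_out (r := r) (show 0 < 2 ∨ 2 * r + 4 ≤ 0 by omega),
      backZ_out (r := r) (show 1 < 2 ∨ 2 * r + 4 ≤ 1 by omega)]
    exact ⟨Or.inl a1, Or.inr ⟨by ring, hpos hκ'⟩, a2, Or.inr ⟨by ring, hpos hκ'⟩⟩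
  · refine ⟨τ, f' j - f' k, ?_⟩
    simp only [p1, x1, z1, Nat.reduceAdd, backX_in (show 2 ≤ 2 ∧ 2 ≤ 2 * r + 2 by omega),
      backZ_in (show 2 ≤ 2 ∧ 2 ≤ 2 * r + 2 by omega), wordX_even (r + 2) g (show 2 % 2 = 0 from rfl),
      wordZ_even (r + 2) g (show 2 % 2 = 0 from rfl),
      backX_out (show ¬(2 ≤ 1 ∧ 1 ≤ 2 * r + 2) by omega),
      backZ_out (r := r) (show 1 < 2 ∨ 2 * r + 4 ≤ 1 by omega)]
    exact ⟨b2, Or.inr ⟨by ring, hpos hκ'⟩, Or.inl b1, Or.inl b1⟩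
  · refine ⟨σ', f j - f k, ?_⟩
    have he : (2 * r + 2) % 2 = 0 := by omega
    simp only [wordPerm_even (r + 2) g he, wordX_even (r + 2) g he,
      wordZ_even (r + 2) g he, show 2 * r + 2 + 1 = 2 * r + 3 by ring, Equiv.Perm.coe_one, id,
      x3, z3, backX_in (show 2 ≤ 2 * r + 2 ∧ 2 * r + 2 ≤ 2 * r + 2 by omega),
      backZ_in (show 2 ≤ 2 * r + 2 ∧ 2 * r + 2 ≤ 2 * r + 2 by omega),
      backX_out (show ¬(2 ≤ 2 * r + 3 ∧ 2 * r + 3 ≤ 2 * r + 2) by omega), backZ_last]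
    exact ⟨Or.inl c1, Or.inl c1, c2, Or.inr ⟨by ring, hpos hκ⟩⟩
  · refine ⟨τ', f j - f k, ?_⟩
    have he : (2 * r + 4) % 2 = 0 := by omega
    simp only [p3, wordX_even (r + 2) g he,
      wordZ_even (r + 2) g he, show 2 * r + 3 + 1 = 2 * r + 4 by ring,
      x3, z3, backX_out (show ¬(2 ≤ 2 * r + 4 ∧ 2 * r + 4 ≤ 2 * r + 2) by omega),
      backZ_out (r := r) (show 2 * r + 4 < 2 ∨ 2 * r + 4 ≤ 2 * r + 4 by omega),
      backX_out (show ¬(2 ≤ 2 * r + 3 ∧ 2 * r + 3 ≤ 2 * r + 2) by omega), backZ_last,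
      padPerm_padPerm]
    exact ⟨d2, Or.inr ⟨by ring, hpos hκ⟩, Or.inl d1, Or.inr ⟨by ring, hpos hκ⟩⟩

/-- On the back pages the first coordinates shrink by the factor `1 - t`, so they separate the
strands until `t = 1`; at that moment the layers do. -/
theorem BackLayered.separated (H : BackLayered r g f) {j k : Fin (N + 1)} (hjk : j ≠ k) {t : ℝ}
    (ht : 0 ≤ t) (ht1 : t ≤ 1) {l l' : ℕ} (hl : 2 * (r + 2) ≤ l)
    (hl' : l' = 0 ∨ 2 * (r + 2) ≤ l') :
    Separated ((1 - t) * wordX (r + 2) g l j + t * backX r g l j)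
      ((1 - t) * wordX (r + 2) g l' j + t * backX r g l' j)
      ((1 - t) * wordZ (r + 2) g l j + t * backZ r g f l j)
      ((1 - t) * wordZ (r + 2) g l' j + t * backZ r g f l' j)
      ((1 - t) * wordX (r + 2) g l k + t * backX r g l k)
      ((1 - t) * wordX (r + 2) g l' k + t * backX r g l' k)
      ((1 - t) * wordZ (r + 2) g l k + t * backZ r g f l k)
      ((1 - t) * wordZ (r + 2) g l' k + t * backZ r g f l' k) := by
  have hx : ∀ j, wordX (r + 2) g l' j = j := fun j => by
    rcases hl' with rfl | h
    · exact wordX_even _ _ rfl j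
    · exact wordX_ge _ _ h j
  have hz : ∀ j, wordZ (r + 2) g l' j = 0 := fun j => by
    rcases hl' with rfl | h
    · exact wordZ_even _ _ rfl j
    · exact wordZ_ge _ _ h j
  simp only [wordX_ge _ _ hl, wordZ_ge _ _ hl, hx, hz,
    backX_out (show ¬(2 ≤ l ∧ l ≤ 2 * r + 2) by omega),
    backX_out (show ¬(2 ≤ l' ∧ l' ≤ 2 * r + 2) by omega),
    backZ_out (show l < 2 ∨ 2 * r + 4 ≤ l by omega),
    backZ_out (show l' < 2 ∨ 2 * r + 4 ≤ l' by omega), mul_zero, add_zero, zero_add]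
  rcases ht1.lt_or_eq with h | rfl
  · have h' : 0 < 1 - t := by linarith
    rcases lt_or_gt_of_ne hjk with h1 | h1
    · have := mul_lt_mul_of_pos_left (fin_cast_lt h1) h'
      exact Or.inl ⟨this, this, this, this⟩
    · have := mul_lt_mul_of_pos_left (fin_cast_lt h1) h'
      exact Or.inr (Or.inl ⟨this, this, this, this⟩)
  · simp only [one_mul]
    rcases lt_or_gt_of_ne (H.inj.ne ((padPerm (g (r + 1))).injective.ne hjk)) with h1 | h1
    · exact Or.inr (Or.inr (Or.inl ⟨h1, h1⟩))
    · exact Or.inr (Or.inr (Or.inr ⟨h1, h1⟩))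

theorem BackLayered.braided (H : BackLayered r g f) :
    Braided (2 * (r + 2)) (wordPerm (r + 2) g) wordH (backX r g) (backZ r g f) := by
  refine ⟨(braided_word (r + 2) g).decr, fun l _ j => by linarith [H.zero_le l j], H.zero_le _,
    H.zero_le _, H.zero_le _, H.zero_le _, ?_, ?_⟩
  · intro l hl j k hjk
    rcases H.cone hl with ⟨h1, h2, h3, h4⟩ | hc
    · rw [h1, h2, h3, h4]; exact (braided_word (r + 2) g).front l hl j k hjk
    · obtain ⟨σ, κ, -, h1, -, h2⟩ := hc j k hjk
      exact h1.apart h2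
  · intro l hl hl' j k hjk
    rw [wordPerm_ge _ _ hl]
    have := H.separated hjk zero_le_one le_rfl hl (l' := nextPage (2 * (r + 2)) l)
      (by unfold nextPage; split_ifs <;> omega)
    simpa using this

theorem BackLayered.toLink_eq (H : BackLayered r g f) :
    wordLink (r + 2) g = H.braided.poly.toLink := by
  refine (braided_word (r + 2) g).toLink_eq H.braided ?_ ?_
  · have e : ∀ t x : ℝ, (1 - t) * x + t * x = x := fun t x => by ring
    intro t ht ht1 l hl j k hjk
    rcases H.cone hl with ⟨h1, h2, h3, h4⟩ | hc
    · rw [h1, h2, h3, h4, e, e, e, e]; exact (braided_word (r + 2) g).front l hl j k hjk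
    · obtain ⟨σ, κ, h1, h2, h3, h4⟩ := hc j k hjk
      exact (h1.convex h2 ht ht1).apart (h3.convex h4 ht ht1)
  · intro t ht ht1 l hl hl' j k hjk
    dsimp only
    rw [wordPerm_ge _ _ hl]
    exact H.separated hjk ht ht1 hl (by unfold nextPage; split_ifs <;> omega)

/-- Outside the inner letters the first coordinates are zero and a strand is known by its layer.
Strands of the two words in the same layer are matched, which behind the last letter means undoing
its permutation in one word and applying it in the other. -/
theorem BackLayered.edges_subset {g' : ℕ → Letter N} (H : BackLayered r g f)
    (H' : BackLayered r g' f) (hin : ∀ q, 0 < q → q ≤ r → g q = g' q) :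
    pageEdges (2 * (r + 2)) (wordPerm (r + 2) g) wordH (backX r g) (backZ r g f) ⊆
      pageEdges (2 * (r + 2)) (wordPerm (r + 2) g') wordH (backX r g') (backZ r g' f) := by
  have hX : ∀ l, 2 ≤ l → l ≤ 2 * r + 2 → backX r g l = backX r g' l := by
    intro l h1 h2
    rw [backX_in ⟨h1, h2⟩, backX_in ⟨h1, h2⟩]
    ext j
    rw [wordX, wordX]
    split_ifs with h
    · rw [hin (l / 2) (by omega) (by omega)]
    · rfl
  have hZ : ∀ l, 2 ≤ l → l ≤ 2 * r + 2 → backZ r g f l = backZ r g' f l := by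
    intro l h1 h2
    rw [backZ_in ⟨h1, h2⟩, backZ_in ⟨h1, h2⟩]
    ext j
    rw [wordZ, wordZ]
    split_ifs with h
    · rw [hin (l / 2) (by omega) (by omega)]
    · rfl
  have hX0 : ∀ l, (l < 2 ∨ 2 * r + 3 ≤ l) → ∀ j k, backX r g l j = backX r g' l k := by
    intro l hl j k
    rw [backX_out (by omega), backX_out (by omega)]
  have hZ0 : ∀ l, (l < 2 ∨ 2 * r + 4 ≤ l) → ∀ j, backZ r g f l j =
      backZ r g' f l (padPerm (g' (r + 1)) (padPerm (g (r + 1)) j)) := by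
    intro l hl j
    rw [backZ_out hl, backZ_out hl, padPerm_padPerm]
  have p1 : wordPerm (r + 2) g 1 = padPerm (g 0) := wordPerm_odd (r + 2) g (q := 0) (by omega)
  have p1' : wordPerm (r + 2) g' 1 = padPerm (g' 0) := wordPerm_odd (r + 2) g' (q := 0) (by omega)
  have p3 : wordPerm (r + 2) g (2 * r + 3) = padPerm (g (r + 1)) :=
    wordPerm_odd (r + 2) g (q := r + 1) (by omega)
  have p3' : wordPerm (r + 2) g' (2 * r + 3) = padPerm (g' (r + 1)) :=
    wordPerm_odd (r + 2) g' (q := r + 1) (by omega)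
  refine pageEdges_subset fun l hl j => ?_
  rcases le_or_gt (2 * (r + 2)) l with h | h
  · refine ⟨padPerm (g' (r + 1)) (padPerm (g (r + 1)) j), hX0 _ (by omega) _ _,
      hZ0 _ (by omega) _, ?_, ?_⟩ <;> rw [wordPerm_ge _ _ h, wordPerm_ge _ _ h]
    · exact hX0 _ (by unfold nextPage; split_ifs <;> omega) _ _
    · exact hZ0 _ (by unfold nextPage; split_ifs <;> omega) _
  rw [nextPage_front h]
  by_cases hs : 2 ≤ l ∧ l < 2 * r + 2
  · have : wordPerm (r + 2) g l = wordPerm (r + 2) g' l := by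
      rw [wordPerm, wordPerm]
      split_ifs with h
      · rw [hin (l / 2) (by omega) (by omega)]
      · rfl
    refine ⟨j, ?_⟩
    rw [this, hX _ (by omega) (by omega), hX _ (by omega) (by omega), hZ _ (by omega) (by omega),
      hZ _ (by omega) (by omega)]
    exact ⟨rfl, rfl, rfl, rfl⟩
  obtain rfl | rfl | rfl | rfl : l = 0 ∨ l = 1 ∨ l = 2 * r + 2 ∨ l = 2 * r + 3 := by omega
  · refine ⟨padPerm (g' (r + 1)) (padPerm (g (r + 1)) j), hX0 _ (by omega) _ _,
      hZ0 _ (by omega) _, hX0 _ (by omega) _ _, ?_⟩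
    rw [wordPerm_even _ _ rfl, wordPerm_even _ _ rfl]
    exact hZ0 _ (by omega) _
  · refine ⟨padPerm (g' 0) (padPerm (g 0) j), hX0 _ (by omega) _ _, ?_, ?_, ?_⟩
    · rw [backZ_out (by omega), backZ_out (by omega), H'.closed, ← H.closed (padPerm (g 0) j),
        padPerm_padPerm]
    · rw [p1, p1', padPerm_padPerm, hX _ (by omega) (by omega)]
    · rw [p1, p1', padPerm_padPerm, hZ _ (by omega) (by omega)]
  · refine ⟨j, ?_⟩
    rw [wordPerm_even _ _ (by omega), wordPerm_even _ _ (by omega), hX _ (by omega) le_rfl,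
      hZ _ (by omega) le_rfl]
    refine ⟨rfl, rfl, hX0 _ (by omega) _ _, ?_⟩
    rw [show 2 * r + 2 + 1 = 2 * r + 3 by ring, backZ_last, backZ_last]
  · refine ⟨j, hX0 _ (by omega) _ _, ?_, hX0 _ (by omega) _ _, ?_⟩
    · rw [backZ_last, backZ_last]
    · rw [p3, p3', backZ_out (by omega), backZ_out (by omega), padPerm_padPerm, padPerm_padPerm]

theorem BackLayered.wordLink_eq {g' : ℕ → Letter N} (H : BackLayered r g f)
    (H' : BackLayered r g' f) (hin : ∀ q, 0 < q → q ≤ r → g q = g' q) :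
    wordLink (r + 2) g = wordLink (r + 2) g' := by
  rw [H.toLink_eq, H'.toLink_eq]
  refine congrArg PolyLink.toLink (PolyLink.ext_edges ?_)
  rw [Braided.poly_edges, Braided.poly_edges]
  exact Set.Subset.antisymm (H.edges_subset H' hin)
    (H'.edges_subset H fun q hq hq' => (hin q hq hq').symm)

end

theorem padFn_bracket {N : ℕ} (a b : Letter N) (w : List (Letter N)) :
    padFn (a :: (w ++ [b])) 0 = a ∧ padFn (a :: (w ++ [b])) (w.length + 1) = b ∧
      ∀ q, 0 < q → q ≤ w.length → padFn (a :: (w ++ [b])) q = padFn w (q - 1) := by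
  refine ⟨rfl, by simp [padFn], fun q hq hq' => ?_⟩
  obtain ⟨q, rfl⟩ : ∃ p, q = p + 1 := ⟨q - 1, by omega⟩
  simp [padFn, List.getElem?_append_left (show q < w.length by omega)]

/-- Conjugate braids have the same closure. -/
theorem padLink_conj {N : ℕ} (i : Fin N) (w : List (Letter N)) :
    padLink (some (i, true) :: (w ++ [some (i, false)])) = padLink (none :: (w ++ [none])) := by
  have hlt : ((i.castSucc : Fin (N + 1)) : ℝ) < (i.succ : Fin (N + 1)) :=
    fin_cast_lt Fin.castSucc_lt_succ
  obtain ⟨h1, h2, h3⟩ := padFn_bracket (some (i, true)) (some (i, false)) w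
  obtain ⟨h1', h2', h3'⟩ := padFn_bracket (none : Letter N) none w
  rw [padLink, padLink, show (some (i, true) :: (w ++ [some (i, false)])).length = w.length + 2 by
    simp, show (none :: (w ++ [none])).length = w.length + 2 by simp]
  -- Layers decrease from left to right because the last letter is an inverse generator, whose left
  -- strand is on top. That strand is also on top in the first letter, on the other side of the
  -- back.
  refine BackLayered.wordLink_eq (f := fun j => (N : ℝ) - j)
    ⟨sub_val_injective, sub_val_nonneg, ?_, ?_, ?_⟩ ⟨sub_val_injective, sub_val_nonneg, ?_, ?_, ?_⟩
    fun q hq hq' => (h3 q hq hq').trans (h3' q hq hq').symm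
  · rw [h2]
    simp only [LetterAbove]
    linarith
  · rw [h1, h2]
    simp only [LetterAbove, padPerm, letterPerm, Equiv.swap_apply_left, Equiv.swap_apply_right]
    linarith
  · intro j
    rw [h1, h2]
    simp [padPerm, letterPerm]
  · rw [h2']
    trivial
  · rw [h1']
    trivial
  · intro j
    rw [h1', h2']
    rfl

/-! ### Removing a loop -/

/-- A triangle and a segment on different sides of a plane meet at most in the vertex `a`. -/
theorem triangle_inter_left {a b c : Space} {e : Space × Space} (α β γ v : ℝ)
    (ha : v ≤ α * a 0 + β * a 1 + γ * a 2) (hb : v < α * b 0 + β * b 1 + γ * b 2)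
    (hc : v < α * c 0 + β * c 1 + γ * c 2) (he : α * e.1 0 + β * e.1 1 + γ * e.1 2 ≤ v)
    (he' : α * e.2 0 + β * e.2 1 + γ * e.2 2 ≤ v) :
    convexHull ℝ {a, b, c} ∩ segment ℝ e.1 e.2 ⊆ {a, b} := by
  rintro x ⟨hx, hx'⟩
  obtain ⟨s, t, hs, hs1, ht, ht1, rfl⟩ := mem_triangle.1 hx
  obtain ⟨u, hu, hu1, h⟩ := mem_seg.1 hx'
  have h0 := congrFun h 0
  have h1 := congrFun h 1
  have h2 := congrFun h 2
  simp only [Pi.add_apply, Pi.smul_apply, smul_eq_mul] at h0 h1 h2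
  have k1 := convex_le hu hu1 he he'
  -- The linear form exceeds `v` on the side opposite to `a`, so a common point with the segment has
  -- parameter `s = 0`.
  have k2 := lt_convex ht ht1 hb hc
  have k3 : (1 - s) * (α * a 0 + β * a 1 + γ * a 2) + s * ((1 - t) * (α * b 0 + β * b 1 + γ * b 2) +
      t * (α * c 0 + β * c 1 + γ * c 2)) ≤ v := by
    calc _ = (1 - u) * (α * e.1 0 + β * e.1 1 + γ * e.1 2) +
        u * (α * e.2 0 + β * e.2 1 + γ * e.2 2) := by
          linear_combination -α * h0 - β * h1 - γ * h2
      _ ≤ v := k1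
  rcases hs.eq_or_lt with rfl | hs0
  · simp
  · have := mul_pos hs0 (sub_pos.2 k2)
    have := mul_nonneg (sub_nonneg.2 hs1) (sub_nonneg.2 ha)
    exact absurd k3 (not_le.2 (by linarith))

/-- A triangle and a segment on different sides of a plane meet at most in the vertex `b`. -/
theorem triangle_inter_right {a b c : Space} {e : Space × Space} (α β γ v : ℝ)
    (ha : v < α * a 0 + β * a 1 + γ * a 2) (hb : v ≤ α * b 0 + β * b 1 + γ * b 2)
    (hc : v < α * c 0 + β * c 1 + γ * c 2) (he : α * e.1 0 + β * e.1 1 + γ * e.1 2 ≤ v)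
    (he' : α * e.2 0 + β * e.2 1 + γ * e.2 2 ≤ v) :
    convexHull ℝ {a, b, c} ∩ segment ℝ e.1 e.2 ⊆ {a, b} := by
  rw [Set.insert_comm, Set.pair_comm a b]
  exact triangle_inter_left α β γ v hb ha hc he he'

/-- The vertices of a vertical line. -/
noncomputable def vertPt (x : ℝ) (l : ℕ) : Space := ![x + 1, -(l : ℝ) / 2, 0]

section
variable {x p z z' : ℝ} {R : Set (Space × Space)}

/-- The last strand comes straight down the line with first coordinate `x + 1` to the crossing. Its
vertices are removed from below, and each triangle is kept from every other edge by an explicit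
plane. The bound `n ≤ 2 * p` keeps these vertices above the crossing. -/
theorem exists_remove_vertical (hR : ∀ e ∈ R, e.1 0 ≤ x ∧ e.2 0 ≤ x)
    (hz : 0 ≤ z') (n : ℕ) (hn : (n : ℝ) ≤ 2 * p) (K : PolyLink)
    (hK : K.edges = insert (vertPt x n, ![x + 1 / 2, -p - 1 / 2, z']) (pathEdges (vertPt x) n ∪
      insert (![x, -p, 0], ![x + 1 / 2, -p - 1 / 2, z])
      (insert (![x + 1 / 2, -p - 1 / 2, z], ![x + 1, -p - 1, 0])
      (insert (![x + 1, -p - 1, 0], ![x + 1, -p - 2, -1])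
      (insert (![x + 1, -p - 2, -1], ![x + 1, 1, -1])
      (insert (![x + 1, 1, -1], vertPt x 0)
      (insert (![x + 1 / 2, -p - 1 / 2, z'], ![x, -p - 1, 0]) R))))))) :
    ∃ L : PolyLink, L.edges = insert (vertPt x 0, ![x + 1 / 2, -p - 1 / 2, z'])
      (insert (![x, -p, 0], ![x + 1 / 2, -p - 1 / 2, z])
      (insert (![x + 1 / 2, -p - 1 / 2, z], ![x + 1, -p - 1, 0])
      (insert (![x + 1, -p - 1, 0], ![x + 1, -p - 2, -1])
      (insert (![x + 1, -p - 2, -1], ![x + 1, 1, -1])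
      (insert (![x + 1, 1, -1], vertPt x 0)
      (insert (![x + 1 / 2, -p - 1 / 2, z'], ![x, -p - 1, 0]) R)))))) ∧ L.toLink = K.toLink := by
  induction n generalizing K with
  | zero =>
    refine ⟨K, ?_, rfl⟩
    have : pathEdges (vertPt x) 0 = ∅ := by
      ext e; simp [pathEdges]
    rw [hK, this, Set.empty_union]
  | succ n ih =>
    push_cast at hn
    rw [pathEdges_succ, Set.insert_union] at hK
    rw [Set.insert_comm] at hK
    obtain ⟨L, hL, hLK⟩ := exists_remove_insert K hK (by
      rintro e (⟨l, hl, rfl⟩ | rfl | rfl | rfl | rfl | rfl | rfl | he)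
      · have : (l : ℝ) + 1 ≤ n := by exact_mod_cast hl
        refine triangle_inter_left 0 (-1) 0 (n / 2) ?_ ?_ ?_ ?_ ?_ <;>
          simp [vertPt] <;> linarith
      · refine triangle_inter_right 1 0 0 (x + 1 / 2) ?_ ?_ ?_ ?_ ?_ <;>
          simp [vertPt] <;> linarith
      · refine triangle_inter_right 0 1 0 (-p - 1 / 2) ?_ ?_ ?_ ?_ ?_ <;>
          simp [vertPt] <;> linarith
      · refine triangle_inter_right 0 1 0 (-p - 1 / 2) ?_ ?_ ?_ ?_ ?_ <;>
          simp [vertPt] <;> linarith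
      · refine triangle_inter_right 0 0 1 (-1 / 2) ?_ ?_ ?_ ?_ ?_ <;>
          simp [vertPt] <;> linarith
      · refine triangle_inter_left 0 (-1) 0 (n / 2) ?_ ?_ ?_ ?_ ?_ <;>
          simp [vertPt] <;> linarith
      · refine triangle_inter_right 1 0 0 (x + 1 / 2) ?_ ?_ ?_ ?_ ?_ <;>
          simp [vertPt] <;> linarith
      · have := hR e he
        refine triangle_inter_right 1 0 0 (x + 1 / 2) ?_ ?_ ?_ ?_ ?_ <;>
          simp [vertPt] <;> linarith)
    obtain ⟨L', hL', hLK'⟩ := ih (by linarith) L hL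
    exact ⟨L', hL', hLK'.trans hLK⟩

/-- The six vertices of the loop disappear in turn: the upper and the lower corner of the closing
arc, the top and the bottom of the last strand, and the two points of the crossing. Each of the
first five triangles is separated from the other edges by explicit planes, which depend on which
strand is on top. -/
theorem exists_remove_loop (hR : ∀ e ∈ R, e.1 0 ≤ x ∧ e.2 0 ≤ x) (hp : 0 ≤ p)
    (hz : z = 0 ∧ z' = 1 ∨ z = 1 ∧ z' = 0)
    (hST : ∀ e ∈ R, segment ℝ ![x, -p, 0] ![x, -p - 1, 0] ∩ segment ℝ e.1 e.2 ⊆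
      {![x, -p, 0], ![x, -p - 1, 0]}) (K : PolyLink)
    (hK : K.edges = insert (vertPt x 0, ![x + 1 / 2, -p - 1 / 2, z'])
      (insert (![x, -p, 0], ![x + 1 / 2, -p - 1 / 2, z])
      (insert (![x + 1 / 2, -p - 1 / 2, z], ![x + 1, -p - 1, 0])
      (insert (![x + 1, -p - 1, 0], ![x + 1, -p - 2, -1])
      (insert (![x + 1, -p - 2, -1], ![x + 1, 1, -1])
      (insert (![x + 1, 1, -1], vertPt x 0)
      (insert (![x + 1 / 2, -p - 1 / 2, z'], ![x, -p - 1, 0]) R))))))) :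
    ∃ L : PolyLink, L.edges = insert (![x, -p, 0], ![x, -p - 1, 0]) R ∧ L.toLink = K.toLink := by
  have hz0 : 0 ≤ z := by rcases hz with ⟨rfl, rfl⟩ | ⟨rfl, rfl⟩ <;> norm_num
  have hz0' : 0 ≤ z' := by rcases hz with ⟨rfl, rfl⟩ | ⟨rfl, rfl⟩ <;> norm_num
  obtain ⟨K1, hK1, h1⟩ := exists_remove_insert K
    (a := ![x + 1, -p - 2, -1]) (c := ![x + 1, 1, -1]) (b := vertPt x 0)
    (E := insert (![x + 1, -p - 1, 0], ![x + 1, -p - 2, -1])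
      (insert (vertPt x 0, ![x + 1 / 2, -p - 1 / 2, z'])
      (insert (![x + 1 / 2, -p - 1 / 2, z], ![x + 1, -p - 1, 0])
      (insert (![x, -p, 0], ![x + 1 / 2, -p - 1 / 2, z])
      (insert (![x + 1 / 2, -p - 1 / 2, z'], ![x, -p - 1, 0]) R)))))
    (by rw [hK]; ext e; simp only [Set.mem_insert_iff]; tauto) (by
      rintro e (rfl | rfl | rfl | rfl | rfl | he)
      · refine triangle_inter_left 0 2 (-3) (-2 * p - 1) ?_ ?_ ?_ ?_ ?_ <;>
          simp [vertPt] <;> linarith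
      · refine triangle_inter_right 0 0 (-1) 0 ?_ ?_ ?_ ?_ ?_ <;>
          simp [vertPt]
        linarith
      · refine triangle_inter_left 0 2 (-3) (-2 * p - 1) ?_ ?_ ?_ ?_ ?_ <;>
          simp [vertPt] <;> linarith
      · refine triangle_inter_right 1 0 0 (x + 1 / 2) ?_ ?_ ?_ ?_ ?_ <;>
          simp [vertPt] <;> linarith
      · refine triangle_inter_right 1 0 0 (x + 1 / 2) ?_ ?_ ?_ ?_ ?_ <;>
          simp [vertPt] <;> linarith
      · have := hR e he
        refine triangle_inter_right 1 0 0 (x + 1 / 2) ?_ ?_ ?_ ?_ ?_ <;>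
          simp [vertPt] <;> linarith)
  rw [Set.insert_comm] at hK1
  obtain ⟨K2, hK2, h2⟩ := exists_remove_insert K1 hK1 (by
      rintro e (rfl | rfl | rfl | rfl | he)
      · refine triangle_inter_right (2 * p + 2) (-1) 0 ((2 * p + 2) * (x + 1)) ?_ ?_ ?_ ?_ ?_ <;>
          simp [vertPt] <;> linarith
      · refine triangle_inter_left 1 1 (-2) (x - p) ?_ ?_ ?_ ?_ ?_ <;>
          simp [vertPt] <;> linarith
      · refine triangle_inter_right 1 0 0 (x + 1 / 2) ?_ ?_ ?_ ?_ ?_ <;>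
          simp [vertPt] <;> linarith
      · refine triangle_inter_right 1 0 0 (x + 1 / 2) ?_ ?_ ?_ ?_ ?_ <;>
          simp [vertPt] <;> linarith
      · have := hR e he
        refine triangle_inter_right 1 0 0 (x + 1 / 2) ?_ ?_ ?_ ?_ ?_ <;>
          simp [vertPt] <;> linarith)
  obtain ⟨K3, hK3, h3⟩ := exists_remove_insert K2 hK2 (by
      rintro e (rfl | rfl | rfl | he)
      · rcases hz with ⟨rfl, rfl⟩ | ⟨rfl, rfl⟩
        · refine triangle_inter_left 1 1 1 (x - p) ?_ ?_ ?_ ?_ ?_ <;>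
            simp [vertPt] <;> linarith
        · refine triangle_inter_left 0 1 (-1) (-p - 1) ?_ ?_ ?_ ?_ ?_ <;>
            simp [vertPt] <;> linarith
      · refine triangle_inter_right 1 0 0 (x + 1 / 2) ?_ ?_ ?_ ?_ ?_ <;>
          simp [vertPt] <;> linarith
      · refine triangle_inter_right 1 0 0 (x + 1 / 2) ?_ ?_ ?_ ?_ ?_ <;>
          simp [vertPt] <;> linarith
      · have := hR e he
        refine triangle_inter_right 1 0 0 (x + 1 / 2) ?_ ?_ ?_ ?_ ?_ <;>
          simp [vertPt] <;> linarith)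
  rw [Set.insert_comm] at hK3
  obtain ⟨K4, hK4, h4⟩ := exists_remove_insert K3 hK3 (by
      rintro e (rfl | rfl | he)
      · rcases hz with ⟨rfl, rfl⟩ | ⟨rfl, rfl⟩
        · refine triangle_inter_left 4 0 1 (4 * x + 2) ?_ ?_ ?_ ?_ ?_ <;>
            simp <;> linarith
        · refine triangle_inter_left 4 0 (-1) (4 * x + 1) ?_ ?_ ?_ ?_ ?_ <;>
            simp <;> linarith
      · rcases hz with ⟨rfl, rfl⟩ | ⟨rfl, rfl⟩
        · refine triangle_inter_right 4 0 (-1) (4 * x + 1) ?_ ?_ ?_ ?_ ?_ <;>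
            simp <;> linarith
        · refine triangle_inter_right 4 0 1 (4 * x + 2) ?_ ?_ ?_ ?_ ?_ <;>
            simp <;> linarith
      · have := hR e he
        refine triangle_inter_right 1 0 0 (x + 1 / 4) ?_ ?_ ?_ ?_ ?_ <;>
          simp <;> linarith)
  rw [Set.insert_comm] at hK4
  obtain ⟨K5, hK5, h5⟩ := exists_remove_insert K4 hK4 (by
      rintro e (rfl | he)
      · rcases hz with ⟨rfl, rfl⟩ | ⟨rfl, rfl⟩
        · refine triangle_inter_right 0 4 (-1) (-4 * p - 3) ?_ ?_ ?_ ?_ ?_ <;>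
            simp <;> linarith
        · refine triangle_inter_right 0 4 1 (-4 * p - 2) ?_ ?_ ?_ ?_ ?_ <;>
            simp <;> linarith
      · have := hR e he
        refine triangle_inter_left 1 0 0 x ?_ ?_ ?_ ?_ ?_ <;>
          simp <;> linarith)
  -- This triangle has a whole side in the plane with first coordinate `x`, where edges of `R` may
  -- lie. Plane separation no longer suffices, and `hST` is needed.
  obtain ⟨K6, hK6, h6⟩ := exists_remove_insert K5 hK5 (by
      rintro e he y ⟨hy, hy'⟩
      refine hST e he ⟨?_, hy'⟩
      obtain ⟨s, t, hs, hs1, ht, ht1, rfl⟩ := mem_triangle.1 hy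
      obtain ⟨u, hu, hu1, h⟩ := mem_seg.1 hy'
      have h0 := congrFun h 0
      simp at h0
      have := convex_le hu hu1 (hR e he).1 (hR e he).2
      -- The first coordinate in the triangle is `x + s * t / 2`, while on `R` it is at most `x`.
      have hst : s * t = 0 := by
        have := mul_nonneg hs ht
        linarith
      rw [mem_seg]
      refine ⟨s, hs, hs1, ?_⟩
      rw [space_eq_iff]
      refine ⟨?_, ?_, ?_⟩ <;>
        simp only [Pi.add_apply, Pi.smul_apply, smul_eq_mul, Matrix.cons_val]
      · linear_combination -(1 / 2) * hst
      · linear_combination -(1 / 2) * hst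
      · linear_combination -z' * hst)
  exact ⟨K6, hK6, by rw [h6, h5, h4, h3, h2, h1]⟩

end

/-! ### Stabilization -/

/-- The first half of the strand that starts at position `j` at letter `q`. -/
noncomputable def upperEdge {N : ℕ} (g : Letter N) (q : ℕ) (j : Fin (N + 1)) : Space × Space :=
  (![(j : ℝ), -(q : ℝ), 0], ![((j : ℝ) + padPerm g j) / 2, -(q : ℝ) - 1 / 2, padLift g j])

/-- The second half of the strand that starts at position `j` at letter `q`. -/
noncomputable def lowerEdge {N : ℕ} (g : Letter N) (q : ℕ) (j : Fin (N + 1)) : Space × Space :=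
  (![((j : ℝ) + padPerm g j) / 2, -(q : ℝ) - 1 / 2, padLift g j],
    ![(padPerm g j : ℝ), -((q + 1 : ℕ) : ℝ), 0])

/-- The closing arcs of a braid. -/
def backEdges (N m : ℕ) : Set (Space × Space) :=
  {e | ∃ j : Fin (N + 1), e = (levelPt m j, lowPt m j) ∨ e = (lowPt m j, highPt j) ∨
      e = (highPt j, levelPt 0 j)}

theorem exists_padLink_poly {N : ℕ} (w : List (Letter N)) : ∃ K : PolyLink,
    K.edges = {e | ∃ q < w.length, ∃ j, e = upperEdge (padFn w q) q j ∨
      e = lowerEdge (padFn w q) q j} ∪ backEdges N w.length ∧ K.toLink = padLink w := by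
  refine ⟨(braided_word w.length (padFn w)).poly, ?_, rfl⟩
  rw [Braided.poly_edges, pageEdges_word]
  rfl

/-- A letter as a letter on one more strand. -/
def liftLetter {N : ℕ} (g : Letter N) : Letter (N + 1) := g.map fun a => (a.1.castSucc, a.2)

theorem padPerm_liftLetter {N : ℕ} (g : Letter N) (j : Fin (N + 1)) :
    padPerm (liftLetter g) j.castSucc = (padPerm g j).castSucc := by
  rcases g with _ | ⟨i, b⟩
  · rfl
  · simp only [liftLetter, Option.map_some, padPerm, letterPerm, Fin.succ_castSucc]
    rw [← Fin.castSucc_injective _ |>.map_swap]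

theorem padPerm_liftLetter_last {N : ℕ} (g : Letter N) :
    padPerm (liftLetter g) (Fin.last (N + 1)) = Fin.last (N + 1) := by
  rcases g with _ | ⟨i, b⟩
  · rfl
  · simp only [liftLetter, Option.map_some, padPerm, letterPerm, Fin.succ_castSucc]
    exact Equiv.swap_apply_of_ne_of_ne (Fin.castSucc_lt_last _).ne' (Fin.castSucc_lt_last _).ne'

theorem padLift_liftLetter {N : ℕ} (g : Letter N) (j : Fin (N + 1)) :
    padLift (liftLetter g) j.castSucc = padLift g j := by
  rcases g with _ | ⟨i, b⟩
  · rfl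
  · cases b <;> simp [liftLetter, padLift, letterOver, Fin.ext_iff]

theorem padLift_liftLetter_last {N : ℕ} (g : Letter N) :
    padLift (liftLetter g) (Fin.last (N + 1)) = 0 := by
  rcases g with _ | ⟨i, b⟩
  · rfl
  · have h1 : N + 1 ≠ i := by have := i.2; omega
    have h2 : N ≠ (i : ℕ) := by have := i.2; omega
    cases b <;> simp [liftLetter, padLift, letterOver, Fin.ext_iff, h1, h2]

theorem upperEdge_liftLetter {N : ℕ} (g : Letter N) (q : ℕ) (j : Fin (N + 1)) :
    upperEdge (liftLetter g) q j.castSucc = upperEdge g q j := by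
  rw [upperEdge, upperEdge, padPerm_liftLetter, padLift_liftLetter]
  rfl

theorem lowerEdge_liftLetter {N : ℕ} (g : Letter N) (q : ℕ) (j : Fin (N + 1)) :
    lowerEdge (liftLetter g) q j.castSucc = lowerEdge g q j := by
  rw [lowerEdge, lowerEdge, padPerm_liftLetter, padLift_liftLetter]
  rfl

theorem upperEdge_liftLetter_last {N : ℕ} (g : Letter N) (q : ℕ) :
    upperEdge (liftLetter g) q (Fin.last (N + 1)) =
      (vertPt N (2 * q), vertPt N (2 * q + 1)) := by
  rw [upperEdge, padPerm_liftLetter_last, padLift_liftLetter_last, vertPt, vertPt, Prod.mk.injEq]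
  constructor <;> rw [space_eq_iff] <;> refine ⟨?_, ?_, ?_⟩ <;>
    simp only [Matrix.cons_val, Fin.val_last] <;> push_cast <;> ring

theorem lowerEdge_liftLetter_last {N : ℕ} (g : Letter N) (q : ℕ) :
    lowerEdge (liftLetter g) q (Fin.last (N + 1)) =
      (vertPt N (2 * q + 1), vertPt N (2 * q + 1 + 1)) := by
  rw [lowerEdge, padPerm_liftLetter_last, padLift_liftLetter_last, vertPt, vertPt, Prod.mk.injEq]
  constructor <;> rw [space_eq_iff] <;> refine ⟨?_, ?_, ?_⟩ <;>
    simp only [Matrix.cons_val, Fin.val_last] <;> push_cast <;> ring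

/-- The edges of the closure of a word that ends with a trivial letter, except for the strand of
that letter at the last position. -/
def bodyEdges {N : ℕ} (w : List (Letter N)) : Set (Space × Space) :=
  {e | ∃ q < w.length, ∃ j, e = upperEdge (padFn w q) q j ∨ e = lowerEdge (padFn w q) q j} ∪
  {e | ∃ j ≠ Fin.last N, e = upperEdge none w.length j ∨ e = lowerEdge none w.length j} ∪
  backEdges N (w.length + 1)

theorem padFn_concat {N : ℕ} (w : List (Letter N)) (g : Letter N) :
    padFn (w ++ [g]) w.length = g := by simp [padFn]

theorem padLink_concat_none_edges {N : ℕ} (w : List (Letter N)) :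
    {e | ∃ q < (w ++ [none]).length, ∃ j, e = upperEdge (padFn (w ++ [none]) q) q j ∨
      e = lowerEdge (padFn (w ++ [none]) q) q j} ∪ backEdges N (w ++ [none]).length =
    insert (upperEdge (none : Letter N) w.length (Fin.last N))
      (insert (lowerEdge (none : Letter N) w.length (Fin.last N)) (bodyEdges w)) := by
  ext e
  simp only [List.length_append, List.length_singleton, Set.mem_union, Set.mem_insert_iff,
    bodyEdges, Set.mem_ofPred_eq]
  constructor
  · rintro (⟨q, hq, j, h⟩ | h)
    · rcases (Nat.lt_succ_iff.1 hq).lt_or_eq with hq | rfl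
      · rw [padFn_append_left _ _ hq] at h
        exact Or.inr (Or.inr (Or.inl (Or.inl ⟨q, hq, j, h⟩)))
      · rw [padFn_concat] at h
        by_cases hj : j = Fin.last N
        · subst hj; tauto
        · exact Or.inr (Or.inr (Or.inl (Or.inr ⟨j, hj, h⟩)))
    · tauto
  · rintro (h | h | (⟨q, hq, j, h⟩ | ⟨j, hj, h⟩) | h)
    · exact Or.inl ⟨w.length, by omega, Fin.last N, by rw [padFn_concat]; exact Or.inl h⟩
    · exact Or.inl ⟨w.length, by omega, Fin.last N, by rw [padFn_concat]; exact Or.inr h⟩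
    · exact Or.inl ⟨q, by omega, j, by rw [padFn_append_left _ _ hq]; exact h⟩
    · exact Or.inl ⟨w.length, by omega, j, by rw [padFn_concat]; exact h⟩
    · exact Or.inr h

/-- The rest of the braid lies on or to the left of position `N`, so that the loop of the last
strand can be contracted without meeting it. -/
theorem body_le {N : ℕ} (w : List (Letter N)) : ∀ e ∈ bodyEdges w, e.1 0 ≤ N ∧ e.2 0 ≤ N := by
  have hj : ∀ j : Fin (N + 1), (j : ℝ) ≤ N := fun j => by
    exact_mod_cast Nat.lt_succ_iff.1 j.2
  rintro e ((⟨q, hq, j, rfl | rfl⟩ | ⟨j, -, rfl | rfl⟩) | ⟨j, rfl | rfl | rfl⟩) <;>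
    simp only [upperEdge, lowerEdge, levelPt, lowPt, highPt, Matrix.cons_val] <;>
    constructor <;> first
      | linarith [hj j, hj (padPerm (none : Letter N) j)]
      | linarith [hj j, hj (padPerm (padFn w q) j)]

/-- No other edge starts at the two upper vertices of the straight strand into which the loop is
contracted. -/
theorem body_fst {N : ℕ} (w : List (Letter N)) : ∀ e ∈ bodyEdges w, e.1 0 = N →
    e.1 1 ≠ -(w.length : ℝ) ∧ e.1 1 ≠ -(w.length : ℝ) - 1 / 2 := by
  have h0 : (0 : ℝ) ≤ w.length := Nat.cast_nonneg _
  rintro e ((⟨q, hq, j, rfl | rfl⟩ | ⟨j, hj, rfl | rfl⟩) | ⟨j, rfl | rfl | rfl⟩) hx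
  · have : (q : ℝ) + 1 ≤ w.length := by exact_mod_cast hq
    simp only [upperEdge, Matrix.cons_val]
    constructor <;> intro h <;> linarith
  · have : (q : ℝ) + 1 ≤ w.length := by exact_mod_cast hq
    simp only [lowerEdge, Matrix.cons_val]
    constructor <;> intro h <;> linarith
  · refine absurd (finVal_inj ?_) hj
    simpa [upperEdge] using hx
  · refine absurd (finVal_inj ?_) hj
    simpa [lowerEdge, padPerm] using hx
  · simp only [levelPt, Matrix.cons_val]
    push_cast
    constructor <;> intro h <;> linarith
  · simp only [lowPt, Matrix.cons_val]
    push_cast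
    constructor <;> intro h <;> linarith
  · simp only [highPt, Matrix.cons_val]
    constructor <;> intro h <;> linarith

/-- The loop that the last strand forms at a letter at the last two positions. -/
theorem padLink_concat_last_edges {N : ℕ} (w : List (Letter N)) (b : Bool) :
    {e | ∃ q < (w.map liftLetter ++ [some (Fin.last N, b)]).length, ∃ j,
      e = upperEdge (padFn (w.map liftLetter ++ [some (Fin.last N, b)]) q) q j ∨
      e = lowerEdge (padFn (w.map liftLetter ++ [some (Fin.last N, b)]) q) q j} ∪
      backEdges (N + 1) (w.map liftLetter ++ [some (Fin.last N, b)]).length =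
    insert (vertPt N (2 * w.length : ℕ), ![(N : ℝ) + 1 / 2, -(w.length : ℝ) - 1 / 2, if b then 1 else 0])
      (pathEdges (vertPt N) (2 * w.length) ∪
      insert (![(N : ℝ), -(w.length : ℝ), 0], ![(N : ℝ) + 1 / 2, -(w.length : ℝ) - 1 / 2, if b then 0 else 1])
      (insert (![(N : ℝ) + 1 / 2, -(w.length : ℝ) - 1 / 2, if b then 0 else 1], ![(N : ℝ) + 1, -(w.length : ℝ) - 1, 0])
      (insert (![(N : ℝ) + 1, -(w.length : ℝ) - 1, 0], ![(N : ℝ) + 1, -(w.length : ℝ) - 2, -1])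
      (insert (![(N : ℝ) + 1, -(w.length : ℝ) - 2, -1], ![(N : ℝ) + 1, 1, -1])
      (insert (![(N : ℝ) + 1, 1, -1], vertPt N 0)
      (insert (![(N : ℝ) + 1 / 2, -(w.length : ℝ) - 1 / 2, if b then 1 else 0], ![(N : ℝ), -(w.length : ℝ) - 1, 0])
        (bodyEdges w))))))) := by
  have hlen : (w.map liftLetter ++ [some (Fin.last N, b)]).length = w.length + 1 := by simp
  have hfn : ∀ q, q < w.length → padFn (w.map liftLetter ++ [some (Fin.last N, b)]) q =
      liftLetter (padFn w q) := by
    intro q hq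
    rw [padFn_append_left _ _ (by simpa using hq)]
    simp [padFn, hq]
  have hfl : padFn (w.map liftLetter ++ [some (Fin.last N, b)]) w.length = some (Fin.last N, b) := by
    have := padFn_concat (w.map liftLetter) (some (Fin.last N, b))
    rwa [List.length_map] at this
  have hs : ((Fin.last N).succ : Fin (N + 2)) = Fin.last (N + 1) := rfl
  have hne : (Fin.last N).castSucc ≠ Fin.last (N + 1) := (Fin.castSucc_lt_last _).ne
  have u1 : upperEdge (some (Fin.last N, b)) w.length (Fin.last N).castSucc =
      (![(N : ℝ), -(w.length : ℝ), 0], ![(N : ℝ) + 1 / 2, -(w.length : ℝ) - 1 / 2, if b then 0 else 1]) := by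
    rw [upperEdge, Prod.mk.injEq]
    constructor <;> rw [space_eq_iff] <;> refine ⟨?_, ?_, ?_⟩ <;>
      cases b <;> simp [padPerm, letterPerm, padLift, letterOver, hs, hne] <;> ring
  have u2 : lowerEdge (some (Fin.last N, b)) w.length (Fin.last N).castSucc =
      (![(N : ℝ) + 1 / 2, -(w.length : ℝ) - 1 / 2, if b then 0 else 1], ![(N : ℝ) + 1, -(w.length : ℝ) - 1, 0]) := by
    rw [lowerEdge, Prod.mk.injEq]
    constructor <;> rw [space_eq_iff] <;> refine ⟨?_, ?_, ?_⟩ <;>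
      cases b <;> simp [padPerm, letterPerm, padLift, letterOver, hs, hne] <;> ring
  have u3 : upperEdge (some (Fin.last N, b)) w.length (Fin.last (N + 1)) =
      (vertPt N (2 * w.length : ℕ),
        ![(N : ℝ) + 1 / 2, -(w.length : ℝ) - 1 / 2, if b then 1 else 0]) := by
    rw [upperEdge, Prod.mk.injEq, vertPt]
    constructor <;> rw [space_eq_iff] <;> refine ⟨?_, ?_, ?_⟩ <;>
      cases b <;> simp [padPerm, letterPerm, padLift, letterOver, hs, hne.symm] <;> ring
  have u4 : lowerEdge (some (Fin.last N, b)) w.length (Fin.last (N + 1)) =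
      (![(N : ℝ) + 1 / 2, -(w.length : ℝ) - 1 / 2, if b then 1 else 0], ![(N : ℝ), -(w.length : ℝ) - 1, 0]) := by
    rw [lowerEdge, Prod.mk.injEq]
    constructor <;> rw [space_eq_iff] <;> refine ⟨?_, ?_, ?_⟩ <;>
      cases b <;> simp [padPerm, letterPerm, padLift, letterOver, hs, hne.symm] <;> ring
  have b1 : (levelPt (w.length + 1) (Fin.last (N + 1)), lowPt (w.length + 1) (Fin.last (N + 1))) =
      (![(N : ℝ) + 1, -(w.length : ℝ) - 1, 0], ![(N : ℝ) + 1, -(w.length : ℝ) - 2, -1]) := by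
    rw [levelPt, lowPt, Prod.mk.injEq]
    constructor <;> rw [space_eq_iff] <;> refine ⟨?_, ?_, ?_⟩ <;> simp <;> ring
  have b2 : (lowPt (w.length + 1) (Fin.last (N + 1)), highPt (Fin.last (N + 1))) =
      (![(N : ℝ) + 1, -(w.length : ℝ) - 2, -1], ![(N : ℝ) + 1, 1, -1]) := by
    rw [highPt, lowPt, Prod.mk.injEq]
    constructor <;> rw [space_eq_iff] <;> refine ⟨?_, ?_, ?_⟩ <;> simp
    ring
  have b3 : (highPt (Fin.last (N + 1)), levelPt 0 (Fin.last (N + 1))) =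
      (![(N : ℝ) + 1, 1, -1], vertPt N 0) := by
    rw [highPt, levelPt, Prod.mk.injEq, vertPt]
    constructor <;> rw [space_eq_iff] <;> refine ⟨?_, ?_, ?_⟩ <;> simp
  have hnone : ∀ j : Fin (N + 1), j ≠ Fin.last N →
      upperEdge (some (Fin.last N, b)) w.length j.castSucc = upperEdge none w.length j ∧
      lowerEdge (some (Fin.last N, b)) w.length j.castSucc = lowerEdge none w.length j := by
    intro j hj
    have h1 : j.castSucc ≠ (Fin.last N).castSucc := fun h => hj (Fin.castSucc_injective _ h)
    have h2 : j.castSucc ≠ (Fin.last N).succ := (Fin.castSucc_lt_last j).ne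
    have h3 : padPerm (some (Fin.last N, b)) j.castSucc = j.castSucc :=
      Equiv.swap_apply_of_ne_of_ne h1 h2
    have h4 : padLift (some (Fin.last N, b)) j.castSucc = 0 := by
      rw [padLift]
      exact if_neg (by cases b <;> assumption)
    rw [upperEdge, lowerEdge, h3, h4]
    exact ⟨rfl, rfl⟩
  rw [hlen]
  ext e
  simp only [Set.mem_union, Set.mem_insert_iff, bodyEdges, Set.mem_ofPred_eq, ← u1, ← u2, ← u3,
    ← u4, ← b1, ← b2, ← b3, pathEdges]
  constructor
  · rintro (⟨q, hq, j, h⟩ | ⟨j, h⟩)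
    · rcases (Nat.lt_succ_iff.1 hq).lt_or_eq with hq | rfl
      · rw [hfn q hq] at h
        induction j using Fin.lastCases with
        | last =>
          rw [upperEdge_liftLetter_last, lowerEdge_liftLetter_last] at h
          refine Or.inr (Or.inl ?_)
          rcases h with h | h
          · exact ⟨2 * q, by omega, h⟩
          · exact ⟨2 * q + 1, by omega, h⟩
        | cast j =>
          rw [upperEdge_liftLetter, lowerEdge_liftLetter] at h
          have : ∃ q < w.length, ∃ j, e = upperEdge (padFn w q) q j ∨ e = lowerEdge (padFn w q) q j :=
            ⟨q, hq, j, h⟩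
          exact Or.inr (Or.inr (Or.inr (Or.inr (Or.inr (Or.inr (Or.inr (Or.inr (Or.inl (Or.inl this)))))))))
      · rw [hfl] at h
        induction j using Fin.lastCases with
        | last => tauto
        | cast j =>
          by_cases hj : j = Fin.last N
          · subst hj; tauto
          · rw [(hnone j hj).1, (hnone j hj).2] at h
            have : ∃ j ≠ Fin.last N, e = upperEdge none w.length j ∨ e = lowerEdge none w.length j :=
              ⟨j, hj, h⟩
            exact Or.inr (Or.inr (Or.inr (Or.inr (Or.inr (Or.inr (Or.inr (Or.inr (Or.inl (Or.inr this)))))))))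
    · induction j using Fin.lastCases with
      | last => tauto
      | cast j =>
        have : e ∈ backEdges N (w.length + 1) := ⟨j, h⟩
        tauto
  · have hb : ∀ {e}, (e = (levelPt (w.length + 1) (Fin.last (N + 1)),
        lowPt (w.length + 1) (Fin.last (N + 1))) ∨
        e = (lowPt (w.length + 1) (Fin.last (N + 1)), highPt (Fin.last (N + 1))) ∨
        e = (highPt (Fin.last (N + 1)), levelPt 0 (Fin.last (N + 1)))) →
        e ∈ backEdges (N + 1) (w.length + 1) := fun h => ⟨Fin.last (N + 1), h⟩
    have hl : ∀ {e} (j : Fin (N + 2)), (e = upperEdge (some (Fin.last N, b)) w.length j ∨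
        e = lowerEdge (some (Fin.last N, b)) w.length j) → ∃ q < w.length + 1, ∃ j,
        e = upperEdge (padFn (w.map liftLetter ++ [some (Fin.last N, b)]) q) q j ∨
        e = lowerEdge (padFn (w.map liftLetter ++ [some (Fin.last N, b)]) q) q j := fun j h =>
      ⟨w.length, by omega, j, by rwa [hfl]⟩
    have hq : ∀ {e} (q : ℕ) (hq : q < w.length) (j : Fin (N + 2)),
        (e = upperEdge (liftLetter (padFn w q)) q j ∨
        e = lowerEdge (liftLetter (padFn w q)) q j) → ∃ q < w.length + 1, ∃ j,
        e = upperEdge (padFn (w.map liftLetter ++ [some (Fin.last N, b)]) q) q j ∨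
        e = lowerEdge (padFn (w.map liftLetter ++ [some (Fin.last N, b)]) q) q j := fun q hq j h =>
      ⟨q, by omega, j, by rwa [hfn q hq]⟩
    rintro (h | ⟨l, hl', h⟩ | h | h | h | h | h | h | (⟨q, hq', j, h⟩ | ⟨j, hj, h⟩) | ⟨j, h⟩)
    · exact Or.inl (hl _ (Or.inl h))
    · obtain ⟨q, rfl | rfl⟩ : ∃ q, l = 2 * q ∨ l = 2 * q + 1 := ⟨l / 2, by omega⟩
      · exact Or.inl (hq q (by omega) (Fin.last _) (Or.inl (by rw [upperEdge_liftLetter_last]; exact h)))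
      · exact Or.inl (hq q (by omega) (Fin.last _) (Or.inr (by rw [lowerEdge_liftLetter_last]; exact h)))
    · exact Or.inl (hl _ (Or.inl h))
    · exact Or.inl (hl _ (Or.inr h))
    · exact Or.inr (hb (Or.inl h))
    · exact Or.inr (hb (Or.inr (Or.inl h)))
    · exact Or.inr (hb (Or.inr (Or.inr h)))
    · exact Or.inl (hl _ (Or.inr h))
    · rw [← upperEdge_liftLetter, ← lowerEdge_liftLetter] at h
      exact Or.inl (hq q hq' _ h)
    · rw [← (hnone j hj).1, ← (hnone j hj).2] at h
      exact Or.inl (hl _ h)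
    · exact Or.inr ⟨j.castSucc, h⟩

/-- Stabilization does not change the closure. -/
theorem padLink_stabilize {N : ℕ} (w : List (Letter N)) (b : Bool) :
    padLink (w.map liftLetter ++ [some (Fin.last N, b)]) = padLink (w ++ [none]) := by
  obtain ⟨K, hK, hKL⟩ := exists_padLink_poly (w.map liftLetter ++ [some (Fin.last N, b)])
  obtain ⟨K', hK', hKL'⟩ := exists_padLink_poly (w ++ [none])
  rw [padLink_concat_last_edges] at hK
  rw [padLink_concat_none_edges] at hK'
  have e1 : upperEdge (none : Letter N) w.length (Fin.last N) =
      (![(N : ℝ), -(w.length : ℝ), 0], ![(N : ℝ), -(w.length : ℝ) - 1 / 2, 0]) := by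
    rw [upperEdge, Prod.mk.injEq]
    constructor <;> rw [space_eq_iff] <;> refine ⟨?_, ?_, ?_⟩ <;> simp [padPerm, padLift]
  have e2 : lowerEdge (none : Letter N) w.length (Fin.last N) =
      (![(N : ℝ), -(w.length : ℝ) - 1 / 2, 0], ![(N : ℝ), -(w.length : ℝ) - 1, 0]) := by
    rw [lowerEdge, Prod.mk.injEq]
    constructor <;> rw [space_eq_iff] <;> refine ⟨?_, ?_, ?_⟩ <;> simp [padPerm, padLift]
    ring
  rw [e1, e2] at hK'
  have hS : ∀ e ∈ bodyEdges w, e.1 ≠ ![(N : ℝ), -(w.length : ℝ), 0] := fun e he h =>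
    (body_fst w e he (by simp [h])).1 (by simp [h])
  -- The target polygon with its last strand straightened already exists; its disjointness condition
  -- later provides the hypothesis that the contracted loop meets nothing else.
  obtain ⟨L', hL', hLK'⟩ := exists_merge_insert K' hK' (mem_seg.2 ⟨1 / 2, by norm_num, by norm_num, by
      rw [space_eq_iff]
      refine ⟨?_, ?_, ?_⟩ <;>
        simp only [Pi.add_apply, Pi.smul_apply, smul_eq_mul, Matrix.cons_val] <;> ring⟩)
    fun e he => ⟨hS e he, fun h => (body_fst w e he (by simp [h])).2 (by simp [h])⟩
  obtain ⟨K1, hK1, h1⟩ := exists_remove_vertical (body_le w)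
    (by split_ifs <;> norm_num) (2 * w.length) (by push_cast; exact le_rfl) K hK
  obtain ⟨L, hL, h2⟩ := exists_remove_loop (body_le w) (Nat.cast_nonneg _)
    (by cases b <;> simp) (fun e he => by
      have := L'.disjoint _ (by rw [hL']; exact Set.mem_insert _ _) e
        (by rw [hL']; exact Set.mem_insert_of_mem _ he) (fun h => hS e he (by rw [← h]))
      exact this.trans Set.inter_subset_left) K1 hK1
  rw [← hKL, ← hKL', ← h1, ← h2, ← hLK']
  exact congrArg PolyLink.toLink (PolyLink.ext_edges (hL.trans hL'.symm))

/-! ### The skein relation -/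

section
variable {N m q : ℕ} {g : ℕ → Letter N} {i : Fin N} {b : Bool}

/-- The edges of the closure of a word outside a crossing, namely letter `q`, with the generator
number `i`. -/
def skeinBody (m : ℕ) (g : ℕ → Letter N) (q : ℕ) (i : Fin N) : Set (Space × Space) :=
  {e | ∃ p < m, p ≠ q ∧ ∃ j, e = upperEdge (g p) p j ∨ e = lowerEdge (g p) p j} ∪
  {e | ∃ j, j ≠ i.castSucc ∧ j ≠ i.succ ∧ (e = upperEdge none q j ∨ e = lowerEdge none q j)} ∪
  backEdges N m

/-- Lifts where the strand that starts on the right of the crossing has the lift `ε` there. -/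
noncomputable def skeinZ (m : ℕ) (g : ℕ → Letter N) (q : ℕ) (i : Fin N) (ε : ℝ) (l : ℕ)
    (j : Fin (N + 1)) : ℝ :=
  if l = 2 * q + 1 then if (j : ℕ) = i + 1 then ε else 0 else wordZ m g l j

/-- In a braid closure the overcrossing strand is lifted by `1`, whereas a skein triple wants one
strand straight and the other passing above or below it. Giving the right strand the lift `1 / 2` or
`-1 / 2` halves the difference of the lifts and so preserves its sign. -/
theorem skein_lift (hb : g q = some (i, b)) {j k : Fin (N + 1)} (hjk : j ≠ k)
    (hx : ((j : ℝ) + padPerm (g q) j) / 2 = ((k : ℝ) + padPerm (g q) k) / 2) :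
    skeinZ m g q i (if b then 1 / 2 else -1 / 2) (2 * q + 1) j -
      skeinZ m g q i (if b then 1 / 2 else -1 / 2) (2 * q + 1) k =
      (padLift (g q) j - padLift (g q) k) / 2 := by
  rcases letter_pair (g q) hjk with ⟨h1, h2⟩ | ⟨h1, h2⟩ | ⟨h1, h2, -⟩
  · have := fin_cast_lt h1; have := fin_cast_lt h2; linarith
  · have := fin_cast_lt h1; have := fin_cast_lt h2; linarith
  · rw [hb] at h1 h2
    have h3 := letterPerm_cases (i, b) j
    simp only [padPerm] at h1 h2
    rw [h1] at h3
    have h4 : ¬(k = j) := fun h => hjk h.symm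
    simp only [skeinZ, if_true, hb, padLift, letterOver, Fin.ext_iff]
    rcases h3 with ⟨h5, h6⟩ | ⟨h5, h6⟩ | ⟨-, -, h5⟩
    · cases b <;> simp [h5, h6] <;> norm_num
    · cases b <;> simp [h5, h6]
    · exact absurd h5 h4

/-- The change of lifts moves the differences at the crossing only within their cones, hence is an
isotopy. -/
theorem exists_skein_poly (hq : q < m) (hb : g q = some (i, b)) : ∃ K : PolyLink,
    K.edges = pageEdges (2 * m) (wordPerm m g) wordH (wordX m g)
      (skeinZ m g q i (if b then 1 / 2 else -1 / 2)) ∧ K.toLink = wordLink m g := by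
  obtain ⟨ε, hε⟩ : ∃ ε : ℝ, ε = if b then 1 / 2 else -1 / 2 := ⟨_, rfl⟩
  have hout : ∀ l, l ≠ 2 * q + 1 → skeinZ m g q i ε l = wordZ m g l := fun l hl => by
    ext j; exact if_neg hl
  have hcone : ∀ {σ κ : ℝ} {j k : Fin (N + 1)}, j ≠ k →
      InCone σ κ (((j : ℝ) + padPerm (g q) j) / 2 - ((k : ℝ) + padPerm (g q) k) / 2)
        (padLift (g q) j - padLift (g q) k) →
      InCone σ κ (((j : ℝ) + padPerm (g q) j) / 2 - ((k : ℝ) + padPerm (g q) k) / 2)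
        (skeinZ m g q i ε (2 * q + 1) j - skeinZ m g q i ε (2 * q + 1) k) := by
    intro σ κ j k hjk h
    rcases h with h | ⟨h, h'⟩
    · exact Or.inl h
    · refine Or.inr ⟨h, ?_⟩
      rw [hε, skein_lift hb hjk (sub_eq_zero.1 h)]
      linarith
  have hs : ∃ H : Braided (2 * m) (wordPerm m g) wordH (wordX m g) (skeinZ m g q i ε),
      (braided_word m g).poly.toLink = H.poly.toLink := by
    refine (braided_word m g).exists_slide (braided_word m g).decr ?_ ?_ ?_
    · intro l _ j
      by_cases hl : l = 2 * q + 1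
      · subst hl
        simp only [skeinZ, if_true, hε]
        cases b <;> split_ifs <;> norm_num at *
      · rw [hout l hl]; linarith [wordZ_nonneg m g l j]
    · intro l hl
      exact ⟨rfl, hout l (by omega)⟩
    · intro l hl
      by_cases h : l = 2 * q ∨ l = 2 * q + 1
      swap
      · exact Or.inl ⟨rfl, hout _ (by omega), rfl, hout _ (by omega)⟩
      right
      intro j k hjk
      obtain ⟨⟨σ, a1, a2⟩, ⟨τ, b1, b2⟩⟩ := letter_cone (g q) hjk (letter_pair_sign (g q) hjk)
      rcases h with rfl | rfl
      · refine ⟨σ, padLift (g q) j - padLift (g q) k, ?_⟩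
        rw [hout _ (by omega)]
        simp only [wordPerm_even m g (Nat.mul_mod_right 2 q),
          wordX_even m g (Nat.mul_mod_right 2 q), wordZ_even m g (Nat.mul_mod_right 2 q),
          wordX_odd m g hq, wordZ_odd m g hq, Equiv.Perm.coe_one, id]
        exact ⟨Or.inl a1, Or.inl a1, a2, hcone hjk a2⟩
      · refine ⟨τ, padLift (g q) j - padLift (g q) k, ?_⟩
        rw [hout (2 * q + 1 + 1) (by omega)]
        simp only [wordPerm_odd m g hq, show 2 * q + 1 + 1 = 2 * (q + 1) by ring,
          wordX_even m g (Nat.mul_mod_right 2 (q + 1)), wordZ_even m g (Nat.mul_mod_right 2 (q + 1)),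
          wordX_odd m g hq, wordZ_odd m g hq]
        exact ⟨b2, hcone hjk b2, Or.inl b1, Or.inl b1⟩
  obtain ⟨H, hH⟩ := hs
  rw [← hε]
  exact ⟨H.poly, H.poly_edges, hH.symm⟩

theorem skein_edges (hq : q < m) (hb : g q = some (i, b)) (ε : ℝ) :
    pageEdges (2 * m) (wordPerm m g) wordH (wordX m g) (skeinZ m g q i ε) =
      insert (![(i : ℝ), -(q : ℝ), 0], ![(i : ℝ) + 1 / 2, -(q : ℝ) - 1 / 2, 0])
      (insert (![(i : ℝ) + 1 / 2, -(q : ℝ) - 1 / 2, 0], ![(i : ℝ) + 1, -(q : ℝ) - 1, 0])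
      (insert (![(i : ℝ) + 1, -(q : ℝ), 0], ![(i : ℝ) + 1 / 2, -(q : ℝ) - 1 / 2, ε])
      (insert (![(i : ℝ) + 1 / 2, -(q : ℝ) - 1 / 2, ε], ![(i : ℝ), -(q : ℝ) - 1, 0])
        (skeinBody m g q i)))) := by
  rw [pageEdges_lift m g (by
    intro l hl j
    rw [skeinZ, if_neg (by omega)]
    rcases hl with h | h
    · exact wordZ_even m g h j
    · exact wordZ_ge m g h j)]
  have hp : ∀ p, p < m → p ≠ q → ∀ j : Fin (N + 1), skeinZ m g q i ε (2 * p + 1) j =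
      padLift (g p) j := by
    intro p hp hpq j
    rw [skeinZ, if_neg (by omega), wordZ_odd m g hp]
  have hpq : ∀ j : Fin (N + 1), skeinZ m g q i ε (2 * q + 1) j =
      if (j : ℕ) = i + 1 then ε else 0 := fun j => if_pos rfl
  have c1 : padPerm (g q) i.castSucc = i.succ := by simp [hb, padPerm, letterPerm]
  have c2 : padPerm (g q) i.succ = i.castSucc := by simp [hb, padPerm, letterPerm]
  have c3 : ∀ j, j ≠ i.castSucc → j ≠ i.succ → padPerm (g q) j = j := fun j h h' => by
    rw [hb]; exact Equiv.swap_apply_of_ne_of_ne h h'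
  have u1 : (![((i.castSucc : Fin (N + 1)) : ℝ), -(q : ℝ), 0],
      ![(((i.castSucc : Fin (N + 1)) : ℝ) + padPerm (g q) i.castSucc) / 2, -(q : ℝ) - 1 / 2,
        skeinZ m g q i ε (2 * q + 1) i.castSucc]) =
      (![(i : ℝ), -(q : ℝ), 0], ![(i : ℝ) + 1 / 2, -(q : ℝ) - 1 / 2, 0]) := by
    rw [Prod.mk.injEq]
    constructor <;> rw [space_eq_iff] <;> refine ⟨?_, ?_, ?_⟩ <;>
      simp [c1, hpq]
    ring
  have u2 : (![(((i.castSucc : Fin (N + 1)) : ℝ) + padPerm (g q) i.castSucc) / 2,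
      -(q : ℝ) - 1 / 2, skeinZ m g q i ε (2 * q + 1) i.castSucc],
      ![(padPerm (g q) i.castSucc : ℝ), -((q + 1 : ℕ) : ℝ), 0]) =
      (![(i : ℝ) + 1 / 2, -(q : ℝ) - 1 / 2, 0], ![(i : ℝ) + 1, -(q : ℝ) - 1, 0]) := by
    rw [Prod.mk.injEq]
    constructor <;> rw [space_eq_iff] <;> refine ⟨?_, ?_, ?_⟩ <;>
      simp [c1, hpq] <;> ring
  have u3 : (![((i.succ : Fin (N + 1)) : ℝ), -(q : ℝ), 0],
      ![(((i.succ : Fin (N + 1)) : ℝ) + padPerm (g q) i.succ) / 2, -(q : ℝ) - 1 / 2,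
        skeinZ m g q i ε (2 * q + 1) i.succ]) =
      (![(i : ℝ) + 1, -(q : ℝ), 0], ![(i : ℝ) + 1 / 2, -(q : ℝ) - 1 / 2, ε]) := by
    rw [Prod.mk.injEq]
    constructor <;> rw [space_eq_iff] <;> refine ⟨?_, ?_, ?_⟩ <;>
      simp [c2, hpq]
    ring
  have u4 : (![(((i.succ : Fin (N + 1)) : ℝ) + padPerm (g q) i.succ) / 2,
      -(q : ℝ) - 1 / 2, skeinZ m g q i ε (2 * q + 1) i.succ],
      ![(padPerm (g q) i.succ : ℝ), -((q + 1 : ℕ) : ℝ), 0]) =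
      (![(i : ℝ) + 1 / 2, -(q : ℝ) - 1 / 2, ε], ![(i : ℝ), -(q : ℝ) - 1, 0]) := by
    rw [Prod.mk.injEq]
    constructor <;> rw [space_eq_iff] <;> refine ⟨?_, ?_, ?_⟩ <;>
      simp [c2, hpq] <;> ring
  have u5 : ∀ j, j ≠ i.castSucc → j ≠ i.succ → skeinZ m g q i ε (2 * q + 1) j = 0 := by
    intro j _ h
    rw [hpq]
    exact if_neg fun h' => h (Fin.ext h')
  ext e
  simp only [Set.mem_union, Set.mem_insert_iff, Set.mem_ofPred_eq, skeinBody, ← u1, ← u2, ← u3,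
    ← u4]
  constructor
  · rintro (⟨p, hpm, j, h⟩ | h)
    · by_cases hpq' : p = q
      · subst hpq'
        by_cases h1 : j = i.castSucc
        · subst h1; tauto
        by_cases h2 : j = i.succ
        · subst h2; tauto
        rw [u5 j h1 h2, c3 j h1 h2] at h
        exact Or.inr (Or.inr (Or.inr (Or.inr (Or.inl (Or.inr ⟨j, h1, h2, h⟩)))))
      · rw [hp p hpm hpq'] at h
        exact Or.inr (Or.inr (Or.inr (Or.inr (Or.inl (Or.inl ⟨p, hpm, hpq', j, h⟩)))))
    · exact Or.inr (Or.inr (Or.inr (Or.inr (Or.inr h))))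
  · rintro (h | h | h | h | (⟨p, hpm, hpq', j, h⟩ | ⟨j, h1, h2, h⟩) | h)
    · exact Or.inl ⟨q, hq, _, Or.inl h⟩
    · exact Or.inl ⟨q, hq, _, Or.inr h⟩
    · exact Or.inl ⟨q, hq, _, Or.inl h⟩
    · exact Or.inl ⟨q, hq, _, Or.inr h⟩
    · refine Or.inl ⟨p, hpm, j, ?_⟩
      rw [hp p hpm hpq']
      exact h
    · refine Or.inl ⟨q, hq, j, ?_⟩
      rw [u5 j h1 h2, c3 j h1 h2]
      exact h
    · exact Or.inr h

theorem skein_smooth_edges (hq : q < m) (hb : g q = none) (i : Fin N) :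
    pageEdges (2 * m) (wordPerm m g) wordH (wordX m g) (wordZ m g) =
      insert (![(i : ℝ), -(q : ℝ), 0], ![(i : ℝ), -(q : ℝ) - 1 / 2, 0])
      (insert (![(i : ℝ), -(q : ℝ) - 1 / 2, 0], ![(i : ℝ), -(q : ℝ) - 1, 0])
      (insert (![(i : ℝ) + 1, -(q : ℝ), 0], ![(i : ℝ) + 1, -(q : ℝ) - 1 / 2, 0])
      (insert (![(i : ℝ) + 1, -(q : ℝ) - 1 / 2, 0], ![(i : ℝ) + 1, -(q : ℝ) - 1, 0])
        (skeinBody m g q i)))) := by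
  have u1 : upperEdge (g q) q i.castSucc =
      (![(i : ℝ), -(q : ℝ), 0], ![(i : ℝ), -(q : ℝ) - 1 / 2, 0]) := by
    rw [hb, upperEdge, Prod.mk.injEq]
    constructor <;> rw [space_eq_iff] <;> refine ⟨?_, ?_, ?_⟩ <;> simp [padPerm, padLift]
  have u2 : lowerEdge (g q) q i.castSucc =
      (![(i : ℝ), -(q : ℝ) - 1 / 2, 0], ![(i : ℝ), -(q : ℝ) - 1, 0]) := by
    rw [hb, lowerEdge, Prod.mk.injEq]
    constructor <;> rw [space_eq_iff] <;> refine ⟨?_, ?_, ?_⟩ <;> simp [padPerm, padLift]; ring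
  have u3 : upperEdge (g q) q i.succ =
      (![(i : ℝ) + 1, -(q : ℝ), 0], ![(i : ℝ) + 1, -(q : ℝ) - 1 / 2, 0]) := by
    rw [hb, upperEdge, Prod.mk.injEq]
    constructor <;> rw [space_eq_iff] <;> refine ⟨?_, ?_, ?_⟩ <;> simp [padPerm, padLift]
  have u4 : lowerEdge (g q) q i.succ =
      (![(i : ℝ) + 1, -(q : ℝ) - 1 / 2, 0], ![(i : ℝ) + 1, -(q : ℝ) - 1, 0]) := by
    rw [hb, lowerEdge, Prod.mk.injEq]
    constructor <;> rw [space_eq_iff] <;> refine ⟨?_, ?_, ?_⟩ <;> simp [padPerm, padLift]; ring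
  rw [pageEdges_word]
  change {e | ∃ q < m, ∃ j, e = upperEdge (g q) q j ∨ e = lowerEdge (g q) q j} ∪ backEdges N m = _
  ext e
  simp only [Set.mem_union, Set.mem_insert_iff, Set.mem_ofPred_eq, skeinBody, ← u1, ← u2, ← u3,
    ← u4]
  constructor
  · rintro (⟨p, hpm, j, h⟩ | h)
    · by_cases hpq' : p = q
      · subst hpq'
        by_cases h1 : j = i.castSucc
        · subst h1; tauto
        by_cases h2 : j = i.succ
        · subst h2; tauto
        rw [hb] at h
        exact Or.inr (Or.inr (Or.inr (Or.inr (Or.inl (Or.inr ⟨j, h1, h2, h⟩)))))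
      · exact Or.inr (Or.inr (Or.inr (Or.inr (Or.inl (Or.inl ⟨p, hpm, hpq', j, h⟩)))))
    · exact Or.inr (Or.inr (Or.inr (Or.inr (Or.inr h))))
  · rintro (h | h | h | h | (⟨p, hpm, hpq', j, h⟩ | ⟨j, h1, h2, h⟩) | h)
    · exact Or.inl ⟨q, hq, _, Or.inl h⟩
    · exact Or.inl ⟨q, hq, _, Or.inr h⟩
    · exact Or.inl ⟨q, hq, _, Or.inl h⟩
    · exact Or.inl ⟨q, hq, _, Or.inr h⟩
    · exact Or.inl ⟨p, hpm, j, h⟩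
    · refine Or.inl ⟨q, hq, j, ?_⟩
      rw [hb]
      exact h
    · exact Or.inr h

theorem fin_far {i : Fin N} {j : Fin (N + 1)} (h : j ≠ i.castSucc) (h' : j ≠ i.succ) :
    (j : ℝ) ≤ (i : ℝ) - 1 ∨ (i : ℝ) + 2 ≤ j := by
  simp only [ne_eq, Fin.ext_iff, Fin.val_castSucc, Fin.val_succ] at h h'
  rcases lt_or_ge (j : ℕ) i with h1 | h1
  · left
    have : ((j : ℕ) : ℝ) + 1 ≤ (i : ℕ) := by exact_mod_cast h1
    linarith
  · right
    have : (i : ℕ) + 2 ≤ j := by omega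
    exact_mod_cast this

/-- The edges outside a crossing do not start near it. -/
theorem skeinBody_fst (hq : q < m) : ∀ e ∈ skeinBody m g q i, e.1 1 ≤ -(q : ℝ) →
    -(q : ℝ) - 1 < e.1 1 → e.1 0 ≤ (i : ℝ) - 1 ∨ (i : ℝ) + 2 ≤ e.1 0 := by
  have hm : (q : ℝ) + 1 ≤ m := by exact_mod_cast hq
  rintro e ((⟨p, hp, hpq, j, rfl | rfl⟩ | ⟨j, h1, h2, rfl | rfl⟩) | ⟨j, rfl | rfl | rfl⟩)
  · simp only [upperEdge, Matrix.cons_val]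
    intro h3 h4
    rcases nat_eq_or (a := p) (b := q) with h | h | h
    · exact absurd h hpq
    · linarith
    · linarith
  · simp only [lowerEdge, Matrix.cons_val]
    intro h3 h4
    rcases nat_eq_or (a := p) (b := q) with h | h | h
    · exact absurd h hpq
    · linarith
    · linarith
  · exact fun _ _ => fin_far h1 h2
  · intro _ _
    simpa [lowerEdge, padPerm] using fin_far h1 h2
  · simp only [levelPt, Matrix.cons_val]
    intro h3 h4
    linarith
  · simp only [lowPt, Matrix.cons_val]
    intro h3 h4
    linarith
  · simp only [highPt, Matrix.cons_val]
    intro h3 h4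
    linarith [Nat.cast_nonneg (α := ℝ) q]

/-- The edges outside a crossing meet a neighbourhood of it only in the corners. -/
theorem skeinBody_near (hq : q < m) {e : Space × Space} (he : e ∈ skeinBody m g q i) {x : Space}
    (hx : x ∈ segment ℝ e.1 e.2) (h0 : (i : ℝ) ≤ x 0) (h0' : x 0 ≤ i + 1)
    (h1 : -(q : ℝ) - 1 ≤ x 1) (h1' : x 1 ≤ -(q : ℝ)) (h2 : -1 < x 2) :
    ∃ j : Fin (N + 1), x = ![(j : ℝ), -(q : ℝ), 0] ∨ x = ![(j : ℝ), -(q : ℝ) - 1, 0] := by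
  have hm : (q : ℝ) + 1 ≤ m := by exact_mod_cast hq
  obtain ⟨u, hu, hu1, rfl⟩ := mem_seg.1 hx
  simp only [Pi.add_apply, Pi.smul_apply, smul_eq_mul] at h0 h0' h1 h1' h2
  rcases he with ((⟨p, hp, hpq, j, rfl | rfl⟩ | ⟨j, h3, h4, rfl | rfl⟩) | ⟨j, rfl | rfl | rfl⟩)
  · simp only [upperEdge, Matrix.cons_val] at h1 h1' ⊢
    rcases nat_eq_or (a := p) (b := q) with h | h | h
    · exact absurd h hpq
    · linarith
    · obtain rfl : u = 0 := by linarith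
      refine ⟨j, Or.inr ?_⟩
      rw [space_eq_iff]
      refine ⟨?_, ?_, ?_⟩ <;> simp
      linarith
  · simp only [lowerEdge, Matrix.cons_val] at h1 h1' ⊢
    push_cast at h1 h1'
    rcases nat_eq_or (a := p) (b := q) with h | h | h
    · exact absurd h hpq
    · obtain rfl : u = 1 := by linarith
      refine ⟨padPerm (g p) j, Or.inl ?_⟩
      rw [space_eq_iff]
      refine ⟨?_, ?_, ?_⟩ <;> simp
      linarith
    · linarith
  · simp only [upperEdge, Matrix.cons_val, padPerm, Equiv.Perm.coe_one, id] at h0 h0'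
    rcases fin_far h3 h4 with h | h <;> linarith
  · simp only [lowerEdge, Matrix.cons_val, padPerm, Equiv.Perm.coe_one, id] at h0 h0'
    rcases fin_far h3 h4 with h | h <;> linarith
  · simp only [levelPt, lowPt, Matrix.cons_val] at h1 h1' ⊢
    obtain rfl : u = 0 := by linarith
    refine ⟨j, Or.inr ?_⟩
    rw [space_eq_iff]
    refine ⟨?_, ?_, ?_⟩ <;> simp
    linarith
  · simp only [highPt, lowPt, Matrix.cons_val] at h2
    linarith
  · simp only [highPt, levelPt, Matrix.cons_val] at h1 h1' ⊢
    have := Nat.cast_nonneg (α := ℝ) q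
    push_cast at h1'
    obtain rfl : u = 1 := by linarith
    have hq0 : (q : ℝ) = 0 := by linarith
    refine ⟨j, Or.inl ?_⟩
    rw [space_eq_iff]
    refine ⟨?_, ?_, ?_⟩ <;> simp [hq0]

end

theorem le_of_mem_convexHull {S : Set Space} (α β γ v : ℝ)
    (h : ∀ p ∈ S, α * p 0 + β * p 1 + γ * p 2 ≤ v) {x : Space} (hx : x ∈ convexHull ℝ S) :
    α * x 0 + β * x 1 + γ * x 2 ≤ v := by
  refine convexHull_min (show S ⊆ {p : Space | α * p 0 + β * p 1 + γ * p 2 ≤ v} from h) ?_ hx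
  intro p hp r hr s t hs ht hst
  simp only [Set.mem_ofPred_eq, Pi.add_apply, Pi.smul_apply, smul_eq_mul] at hp hr ⊢
  have h1 := mul_le_mul_of_nonneg_left hp hs
  have h2 := mul_le_mul_of_nonneg_left hr ht
  have h3 : s * v + t * v = v := by rw [← add_mul, hst, one_mul]
  linarith

section
variable {N m q : ℕ} {g gp gn g0 : ℕ → Letter N} {i : Fin N}

/-- The octahedron lies in a box of height one between positions `i` and `i + 1` and above level `-1
/ 2`. The other edges enter this box only at its corners. -/
theorem skeinBody_inter (hq : q < m) :
    convexHull ℝ {![(i : ℝ) + 1, -(q : ℝ), 0], ![(i : ℝ), -(q : ℝ) - 1, 0],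
      ![(i : ℝ), -(q : ℝ), 0], ![(i : ℝ) + 1, -(q : ℝ) - 1, 0],
      ![(i : ℝ) + 1 / 2, -(q : ℝ) - 1 / 2, 0] + ![0, 0, 1 / 2],
      ![(i : ℝ) + 1 / 2, -(q : ℝ) - 1 / 2, 0] - ![0, 0, 1 / 2]} ∩ support (skeinBody m g q i) ⊆
      {![(i : ℝ) + 1, -(q : ℝ), 0], ![(i : ℝ), -(q : ℝ) - 1, 0], ![(i : ℝ), -(q : ℝ), 0],
        ![(i : ℝ) + 1, -(q : ℝ) - 1, 0]} := by
  rintro x ⟨hx, hx'⟩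
  simp only [support, Set.mem_iUnion] at hx'
  obtain ⟨e, he, hx'⟩ := hx'
  have k1 := le_of_mem_convexHull (-1) 0 0 (-(i : ℝ)) (by
    rintro p (rfl | rfl | rfl | rfl | rfl | rfl) <;> simp) hx
  have k2 := le_of_mem_convexHull 1 0 0 ((i : ℝ) + 1) (by
    rintro p (rfl | rfl | rfl | rfl | rfl | rfl) <;> simp <;> linarith) hx
  have k3 := le_of_mem_convexHull 0 (-1) 0 ((q : ℝ) + 1) (by
    rintro p (rfl | rfl | rfl | rfl | rfl | rfl) <;> simp <;> linarith) hx
  have k4 := le_of_mem_convexHull 0 1 0 (-(q : ℝ)) (by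
    rintro p (rfl | rfl | rfl | rfl | rfl | rfl) <;> simp) hx
  have k5 := le_of_mem_convexHull 0 0 (-1) (1 / 2) (by
    rintro p (rfl | rfl | rfl | rfl | rfl | rfl) <;> simp) hx
  obtain ⟨j, hj⟩ := skeinBody_near hq he hx' (by linarith) (by linarith) (by linarith)
    (by linarith) (by linarith)
  have hx0 : x 0 = j := by rcases hj with rfl | rfl <;> rfl
  have hj' : (j : ℝ) = i ∨ (j : ℝ) = (i : ℝ) + 1 := by
    by_cases h1 : j = i.castSucc
    · left; rw [h1]; simp
    by_cases h2 : j = i.succ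
    · right; rw [h2]; simp
    rcases fin_far h1 h2 with h | h <;> linarith
  rcases hj with rfl | rfl <;> rcases hj' with h | h <;> rw [h] <;> simp

/-- Once the superfluous midpoints of straight strands are merged, the three polygons have literally
the form of a skein triple: outside the crossing they share `skeinBody`. -/
theorem skein_wordLink {nabla : Link → ℤ[X]} (hn : IsConwayPolynomial nabla) (hq : q < m)
    (hp : gp q = some (i, true)) (hn' : gn q = some (i, false)) (h0 : g0 q = none)
    (hout : ∀ p, p ≠ q → gp p = g0 p ∧ gn p = g0 p) :
    nabla (wordLink m gp) - nabla (wordLink m gn) = X * nabla (wordLink m g0) := by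
  have hbp : skeinBody m gp q i = skeinBody m g0 q i := by
    unfold skeinBody
    congr 2
    ext e
    refine exists_congr fun p => and_congr_right fun hp => and_congr_right fun hpq => ?_
    rw [(hout p hpq).1]
  have hbn : skeinBody m gn q i = skeinBody m g0 q i := by
    unfold skeinBody
    congr 2
    ext e
    refine exists_congr fun p => and_congr_right fun hp => and_congr_right fun hpq => ?_
    rw [(hout p hpq).2]
  obtain ⟨Kp, hKp, hLp⟩ := exists_skein_poly hq hp
  obtain ⟨Kn, hKn, hLn⟩ := exists_skein_poly hq hn'
  rw [skein_edges hq hp, hbp] at hKp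
  rw [skein_edges hq hn', hbn] at hKn
  obtain ⟨K0, hK0, hL0⟩ : ∃ K : PolyLink, K.edges = _ ∧ K.toLink = wordLink m g0 :=
    ⟨(braided_word m g0).poly, Braided.poly_edges _, rfl⟩
  rw [skein_smooth_edges hq h0 i] at hK0
  have hbody : ∀ e ∈ skeinBody m g0 q i, ∀ x y z : ℝ, (i : ℝ) ≤ x → x ≤ i + 1 → y ≤ -(q : ℝ) →
      -(q : ℝ) - 1 < y → e.1 ≠ ![x, y, z] := by
    intro e he x y z h1 h2 h3 h4 h5
    rcases skeinBody_fst hq e he (by rw [h5]; exact h3) (by rw [h5]; exact h4) with h | h <;>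
      rw [h5] at h <;> simp only [Matrix.cons_val] at h <;> linarith
  have hmid : ∀ x x' y : ℝ, (![(x + x') / 2, y - 1 / 2, 0] : Space) ∈
      segment ℝ ![x, y, 0] ![x', y - 1, 0] := by
    intro x x' y
    refine mem_seg.2 ⟨1 / 2, by norm_num, by norm_num, ?_⟩
    rw [space_eq_iff]
    refine ⟨?_, ?_, ?_⟩ <;>
      simp only [Pi.add_apply, Pi.smul_apply, smul_eq_mul, Matrix.cons_val] <;> ring
  have hm1 := hmid i (i + 1) (-(q : ℝ))
  rw [show ((i : ℝ) + (i + 1)) / 2 = i + 1 / 2 by ring] at hm1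
  have hm2 := hmid i i (-(q : ℝ))
  rw [show ((i : ℝ) + i) / 2 = i by ring] at hm2
  have hm3 := hmid (i + 1) (i + 1) (-(q : ℝ))
  rw [show ((i : ℝ) + 1 + (i + 1)) / 2 = i + 1 by ring] at hm3
  have vne : ∀ {x y z x' y' z' : ℝ}, x ≠ x' ∨ y ≠ y' ∨ z ≠ z' →
      (![x, y, z] : Space) ≠ ![x', y', z'] := by
    rintro x y z x' y' z' h h'
    rw [space_eq_iff] at h'
    simp at h'
    tauto
  obtain ⟨Lp, hLp', hLp''⟩ := exists_merge_insert Kp hKp hm1 (by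
    rintro e (rfl | rfl | he)
    · exact ⟨vne (Or.inl (by simp)), vne (Or.inl (by norm_num))⟩
    · exact ⟨vne (Or.inl (by simp)), vne (Or.inr (Or.inr (by norm_num)))⟩
    · constructor <;> apply hbody e he <;> linarith)
  obtain ⟨Ln, hLn', hLn''⟩ := exists_merge_insert Kn hKn hm1 (by
    rintro e (rfl | rfl | he)
    · exact ⟨vne (Or.inl (by simp)), vne (Or.inl (by norm_num))⟩
    · exact ⟨vne (Or.inl (by simp)), vne (Or.inr (Or.inr (by norm_num)))⟩
    · constructor <;> apply hbody e he <;> linarith)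
  obtain ⟨L1, hL1', hL1''⟩ := exists_merge_insert K0 hK0 hm2 (by
    rintro e (rfl | rfl | he)
    · exact ⟨vne (Or.inl (by simp)), vne (Or.inl (by simp))⟩
    · exact ⟨vne (Or.inl (by simp)), vne (Or.inl (by simp))⟩
    · constructor <;> apply hbody e he <;> linarith)
  obtain ⟨L0, hL0', hL0''⟩ := exists_merge_insert (a := ![(i : ℝ) + 1, -(q : ℝ), 0])
    (c := ![(i : ℝ) + 1, -(q : ℝ) - 1 / 2, 0]) (b := ![(i : ℝ) + 1, -(q : ℝ) - 1, 0]) L1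
    (E := insert (![(i : ℝ), -(q : ℝ), 0], ![(i : ℝ), -(q : ℝ) - 1, 0]) (skeinBody m g0 q i))
    (by rw [hL1']; ext e; simp only [Set.mem_insert_iff]; tauto) hm3 (by
    rintro e (rfl | he)
    · exact ⟨vne (Or.inl (by simp)), vne (Or.inl (by simp))⟩
    · constructor <;> apply hbody e he <;> linarith)
  rw [← hLp, ← hLn, ← hL0, ← hLp'', ← hLn'', ← hL1'', ← hL0'']
  -- The strand from `a` to `b` runs from upper right to lower left, and `h` points towards the
  -- viewer. In `σ_i` this strand is the upper one, and the determinant is `1`, so `gp` carries the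
  -- positive crossing.
  refine hn.skein Lp Ln L0 ⟨skeinBody m g0 q i, ![(i : ℝ) + 1, -(q : ℝ), 0],
    ![(i : ℝ), -(q : ℝ) - 1, 0], ![(i : ℝ), -(q : ℝ), 0], ![(i : ℝ) + 1, -(q : ℝ) - 1, 0],
    ![(i : ℝ) + 1 / 2, -(q : ℝ) - 1 / 2, 0], ![0, 0, 1 / 2], ?_, ?_, ?_, skeinBody_inter hq,
    ?_, ?_, ?_⟩
  · refine ⟨1 / 2, 1 / 2, by norm_num, by norm_num, by norm_num, ?_⟩
    rw [space_eq_iff]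
    refine ⟨?_, ?_, ?_⟩ <;>
      simp only [Pi.add_apply, Pi.smul_apply, smul_eq_mul, Matrix.cons_val] <;> ring
  · refine ⟨1 / 2, 1 / 2, by norm_num, by norm_num, by norm_num, ?_⟩
    rw [space_eq_iff]
    refine ⟨?_, ?_, ?_⟩ <;>
      simp only [Pi.add_apply, Pi.smul_apply, smul_eq_mul, Matrix.cons_val] <;> ring
  · rw [Matrix.det_fin_three]
    simp
    linarith
  · rw [hLp']
    have : (![(i : ℝ) + 1 / 2, -(q : ℝ) - 1 / 2, 0] + ![0, 0, 1 / 2] : Space) =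
        ![(i : ℝ) + 1 / 2, -(q : ℝ) - 1 / 2, 1 / 2] := by
      rw [space_eq_iff]; refine ⟨?_, ?_, ?_⟩ <;> simp
    rw [this]
    ext e
    simp only [Set.mem_insert_iff, Set.mem_union, Set.mem_singleton_iff, if_true]
    tauto
  · rw [hLn']
    have : (![(i : ℝ) + 1 / 2, -(q : ℝ) - 1 / 2, 0] - ![0, 0, 1 / 2] : Space) =
        ![(i : ℝ) + 1 / 2, -(q : ℝ) - 1 / 2, -1 / 2] := by
      rw [space_eq_iff]; refine ⟨?_, ?_, ?_⟩ <;> simp; norm_num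
    rw [this]
    ext e
    simp only [Set.mem_insert_iff, Set.mem_union, Set.mem_singleton_iff, Bool.false_eq_true,
      if_false]
    tauto
  · rw [hL0']
    ext e
    simp only [Set.mem_insert_iff, Set.mem_union, Set.mem_singleton_iff]
    tauto

end

/-- The skein relation for closures of words. -/
theorem padLink_skein {nabla : Link → ℤ[X]} (hn : IsConwayPolynomial nabla) {N : ℕ}
    (A B : List (Letter N)) (i : Fin N) :
    nabla (padLink (A ++ ([some (i, true)] ++ B))) -
      nabla (padLink (A ++ ([some (i, false)] ++ B))) =
        X * nabla (padLink (A ++ ([none] ++ B))) := by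
  have hlen : ∀ g : Letter N, (A ++ ([g] ++ B)).length = A.length + 1 + B.length := by
    intro g; simp; omega
  have hg : ∀ g : Letter N, padFn (A ++ ([g] ++ B)) A.length = g := by
    intro g; rw [padFn_append_right _ _ le_rfl]; simp [padFn]
  have hout : ∀ (g g' : Letter N) p, p ≠ A.length →
      padFn (A ++ ([g] ++ B)) p = padFn (A ++ ([g'] ++ B)) p := by
    intro g g' p hp
    rcases lt_or_gt_of_ne hp with h | h
    · rw [padFn_append_left _ _ h, padFn_append_left _ _ h]
    · rw [padFn_append_right _ _ h.le, padFn_append_right _ _ h.le,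
        padFn_append_right [g] B (by simp; omega), padFn_append_right [g'] B (by simp; omega)]
      rfl
  rw [padLink, padLink, padLink, hlen, hlen, hlen]
  exact skein_wordLink hn (q := A.length) (by omega) (hg _) (hg _) (hg _)
    fun p hp => ⟨hout _ _ p hp, hout _ _ p hp⟩

/-! ### Closures of braid words as a trace on a quotient of the braid group -/

section
variable {N : ℕ}

/-- The closure of a braid word, preceded by one level without crossings. -/
noncomputable def cl (w : BraidWord N) : Link := padLink (none :: w.map some)

theorem padLink_move_none (A B : List (Letter N)) :
    padLink (A ++ none :: B) = padLink (none :: (A ++ B)) := by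
  induction A using List.reverseRecOn generalizing B with
  | nil => rfl
  | append_singleton A g ih =>
    have h := padLink_swap_none A B g
    simp only [List.cons_append, List.nil_append] at h
    rw [List.append_assoc, List.append_assoc, List.singleton_append, List.singleton_append, ← h, ih]

theorem padLink_absorb_none (A B : List (Letter N)) :
    padLink (none :: (A ++ none :: B)) = padLink (none :: (A ++ B)) := by
  have h := padLink_move_none (none :: A) B
  rw [List.cons_append, List.cons_append] at h
  rw [h]
  exact padLink_remove_none [] (A ++ B) none

theorem padLink_none_cons (l : List (Letter N)) (A : BraidWord N) :
    padLink (none :: (A.map some ++ l)) = cl (A ++ l.reduceOption) := by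
  induction l generalizing A with
  | nil => simp [cl]
  | cons g l ih =>
    cases g with
    | none => rw [padLink_absorb_none, ih, List.reduceOption_cons_of_none]
    | some g =>
      have h := ih (A ++ [g])
      rw [List.reduceOption_cons_of_some]
      simpa using h

/-- Trivial letters can be moved to the front, and there all but one are absorbed. So as soon as one
of them is present, the closure depends only on the genuine letters. -/
theorem padLink_eq_cl {l : List (Letter N)} (h : none ∈ l) : padLink l = cl l.reduceOption := by
  obtain ⟨A, B, rfl⟩ := List.append_of_mem h
  rw [padLink_move_none]
  have h1 := padLink_none_cons (A ++ B) []
  simp only [List.map_nil, List.nil_append] at h1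
  rw [h1, List.reduceOption_append, List.reduceOption_append, List.reduceOption_cons_of_none]

theorem reduceOption_map_some (w : BraidWord N) :
    (w.map some : List (Letter N)).reduceOption = w := by
  simp [List.reduceOption]

/-- A trivial letter can be inserted only after an existing letter; this is why the empty word is
excluded. -/
theorem braidClosure_eq_cl {w : BraidWord N} (hw : w ≠ []) : braidClosure w = cl w := by
  obtain ⟨a, w, rfl⟩ := List.exists_cons_of_ne_nil hw
  have h : braidClosure (a :: w) = padLink ((a :: w).map some) := by
    rw [braidClosure_eq_wordLink, padLink, List.length_map]
    congr 1
    funext l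
    rw [padFn, List.getElem?_map]
    cases (a :: w)[l]? <;> rfl
  rw [h, List.map_cons]
  have h1 := padLink_remove_none [] (w.map some) (some a)
  simp only [List.nil_append, List.cons_append] at h1
  rw [← h1, padLink_eq_cl (by simp), List.reduceOption_cons_of_some,
    List.reduceOption_cons_of_none, reduceOption_map_some]

/-- Relations between padded words of equal length become relations between braid words after the
trivial letters are dropped. -/
theorem cl_replace {u v : List (Letter N)}
    (h : ∀ A B, padLink (A ++ (u ++ B)) = padLink (A ++ (v ++ B))) (A B : BraidWord N) :
    cl (A ++ (u.reduceOption ++ B)) = cl (A ++ (v.reduceOption ++ B)) := by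
  have h1 := h (none :: A.map some) (B.map some)
  rw [padLink_eq_cl (by simp), padLink_eq_cl (by simp)] at h1
  simpa [List.reduceOption_append, List.reduceOption_cons_of_none, reduceOption_map_some] using h1

theorem cl_cancel (A B : BraidWord N) (i : Fin N) (b : Bool) :
    cl (A ++ (i, b) :: (i, !b) :: B) = cl (A ++ B) :=
  cl_replace (u := [some (i, b), some (i, !b)]) (v := [none, none])
    (fun A B => padLink_cancel A B i b) A B

theorem cl_comm (A B : BraidWord N) {i j : Fin N} (hij : (i : ℕ) + 2 ≤ j) :
    cl (A ++ ([(i, true), (j, true)] ++ B)) = cl (A ++ ([(j, true), (i, true)] ++ B)) :=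
  cl_replace (u := [some (i, true), some (j, true)]) (v := [some (j, true), some (i, true)])
    (fun A B => padLink_comm A B i j hij) A B

theorem cl_braid (A B : BraidWord N) {i j : Fin N} (hij : (i : ℕ) + 1 = j) :
    cl (A ++ ([(i, true), (j, true), (i, true)] ++ B)) =
      cl (A ++ ([(j, true), (i, true), (j, true)] ++ B)) :=
  cl_replace (u := [some (i, true), some (j, true), some (i, true)])
    (v := [some (j, true), some (i, true), some (j, true)])
    (fun A B => padLink_braid A B i j hij) A B

theorem cl_conj (i : Fin N) (w : BraidWord N) : cl ((i, true) :: (w ++ [(i, false)])) = cl w := by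
  have h := padLink_conj i (none :: w.map some)
  rw [padLink_eq_cl (by simp), padLink_eq_cl (by simp)] at h
  simpa [List.reduceOption_append, List.reduceOption_cons_of_none,
    List.reduceOption_cons_of_some, reduceOption_map_some] using h

/-- A braid word as a braid word on one more strand. -/
def liftWord (w : BraidWord N) : BraidWord (N + 1) := w.map fun g => (g.1.castSucc, g.2)

theorem map_some_liftWord (w : BraidWord N) :
    ((liftWord w).map some : List (Letter (N + 1))) = (w.map some).map liftLetter := by
  rw [liftWord, List.map_map, List.map_map]
  rfl

theorem cl_stabilize (w : BraidWord N) (b : Bool) :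
    cl (liftWord w ++ [(Fin.last N, b)]) = cl w := by
  have h := padLink_stabilize (none :: w.map some) b
  rw [List.map_cons, ← map_some_liftWord] at h
  change padLink (none :: _ ++ _) = _ at h
  rw [padLink_eq_cl (by simp), padLink_eq_cl (by simp)] at h
  simpa [List.reduceOption_append, List.reduceOption_cons_of_none,
    List.reduceOption_cons_of_some, reduceOption_map_some] using h

theorem cl_skein {nabla : Link → ℤ[X]} (hn : IsConwayPolynomial nabla) (A B : BraidWord N)
    (i : Fin N) : nabla (cl (A ++ (i, true) :: B)) - nabla (cl (A ++ (i, false) :: B)) =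
      X * nabla (cl (A ++ B)) := by
  have h := padLink_skein hn (none :: A.map some) (B.map some) i
  rw [padLink_eq_cl (by simp), padLink_eq_cl (by simp), padLink_eq_cl (by simp)] at h
  simpa [List.reduceOption_append, List.reduceOption_cons_of_none,
    List.reduceOption_cons_of_some, reduceOption_map_some] using h

/-- The closure as a function on the free group. -/
noncomputable def clFree : FreeGroup (Fin N) → Link :=
  Quot.lift cl (by rintro _ _ ⟨⟩; exact cl_cancel _ _ _ _)

theorem clFree_mk (w : BraidWord N) : clFree (FreeGroup.mk w) = cl w := rfl

/-- Conjugation by a generator is `cl_conj`; the other cases follow because conjugations compose. -/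
theorem clFree_conj (g x : FreeGroup (Fin N)) : clFree (g * x * g⁻¹) = clFree x := by
  induction g using FreeGroup.induction_on generalizing x with
  | C1 => simp
  | of i =>
    obtain ⟨w, rfl⟩ := Quot.exists_rep x
    exact cl_conj i w
  | inv_of i ih => rw [← ih, inv_inv]; congr 1; group
  | mul g h ih ih' =>
    rw [show g * h * x * (g * h)⁻¹ = g * (h * x * h⁻¹) * g⁻¹ by group, ih, ih']

theorem clFree_mul_comm (x y : FreeGroup (Fin N)) : clFree (x * y) = clFree (y * x) := by
  rw [← clFree_conj y (x * y)]; congr 1; group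

variable (N) in
/-- The braids that can be removed from any braid without changing the closure. -/
def clKernel : Subgroup (FreeGroup (Fin N)) where
  carrier := {g | ∀ a, clFree (a * g) = clFree a}
  mul_mem' := fun {g h} hg hh a => by rw [← mul_assoc, hh, hg]
  one_mem' := fun a => by rw [mul_one]
  inv_mem' := fun {g} hg a => by rw [← hg (a * g⁻¹), inv_mul_cancel_right]

theorem mem_clKernel {g : FreeGroup (Fin N)} : g ∈ clKernel N ↔ ∀ a, clFree (a * g) = clFree a :=
  Iff.rfl

/-- Invariance of the closure under conjugation makes the kernel normal. The quotient is then a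
group with the braid relations and a trace, and no presentation of the braid group is needed. -/
instance : (clKernel N).Normal where
  conj_mem g hg h := by
    intro a
    rw [← clFree_conj h⁻¹ (a * _), ← clFree_conj h⁻¹ a, ← hg (h⁻¹ * a * h⁻¹⁻¹)]
    congr 1
    group

variable (N) in
/-- A quotient of the braid group through which the closure factors. -/
abbrev Braids : Type := FreeGroup (Fin N) ⧸ clKernel N

/-- The braid of a braid word. -/
def ev (w : BraidWord N) : Braids N := QuotientGroup.mk (FreeGroup.mk w)

/-- The closure of a braid. -/
noncomputable def tr : Braids N → Link :=
  Quotient.lift clFree (by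
    intro a b h
    rw [← (QuotientGroup.leftRel_apply.1 h) a, mul_inv_cancel_left])

theorem tr_ev (w : BraidWord N) : tr (ev w) = cl w := rfl

theorem tr_mul_comm (x y : Braids N) : tr (x * y) = tr (y * x) := by
  obtain ⟨x, rfl⟩ := QuotientGroup.mk_surjective x
  obtain ⟨y, rfl⟩ := QuotientGroup.mk_surjective y
  exact clFree_mul_comm x y

theorem ev_append (u v : BraidWord N) : ev (u ++ v) = ev u * ev v := rfl

theorem ev_cons (g : Fin N × Bool) (v : BraidWord N) : ev (g :: v) = ev [g] * ev v := rfl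

theorem ev_not (i : Fin N) (b : Bool) : ev [(i, !b)] = (ev [(i, b)])⁻¹ := rfl

/-- Every element of the free group has the form `A * u` with a word `A`, so interchangeability in
all contexts already says that `u⁻¹ * v` lies in the kernel. -/
theorem ev_eq {u v : BraidWord N} (h : ∀ A B, cl (A ++ (u ++ B)) = cl (A ++ (v ++ B))) :
    ev u = ev v := by
  refine QuotientGroup.eq.2 (mem_clKernel.2 fun a => ?_)
  obtain ⟨A, hA⟩ := Quot.exists_rep (a * (FreeGroup.mk u)⁻¹)
  change FreeGroup.mk A = _ at hA
  have h1 : a = FreeGroup.mk A * FreeGroup.mk u := by rw [hA, inv_mul_cancel_right]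
  have h2 := h A []
  rw [List.append_nil, List.append_nil, ← clFree_mk, ← clFree_mk, ← FreeGroup.mul_mk,
    ← FreeGroup.mul_mk] at h2
  rw [← mul_assoc, ← hA, ← h2, ← h1]

theorem ev_comm {i j : Fin N} (hij : (i : ℕ) + 2 ≤ j) :
    Commute (ev [(i, true)]) (ev [(j, true)]) :=
  ev_eq (u := [(i, true), (j, true)]) (v := [(j, true), (i, true)]) fun A B => cl_comm A B hij

theorem ev_braid {i j : Fin N} (hij : (i : ℕ) + 1 = j) :
    ev [(i, true)] * ev [(j, true)] * ev [(i, true)] =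
      ev [(j, true)] * ev [(i, true)] * ev [(j, true)] :=
  ev_eq (u := [(i, true), (j, true), (i, true)]) (v := [(j, true), (i, true), (j, true)])
    fun A B => cl_braid A B hij

theorem ev_comm_sign {i j : Fin N} (hij : (i : ℕ) + 2 ≤ j) (b c : Bool) :
    Commute (ev [(i, b)]) (ev [(j, c)]) := by
  have h := ev_comm hij
  have hf : ∀ i : Fin N, ev [(i, false)] = (ev [(i, true)])⁻¹ := fun i => ev_not i true
  cases b <;> cases c
  · rw [hf, hf]; exact h.inv_inv
  · rw [hf]; exact h.inv_left
  · rw [hf]; exact h.inv_right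
  · exact h

theorem ev_braid_sign {i j : Fin N} (hij : (i : ℕ) + 1 = j) (b : Bool) :
    ev [(i, b)] * ev [(j, b)] * ev [(i, b)] = ev [(j, b)] * ev [(i, b)] * ev [(j, b)] := by
  have h := ev_braid hij
  have hf : ∀ i : Fin N, ev [(i, false)] = (ev [(i, true)])⁻¹ := fun i => ev_not i true
  cases b
  · simp only [hf]
    rw [← mul_inv_rev, ← mul_inv_rev, ← mul_inv_rev, ← mul_inv_rev, ← mul_assoc, ← mul_assoc, h]
  · exact h

end

/-! ### The braid on one strand -/

/-- With one trivial letter the closure on one strand is a pentagon; removing the collinear vertex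
and one more leaves a triangle. -/
theorem exists_triangle_cl_nil : ∃ K : PolyLink, K.IsTriangle ∧ K.toLink = cl ([] : BraidWord 0) := by
  obtain ⟨K, hK, hKl⟩ := exists_padLink_poly (N := 0) [none]
  have hK' : K.edges = insert (![0, 0, 0], ![0, -1 / 2, 0]) (insert (![0, -1 / 2, 0], ![0, -1, 0])
      {(![0, -1, 0], ![0, -2, -1]), (![0, -2, -1], ![0, 1, -1]), (![0, 1, -1], ![0, 0, 0])}) := by
    rw [hK]
    have h1 : upperEdge (padFn [none] 0) 0 (0 : Fin (0 + 1)) = (![0, 0, 0], ![0, -1 / 2, 0]) := by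
      simp [upperEdge, padFn, padPerm, padLift]
      norm_num
    have h2 : lowerEdge (padFn [none] 0) 0 (0 : Fin (0 + 1)) = (![0, -1 / 2, 0], ![0, -1, 0]) := by
      simp [lowerEdge, padFn, padPerm, padLift]
      norm_num
    have h3 : (levelPt 1 (0 : Fin (0 + 1)) : Space) = ![0, -1, 0] := by simp [levelPt]
    have h4 : (lowPt 1 (0 : Fin (0 + 1)) : Space) = ![0, -2, -1] := by simp [lowPt]; norm_num
    have h5 : (highPt (0 : Fin (0 + 1)) : Space) = ![0, 1, -1] := by simp [highPt]
    have h6 : (levelPt 0 (0 : Fin (0 + 1)) : Space) = ![0, 0, 0] := by simp [levelPt]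
    ext e
    constructor
    · rintro (⟨q, hq, j, he⟩ | ⟨j, he⟩)
      · obtain rfl : q = 0 := by simpa using hq
        obtain rfl : j = 0 := Fin.fin_one_eq_zero j
        rw [h1, h2] at he
        rcases he with rfl | rfl <;> simp
      · obtain rfl : j = 0 := Fin.fin_one_eq_zero j
        simp only [List.length_singleton] at he
        rw [h3, h4, h5, h6] at he
        rcases he with rfl | rfl | rfl <;> simp
    · rintro (rfl | rfl | rfl | rfl | rfl)
      · exact Or.inl ⟨0, by simp, 0, Or.inl h1.symm⟩
      · exact Or.inl ⟨0, by simp, 0, Or.inr h2.symm⟩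
      · exact Or.inr ⟨0, Or.inl (by simp only [List.length_singleton]; rw [h3, h4])⟩
      · exact Or.inr ⟨0, Or.inr (Or.inl (by simp only [List.length_singleton]; rw [h4, h5]))⟩
      · exact Or.inr ⟨0, Or.inr (Or.inr (by rw [h5, h6]))⟩
  obtain ⟨L, hL, hLK⟩ := exists_merge_insert K hK' (mem_seg.2 ⟨1 / 2, by norm_num, by norm_num, by
      rw [space_eq_iff]; refine ⟨?_, ?_, ?_⟩ <;> simp; norm_num⟩) (by
    rintro e (rfl | rfl | rfl) <;> simp
    norm_num)
  obtain ⟨M, hM, hML⟩ := exists_remove_insert L hL (by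
    rintro e (rfl | rfl)
    · exact triangle_inter_right 0 0 1 (-1) (by simp) (by simp) (by simp) (by simp) (by simp)
    · exact triangle_inter_left 0 (-1) (-1) 0 (by simp) (by simp; norm_num) (by simp) (by simp)
        (by simp))
  exact ⟨M, ⟨_, _, _, hM⟩, hML.trans (hLK.trans hKl)⟩

theorem conway_cl_nil {nabla : Link → ℤ[X]} (hn : IsConwayPolynomial nabla) :
    nabla (cl ([] : BraidWord 0)) = 1 := by
  obtain ⟨K, hK, h⟩ := exists_triangle_cl_nil
  rw [← h, hn.unknot K hK]

/-! ### Words up to braid moves -/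

/-- Up to far commutations, braid relations and the removal of repeated letters, the largest letter
occurs at most once in a word. -/
theorem word_induction {N : ℕ} {Q : List (Fin N) → Prop}
    (comm : ∀ A B (i j : Fin N), (i : ℕ) + 2 ≤ j → (Q (A ++ i :: j :: B) ↔ Q (A ++ j :: i :: B)))
    (braid : ∀ A B (i j : Fin N), (i : ℕ) + 1 = j →
      Q (A ++ i :: j :: i :: B) → Q (A ++ j :: i :: j :: B))
    (dup : ∀ A B i, Q (A ++ i :: i :: B)) (n : ℕ) :
    ∀ A u B : List (Fin N), (∀ x ∈ u, (x : ℕ) < n) →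
      (∀ v : List (Fin N), (∀ x ∈ v, (x : ℕ) + 1 < n) → Q (A ++ (v ++ B))) →
      (∀ (v : List (Fin N)) (y : Fin N) (v' : List (Fin N)), (y : ℕ) + 1 = n →
        (∀ x ∈ v, (x : ℕ) + 1 < n) → (∀ x ∈ v', (x : ℕ) + 1 < n) →
        Q (A ++ (v ++ y :: (v' ++ B)))) → Q (A ++ (u ++ B)) := by
  -- Far commutation carries `y` past a block of letters that are all at least two below it.
  have move : ∀ (y : Fin N) (m : List (Fin N)), (∀ x ∈ m, (x : ℕ) + 2 ≤ y) → ∀ A B,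
      (Q (A ++ y :: (m ++ B)) ↔ Q (A ++ (m ++ y :: B))) := by
    intro y m
    induction m with
    | nil => exact fun _ A B => Iff.rfl
    | cons x m ih =>
      intro h A B
      have h1 := ih (fun z hz => h z (List.mem_cons_of_mem _ hz)) (A ++ [x]) B
      simp only [List.append_assoc, List.singleton_append] at h1
      rw [List.cons_append, List.cons_append, ← h1, comm A _ x y (h x List.mem_cons_self)]
  induction n with
  | zero =>
    intro A u B hu h0 _
    exact h0 u fun x hx => absurd (hu x hx) (Nat.not_lt_zero _)
  | succ n ih =>
    intro A u B hu h0 h1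
    obtain ⟨c, hc⟩ : ∃ c, u.countP (fun x : Fin N => decide ((x : ℕ) = n)) = c := ⟨_, rfl⟩
    -- The inner induction is on the number of occurrences of the largest letter.
    induction c using Nat.strong_induction_on generalizing u with
    | _ c ihc =>
    by_cases hy : ∃ y ∈ u, (y : ℕ) = n
    swap
    · refine h0 u fun x hx => ?_
      have := hu x hx
      have : ¬(x : ℕ) = n := fun h => hy ⟨x, hx, h⟩
      omega
    obtain ⟨y, hyu, hyn⟩ := hy
    obtain ⟨C, D, rfl, hC⟩ := List.eq_append_cons_of_mem hyu
    have hCn : ∀ x ∈ C, (x : ℕ) + 1 < n + 1 := fun x hx => by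
      have := hu x (by simp [hx])
      have : (x : ℕ) ≠ n := fun h => hC (by rwa [← Fin.ext (h.trans hyn.symm)])
      omega
    by_cases hyD : y ∈ D
    swap
    · have hDn : ∀ x ∈ D, (x : ℕ) + 1 < n + 1 := fun x hx => by
        have := hu x (by simp [hx])
        have : (x : ℕ) ≠ n := fun h => hyD (by rwa [← Fin.ext (h.trans hyn.symm)])
        omega
      have := h1 C y D (by omega) hCn hDn
      simpa using this
    obtain ⟨m, D, rfl, hm⟩ := List.eq_append_cons_of_mem hyD
    have hmn : ∀ x ∈ m, (x : ℕ) < n := fun x hx => by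
      have := hu x (by simp [hx])
      have : (x : ℕ) ≠ n := fun h => hm (by rwa [← Fin.ext (h.trans hyn.symm)])
      omega
    -- Between the first two occurrences of `y` the outer induction leaves at most one letter `x`
    -- adjacent to `y`. If there is none, the two occurrences become neighbours and `dup` applies.
    -- Otherwise the far letters are moved aside, and `y x y` is obtained from `x y x`, in a word
    -- with one occurrence of `y` fewer.
    have key := ih (A ++ (C ++ [y])) m (y :: (D ++ B)) hmn (fun v hv => ?_) (fun v x v' hx hv hv' => ?_)
    · simpa using key
    · have h2 := (move y v (fun x hx => by have := hv x hx; omega) (A ++ C) (y :: (D ++ B))).2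
        (by have := dup (A ++ (C ++ v)) (D ++ B) y; simpa using this)
      simpa using h2
    · have h3 : Q (A ++ ((C ++ (v ++ x :: y :: x :: (v' ++ D))) ++ B)) := by
        refine ihc _ ?_ _ ?_ rfl
        · rw [← hc]
          have e1 : ¬ (x : ℕ) = n := by omega
          have e2 : ∀ l : List (Fin N), (∀ z ∈ l, (z : ℕ) + 1 < n) →
              l.countP (fun z : Fin N => decide ((z : ℕ) = n)) = 0 := fun l hl => by
            rw [List.countP_eq_zero]
            intro z hz
            have := hl z hz
            simp; omega
          simp only [List.countP_append, List.countP_cons, decide_eq_true_eq, e1, hyn, e2 v hv, e2 v' hv', if_true,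
            if_false]
          omega
        · intro z hz
          simp only [List.mem_append, List.mem_cons] at hz
          rcases hz with h | h | rfl | rfl | rfl | h | h
          · exact hu z (by simp [h])
          · have := hv z h; omega
          · omega
          · omega
          · omega
          · have := hv' z h; omega
          · exact hu z (by simp [h])
      have h4 := braid (A ++ (C ++ v)) (v' ++ (D ++ B)) x y (by omega) (by simpa using h3)
      have h5 := (move y v' (fun z hz => by have := hv' z hz; omega) (A ++ (C ++ (v ++ [y, x])))
        (D ++ B)).1 (by simpa using h4)
      have h6 := (move y v (fun z hz => by have := hv z hz; omega) (A ++ C)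
        (x :: (v' ++ y :: (D ++ B)))).2 (by simpa using h5)
      simpa using h6

/-! ### The top coefficient in terms of letter counts -/

/-- The sign of the leading term contributed by a generator that occurs `p` times while its inverse
occurs `q` times. -/
def signCoeff : ℕ → ℕ → ℤ
  | 0, 0 => 0
  | _ + 1, 0 => 1
  | 0, q + 1 => (-1) ^ q
  | _ + 1, _ + 1 => 0

/-- This recursion is the skein relation for one generator; together with the values for a generator
that does not occur or occurs once positively it determines the coefficients. -/
theorem signCoeff_skein (p q : ℕ) :
    signCoeff (p + 1) q - signCoeff p (q + 1) = signCoeff p q := by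
  cases p <;> cases q <;> simp [signCoeff, pow_succ]

/-- The coefficient of the top possible degree in the Conway polynomial of a closed braid. -/
def topCoeff {N : ℕ} (w : BraidWord N) : ℤ :=
  ∏ i, signCoeff (w.count (i, true)) (w.count (i, false))

theorem topCoeff_perm {N : ℕ} {w w' : BraidWord N} (h : w.Perm w') : topCoeff w = topCoeff w' :=
  Finset.prod_congr rfl fun i _ => by rw [h.count_eq, h.count_eq]

theorem topCoeff_eq_zero {N : ℕ} {w : BraidWord N} {i : Fin N}
    (h : signCoeff (w.count (i, true)) (w.count (i, false)) = 0) : topCoeff w = 0 :=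
  Finset.prod_eq_zero (Finset.mem_univ i) h

theorem topCoeff_eq_zero_of_both {N : ℕ} {w : BraidWord N} {i : Fin N} (h : (i, true) ∈ w)
    (h' : (i, false) ∈ w) : topCoeff w = 0 := by
  refine topCoeff_eq_zero (i := i) ?_
  obtain ⟨p, hp⟩ := Nat.exists_eq_succ_of_ne_zero (List.count_pos_iff.2 h).ne'
  obtain ⟨q, hq⟩ := Nat.exists_eq_succ_of_ne_zero (List.count_pos_iff.2 h').ne'
  rw [hp, hq]
  rfl

/-- Only the factor of the generator `i` depends on the letter in question. -/
theorem topCoeff_skein {N : ℕ} (A B : BraidWord N) (i : Fin N) :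
    topCoeff (A ++ (i, true) :: B) - topCoeff (A ++ (i, false) :: B) = topCoeff (A ++ B) := by
  unfold topCoeff
  rw [← Finset.mul_prod_erase Finset.univ _ (Finset.mem_univ i),
    ← Finset.mul_prod_erase Finset.univ _ (Finset.mem_univ i),
    ← Finset.mul_prod_erase Finset.univ _ (Finset.mem_univ i)]
  have h : ∀ b, ∏ x ∈ Finset.univ.erase i, signCoeff ((A ++ (i, b) :: B).count (x, true))
      ((A ++ (i, b) :: B).count (x, false)) =
      ∏ x ∈ Finset.univ.erase i, signCoeff ((A ++ B).count (x, true)) ((A ++ B).count (x, false)) := by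
    intro b
    refine Finset.prod_congr rfl fun x hx => ?_
    have hne : ∀ c, ((i, b) == (x, c)) = false := fun c =>
      beq_false_of_ne fun h => (Finset.mem_erase.1 hx).1 (Prod.ext_iff.1 h).1.symm
    simp only [List.count_append, List.count_cons, hne]
    simp
  rw [h, h, ← sub_mul,
    ← signCoeff_skein ((A ++ B).count (i, true)) ((A ++ B).count (i, false))]
  congr 2 <;> simp [List.count_append] <;> ring_nf

theorem sum_count_fst {N : ℕ} (w : BraidWord N) :
    ∑ i, (w.count (i, true) + w.count (i, false)) = w.length := by
  induction w with
  | nil => simp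
  | cons g w ih =>
    rw [List.length_cons, ← ih, ← Finset.sum_erase_add _ _ (Finset.mem_univ g.1),
      ← Finset.sum_erase_add Finset.univ (fun i => w.count (i, true) + _) (Finset.mem_univ g.1),
      add_assoc]
    congr 1
    · refine Finset.sum_congr rfl fun x hx => ?_
      have hne : ∀ c, (g == (x, c)) = false := fun c =>
        beq_false_of_ne fun h => (Finset.mem_erase.1 hx).1 (Prod.ext_iff.1 h).1.symm
      simp [List.count_cons, hne]
    · obtain ⟨i, b⟩ := g
      cases b <;> simp <;> ring

/-- With fewer letters than generators some generator is missing and contributes zero. -/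
theorem topCoeff_short {N : ℕ} {w : BraidWord N} (h : w.length < N) : topCoeff w = 0 := by
  by_contra h0
  have h1 : ∀ i, 1 ≤ w.count (i, true) + w.count (i, false) := fun i => by
    by_contra h2
    have e1 : w.count (i, true) = 0 := by omega
    have e2 : w.count (i, false) = 0 := by omega
    exact h0 (topCoeff_eq_zero (i := i) (by rw [e1, e2]; rfl))
  have h2 := Finset.sum_le_sum fun i (_ : i ∈ (Finset.univ : Finset (Fin N))) => h1 i
  rw [sum_count_fst] at h2
  simp at h2
  omega

theorem count_liftWord {N : ℕ} (w : BraidWord N) (i : Fin N) (b : Bool) :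
    (liftWord w).count (i.castSucc, b) = w.count (i, b) :=
  List.count_map_of_injective w (fun g : Fin N × Bool => (g.1.castSucc, g.2))
    (fun g h hgh => by
      simp only [Prod.mk.injEq, Fin.castSucc_inj] at hgh
      exact Prod.ext hgh.1 hgh.2) (i, b)

theorem last_notMem_liftWord {N : ℕ} (w : BraidWord N) (b : Bool) :
    (Fin.last N, b) ∉ liftWord w := by
  intro h
  obtain ⟨g, -, h⟩ := List.mem_map.1 h
  exact (Fin.castSucc_lt_last g.1).ne (Prod.ext_iff.1 h).1

/-- The last generator does not occur. This matches the vanishing of the Conway polynomial of a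
split closure. -/
theorem topCoeff_lift {N : ℕ} (w : BraidWord N) : topCoeff (liftWord w) = 0 :=
  topCoeff_eq_zero (i := Fin.last N) (by
    rw [List.count_eq_zero_of_not_mem (last_notMem_liftWord w _),
      List.count_eq_zero_of_not_mem (last_notMem_liftWord w _)]
    rfl)

theorem topCoeff_stabilize {N : ℕ} (w : BraidWord N) :
    topCoeff (liftWord w ++ [(Fin.last N, true)]) = topCoeff w := by
  unfold topCoeff
  rw [Fin.prod_univ_castSucc]
  have h : signCoeff ((liftWord w ++ [(Fin.last N, true)]).count (Fin.last N, true))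
      ((liftWord w ++ [(Fin.last N, true)]).count (Fin.last N, false)) = 1 := by
    rw [List.count_append, List.count_append,
      List.count_eq_zero_of_not_mem (last_notMem_liftWord w _),
      List.count_eq_zero_of_not_mem (last_notMem_liftWord w _)]
    simp [signCoeff]
  rw [h, mul_one]
  refine Finset.prod_congr rfl fun i _ => ?_
  have hne : ∀ b c : Bool, ((Fin.last N, b) == (i.castSucc, c)) = false := fun b c =>
    beq_false_of_ne fun h => (Fin.castSucc_lt_last i).ne (Prod.ext_iff.1 h).1.symm
  simp only [List.count_append, count_liftWord, List.count_cons, hne]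
  simp

theorem exists_liftWord {N : ℕ} {w : BraidWord (N + 1)} (h : ∀ g ∈ w, (g.1 : ℕ) < N) :
    ∃ v : BraidWord N, liftWord v = w := by
  induction w with
  | nil => exact ⟨[], rfl⟩
  | cons g w ih =>
    obtain ⟨v, rfl⟩ := ih fun g hg => h g (List.mem_cons_of_mem _ hg)
    exact ⟨(⟨g.1, h g List.mem_cons_self⟩, g.2) :: v, rfl⟩

theorem length_liftWord {N : ℕ} (w : BraidWord N) : (liftWord w).length = w.length :=
  List.length_map _

/-! ### The degree of the Conway polynomial of a closed braid -/

theorem cl_congr {N : ℕ} {u v : BraidWord N} (h : ev u = ev v) (A B : BraidWord N) :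
    cl (A ++ (u ++ B)) = cl (A ++ (v ++ B)) := by
  rw [← tr_ev, ← tr_ev, ev_append, ev_append, ev_append, ev_append, h]

theorem cl_rotate {N : ℕ} (A B : BraidWord N) : cl (A ++ B) = cl (B ++ A) := by
  rw [← tr_ev, ← tr_ev, ev_append, ev_append, tr_mul_comm]

/-- The polynomial `p` has degree at most `L - N`, with coefficient `a` in that degree. -/
def TopTerm (p : ℤ[X]) (N L : ℕ) (a : ℤ) : Prop :=
  ∀ d, (L < d + N → p.coeff d = 0) ∧ (L = d + N → p.coeff d = a)

/-- Multiplication by `X` shifts the top term of the smoothed link into the degree where those of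
`p` and `q` are compared. The hypothesis `hc` covers degree zero, where `X * r` has no coefficient.
-/
theorem topTerm_skein {p q r : ℤ[X]} {N L : ℕ} {a b c : ℤ} (h : p - q = X * r) (habc : a - b = c)
    (h0 : TopTerm r N L c) (hc : L < N → c = 0) : TopTerm p N (L + 1) a ↔ TopTerm q N (L + 1) b := by
  have e : ∀ d, (L + 1 < d + N → p.coeff d - q.coeff d = 0) ∧
      (L + 1 = d + N → p.coeff d - q.coeff d = c) := by
    intro d
    rw [← coeff_sub, h]
    cases d with
    | zero =>
      rw [mul_coeff_zero, coeff_X_zero, zero_mul]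
      exact ⟨fun _ => rfl, fun h => (hc (by omega)).symm⟩
    | succ d =>
      rw [coeff_X_mul]
      exact ⟨fun h => (h0 d).1 (by omega), fun h => (h0 d).2 (by omega)⟩
  constructor
  · refine fun hp d => ⟨fun hd => ?_, fun hd => ?_⟩
    · linarith [(e d).1 hd, (hp d).1 hd]
    · linarith [(e d).2 hd, (hp d).2 hd]
  · refine fun hp d => ⟨fun hd => ?_, fun hd => ?_⟩
    · linarith [(e d).1 hd, (hp d).1 hd]
    · linarith [(e d).2 hd, (hp d).2 hd]

/-- Once the word without the letter is settled, the claim does not depend on the sign of that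
letter. -/
theorem topTerm_skein_cl {nabla : Link → ℤ[X]} (hn : IsConwayPolynomial nabla) {N : ℕ}
    (A B : BraidWord N) (i : Fin N)
    (h0 : TopTerm (nabla (cl (A ++ B))) N (A ++ B).length (topCoeff (A ++ B))) (b c : Bool)
    (h : TopTerm (nabla (cl (A ++ (i, b) :: B))) N (A ++ (i, b) :: B).length
      (topCoeff (A ++ (i, b) :: B))) :
    TopTerm (nabla (cl (A ++ (i, c) :: B))) N (A ++ (i, c) :: B).length
      (topCoeff (A ++ (i, c) :: B)) := by
  have hl : ∀ b, (A ++ (i, b) :: B).length = (A ++ B).length + 1 := fun b => by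
    simp only [List.length_append, List.length_cons]; omega
  rw [hl] at h ⊢
  have key := topTerm_skein (cl_skein hn A B i) (topCoeff_skein A B i) h0 topCoeff_short
  cases b <;> cases c
  · exact h
  · exact key.2 h
  · exact key.1 h
  · exact h

/-- The degree and the leading coefficient of the Conway polynomial of a closed braid. -/
theorem topTerm_cl {nabla : Link → ℤ[X]} (hn : IsConwayPolynomial nabla) {N : ℕ}
    (w : BraidWord N) : TopTerm (nabla (cl w)) N w.length (topCoeff w) := by
  obtain ⟨L, hL⟩ : ∃ L, w.length = L := ⟨_, rfl⟩
  induction L using Nat.strong_induction_on generalizing N w with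
  | _ L ih =>
  -- Words with the same underlying generators are equivalent for the claim: the signs are changed
  -- one at a time, the smoothed words being shorter.
  have flip : ∀ w w' : BraidWord N, w.map Prod.fst = w'.map Prod.fst → ∀ A : BraidWord N,
      (A ++ w).length = L → TopTerm (nabla (cl (A ++ w))) N (A ++ w).length (topCoeff (A ++ w)) →
      TopTerm (nabla (cl (A ++ w'))) N (A ++ w').length (topCoeff (A ++ w')) := by
    intro w
    induction w with
    | nil =>
      intro w' hw A _ h
      obtain rfl : w' = [] := by simpa using hw.symm
      exact h
    | cons g w ihw =>
      intro w' hw A hA h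
      obtain ⟨g', w', rfl⟩ : ∃ g' v, w' = g' :: v := List.exists_cons_of_ne_nil (by
        rintro rfl; simp at hw)
      obtain ⟨i, b⟩ := g
      obtain ⟨i', c⟩ := g'
      simp only [List.map_cons, List.cons.injEq] at hw
      obtain ⟨rfl, hw⟩ := hw
      have h1 := ihw w' hw (A ++ [(i, c)])
      simp only [List.append_assoc, List.singleton_append] at h1
      refine h1 (by rw [← hA]; simp) (topTerm_skein_cl hn A w i (ih _ ?_ _ rfl) b c h)
      rw [← hA]
      simp
  -- The claim for all sign choices on a given sequence of generators; by `flip` one choice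
  -- suffices.
  let Q : List (Fin N) → Prop := fun v => v.length = L → ∀ w : BraidWord N, w.map Prod.fst = v →
    TopTerm (nabla (cl w)) N L (topCoeff w)
  have hQ : ∀ (w : BraidWord N),
      (w.length = L → TopTerm (nabla (cl w)) N w.length (topCoeff w)) → Q (w.map Prod.fst) := by
    intro w hw hl w' hw'
    rw [List.length_map] at hl
    have h1 := flip w w' hw'.symm [] hl (hw hl)
    have h2 : w'.length = L := by rw [← hl, ← List.length_map Prod.fst, hw', List.length_map]
    simpa [h2] using h1
  let pos : List (Fin N) → BraidWord N := fun v => v.map fun i => (i, true)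
  have hpos : ∀ v, (pos v).map Prod.fst = v := fun v => by simp [pos, Function.comp_def]
  -- A relation in `Braids N` between subwords with suitable signs transfers the claim between their
  -- underlying sequences, provided the top coefficients agree.
  have transfer : ∀ (A B : List (Fin N)) (u v : BraidWord N), ev u = ev v →
      u.length = v.length → topCoeff (pos A ++ (u ++ pos B)) = topCoeff (pos A ++ (v ++ pos B)) →
      Q (A ++ (u.map Prod.fst ++ B)) → Q (A ++ (v.map Prod.fst ++ B)) := by
    intro A B u v huv hl htop h
    have h1 := hQ (pos A ++ (v ++ pos B)) fun hlen => by
      have h2 := h (by simpa [pos, hl] using hlen) (pos A ++ (u ++ pos B)) (by simp [hpos])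
      rw [hlen, ← cl_congr huv, ← htop]
      exact h2
    simpa [hpos] using h1
  have main := word_induction (Q := Q) ?_ ?_ ?_ N [] (w.map Prod.fst) [] (fun x _ => x.2) ?_ ?_
  · rw [List.append_nil, List.nil_append] at main
    rw [hL]
    exact main (by rw [List.length_map, hL]) w rfl
  · intro A B i j hij
    have hp : ∀ A B, topCoeff (pos A ++ ([(i, true), (j, true)] ++ pos B)) =
        topCoeff (pos A ++ ([(j, true), (i, true)] ++ pos B)) := fun A B =>
      topCoeff_perm (List.Perm.append_left _ ((List.Perm.swap _ _ _).append_right _))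
    exact ⟨transfer A B [(i, true), (j, true)] [(j, true), (i, true)] (ev_comm hij) rfl (hp A B),
      transfer A B [(j, true), (i, true)] [(i, true), (j, true)] (ev_comm hij).symm rfl
        (hp A B).symm⟩
  · intro A B i j hij
    -- The braid relation is used in the form σ_i σ_j σ_i⁻¹ = σ_j⁻¹ σ_i σ_j. On the left `i` occurs
    -- with both signs and on the right `j` does, so both top coefficients vanish; with all signs
    -- positive the letter counts could give different values.
    refine transfer A B [(i, true), (j, true), (i, false)] [(j, false), (i, true), (j, true)] ?_ rfl
      ?_
    · have h := ev_braid hij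
      change ev [(i, true)] * (ev [(j, true)] * (ev [(i, true)])⁻¹) =
        (ev [(j, true)])⁻¹ * (ev [(i, true)] * ev [(j, true)])
      rw [eq_inv_mul_iff_mul_eq, ← mul_assoc, ← mul_assoc, ← h, mul_inv_cancel_right]
    · rw [topCoeff_eq_zero_of_both (i := i) (by simp) (by simp),
        topCoeff_eq_zero_of_both (i := j) (by simp) (by simp)]
  · intro A B i
    -- With opposite signs the two letters cancel, which lowers the degree bound by two, in
    -- accordance with a vanishing top coefficient.
    have h1 := hQ (pos A ++ (i, true) :: (i, false) :: pos B) fun hlen => by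
      have h2 := ih (pos A ++ pos B).length (by rw [← hlen]; simp) (pos A ++ pos B) rfl
      have h3 := cl_cancel (pos A) (pos B) i true
      rw [Bool.not_true] at h3
      rw [h3, topCoeff_eq_zero_of_both (i := i) (by simp) (by simp)]
      have h4 : (pos A ++ (i, true) :: (i, false) :: pos B).length =
        (pos A ++ pos B).length + 2 := by simp; omega
      exact fun d => ⟨fun hd => (h2 d).1 (by omega), fun hd => (h2 d).1 (by omega)⟩
    simpa [hpos] using h1
  · intro v hv
    have h1 := hQ (pos v) fun hlen => by
      cases N with
      | zero =>
        have h0 : pos v = [] := List.eq_nil_iff_forall_not_mem.2 fun g _ => g.1.elim0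
        rw [h0, conway_cl_nil hn]
        intro d
        rw [coeff_one]
        refine ⟨fun hd => if_neg (by simp at hd; omega), fun hd => ?_⟩
        rw [if_pos (by simpa using hd.symm)]
        simp [topCoeff]
      | succ M =>
        obtain ⟨v', hv'⟩ := exists_liftWord (w := pos v) (by
          intro g hg
          obtain ⟨x, hx, rfl⟩ := List.mem_map.1 hg
          have := hv x hx
          simpa using this)
        rw [← hv', topCoeff_lift]
        -- Both signs of the last generator give stabilizations of the same closure, so `X` times
        -- the polynomial of the split closure is zero.
        have h2 := cl_skein hn (liftWord v') [] (Fin.last M)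
        rw [cl_stabilize, cl_stabilize, sub_self, List.append_nil] at h2
        rw [(mul_eq_zero.1 h2.symm).resolve_left X_ne_zero]
        exact fun d => ⟨fun _ => coeff_zero d, fun _ => coeff_zero d⟩
    simpa [hpos] using h1
  · intro v y v' hy hv hv'
    cases N with
    | zero => exact y.elim0
    | succ M =>
    have h1 := hQ (pos v ++ (y, true) :: pos v') fun hlen => by
      obtain rfl : y = Fin.last M := Fin.ext (by simpa using hy)
      obtain ⟨u, hu⟩ := exists_liftWord (w := pos v' ++ pos v) (by
        intro g hg
        rw [List.mem_append] at hg
        rcases hg with hg | hg <;> obtain ⟨x, hx, rfl⟩ := List.mem_map.1 hg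
        · have := hv' x hx; simpa using this
        · have := hv x hx; simpa using this)
      -- Rotation brings the single last generator to the end, and destabilization lowers the number
      -- of letters and of strands by one each, so the difference is unchanged.
      have e1 : cl (pos v ++ (Fin.last M, true) :: pos v') = cl u := by
        rw [List.append_cons, cl_rotate, ← List.append_assoc, ← hu, cl_stabilize]
      have e2 : topCoeff (pos v ++ (Fin.last M, true) :: pos v') = topCoeff u := by
        rw [← topCoeff_stabilize u, hu]
        refine topCoeff_perm ?_
        rw [List.append_assoc, List.append_cons]
        exact List.perm_append_comm.trans (by simp)
      have e3 : (pos v ++ (Fin.last M, true) :: pos v').length = u.length + 1 := by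
        rw [← length_liftWord u, hu]; simp; omega
      have h2 := ih u.length (by omega) u rfl
      rw [e1, e2, e3]
      exact fun d => ⟨fun hd => (h2 d).1 (by omega), fun hd => (h2 d).2 (by omega)⟩
    simpa [hpos] using h1

/-- A homogeneous braid word on `N + 1` strands whose closure has degree `k` has at most `k + N`
letters. -/
theorem length_le_of_homogeneous {nabla : Link → ℤ[X]} (hn : IsConwayPolynomial nabla) {N k : ℕ}
    {w : BraidWord N} (hw : w.Homogeneous) (hk : (nabla (cl w)).degree = (k : WithBot ℕ)) :
    w.length ≤ k + N := by
  by_contra! hlt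
  have h := (topTerm_cl hn w (w.length - N)).2 (by omega)
  -- Beyond degree `k` the coefficient is zero, but in degree `w.length - N` it is a product of
  -- signs.
  rw [coeff_eq_zero_of_degree_lt (by rw [hk]; exact_mod_cast (by omega))] at h
  refine Finset.prod_ne_zero_iff.2 (fun i _ => ?_) h.symm
  by_cases hi : (i, true) ∈ w
  · obtain ⟨p, hp⟩ := Nat.exists_eq_succ_of_ne_zero (List.count_pos_iff.2 hi).ne'
    rw [List.count_eq_zero_of_not_mem ((hw i).1 hi), hp]
    exact one_ne_zero
  · have hi' : (i, false) ∈ w := by_contra fun h => hi ((hw i).2 h)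
    obtain ⟨q, hq⟩ := Nat.exists_eq_succ_of_ne_zero (List.count_pos_iff.2 hi').ne'
    rw [List.count_eq_zero_of_not_mem hi, hq]
    exact pow_ne_zero _ (by norm_num)

/-! ### Removing a generator that occurs only once -/

section
variable {G : Type*} [Group G]

/-- The product `t (i + d - 1) * ⋯ * t i`. -/
def desc (t : ℕ → G) (i : ℕ) : ℕ → G
  | 0 => 1
  | d + 1 => t (i + d) * desc t i d

theorem desc_succ (t : ℕ → G) (i d : ℕ) : desc t i (d + 1) = t (i + d) * desc t i d := rfl

theorem desc_succ_right (t : ℕ → G) (i d : ℕ) : desc t i (d + 1) = desc t (i + 1) d * t i := by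
  induction d with
  | zero => simp [desc]
  | succ d ih => rw [desc_succ, ih, desc_succ, mul_assoc, show i + (d + 1) = i + 1 + d by omega]

theorem desc_commute {t : ℕ → G} {i d : ℕ} {x : G}
    (h : ∀ j, i ≤ j → j < i + d → Commute (t j) x) : Commute (desc t i d) x := by
  induction d with
  | zero => exact Commute.one_left x
  | succ d ih =>
    exact (h _ (by omega) (by omega)).mul_left (ih fun j hj hj' => h j hj (by omega))

variable {t : ℕ → G} {M : ℕ}
  (hb : ∀ j, j + 1 < M → t j * t (j + 1) * t j = t (j + 1) * t j * t (j + 1))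
  (hc : ∀ j k, j + 2 ≤ k → k < M → Commute (t j) (t k))
include hb hc

/-- Moving a factor `t (j + 1)` through the descending product lowers its index by one: it commutes
with all factors except the neighbours, where the braid relation applies. -/
theorem desc_semiconj {i d j : ℕ} (hij : i ≤ j) (hj : j < i + d) (hM : i + d < M) :
    SemiconjBy (desc t i (d + 1)) (t (j + 1)) (t j) := by
  induction d with
  | zero => omega
  | succ d ih =>
    rw [desc_succ]
    rcases Nat.lt_succ_iff_lt_or_eq.1 (show j < i + d + 1 by omega) with h | h
    · exact SemiconjBy.mul_left (hc j _ (by omega) hM).symm (ih h (by omega))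
    · subst h
      have h1 : Commute (desc t i d) (t (i + d + 1)) :=
        desc_commute fun j _ hj => hc j _ (by omega) hM
      have h2 := hb (i + d) (by omega)
      unfold SemiconjBy
      rw [desc_succ, ← add_assoc, mul_assoc, mul_assoc, h1.eq, ← mul_assoc, ← mul_assoc, ← h2]
      simp only [mul_assoc]

theorem desc_semiconj_desc {i d e : ℕ} (he : e ≤ d) (hM : i + d < M) :
    SemiconjBy (desc t i (d + 1)) (desc t (i + 1) e) (desc t i e) := by
  induction e with
  | zero => exact SemiconjBy.one_right _
  | succ e ih =>
    rw [desc_succ, desc_succ, show i + 1 + e = i + e + 1 by omega]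
    exact (desc_semiconj hb hc (by omega) (by omega) hM).mul_right (ih (by omega))

/-- The same band generator in two expressions: as a conjugate of `t i` and as a conjugate of `t (i
+ d)`. It exchanges a single letter `i` for a single letter of the last index. -/
theorem desc_conj {i d : ℕ} (hM : i + d < M) :
    desc t (i + 1) d * t i * (desc t (i + 1) d)⁻¹ = (desc t i d)⁻¹ * t (i + d) * desc t i d := by
  have h := (desc_semiconj_desc hb hc le_rfl hM).eq
  rw [mul_inv_eq_iff_eq_mul, mul_assoc, mul_assoc, eq_inv_mul_iff_mul_eq, ← desc_succ_right, ← h,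
    desc_succ, mul_assoc]

end

section
variable {N : ℕ}

theorem clFree_stabilize (x : FreeGroup (Fin N)) (b : Bool) :
    clFree (FreeGroup.map Fin.castSucc x * FreeGroup.mk [(Fin.last N, b)]) = clFree x := by
  obtain ⟨w, rfl⟩ := Quot.exists_rep x
  exact cl_stabilize w b

/-- The word with the generators from `i` on renumbered to make room for a new generator `i`. -/
def skipWord (i : Fin (N + 1)) (w : BraidWord N) : BraidWord (N + 1) :=
  w.map fun g => (i.succAbove g.1, g.2)

/-- The word with the generators below `i` moved in front of the other generators. -/
def sortWord (i : Fin (N + 1)) (w : BraidWord N) : BraidWord N :=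
  w.filter (fun g => g.1.castSucc < i) ++ w.filter fun g => ¬g.1.castSucc < i

theorem ev_map_commute {f f' : Fin N → Fin (N + 1)} {u v : BraidWord N}
    (h : ∀ g ∈ u, ∀ g' ∈ v, (f g.1 : ℕ) + 2 ≤ f' g'.1) :
    Commute (ev (u.map fun g => (f g.1, g.2))) (ev (v.map fun g => (f' g.1, g.2))) := by
  induction u with
  | nil => exact Commute.one_left _
  | cons g u ih =>
    rw [List.map_cons, ev_cons]
    refine Commute.mul_left ?_ (ih fun g hg => h g (List.mem_cons_of_mem _ hg))
    have hg := h g List.mem_cons_self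
    clear h ih
    induction v with
    | nil => exact Commute.one_right _
    | cons g' v ih =>
      rw [List.map_cons, ev_cons]
      exact Commute.mul_right (ev_comm_sign (hg g' List.mem_cons_self) _ _)
        (ih fun g hg' => hg g (List.mem_cons_of_mem _ hg'))

/-- Generators below `i` commute with those above `i`, so a word without `i` splits into a low and a
high part. -/
theorem ev_skipWord (i : Fin (N + 1)) (w : BraidWord N) :
    ev (skipWord i w) = ev (liftWord (w.filter fun g => g.1.castSucc < i)) *
      ev ((w.filter fun g => ¬g.1.castSucc < i).map fun g => (g.1.succ, g.2)) := by
  induction w with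
  | nil => rfl
  | cons g w ih =>
    rw [skipWord, List.map_cons, ev_cons]
    change _ * ev (skipWord i w) = _
    rw [ih]
    by_cases hg : g.1.castSucc < i
    · rw [List.filter_cons_of_pos (by simpa using hg), List.filter_cons_of_neg (by simpa using hg),
        Fin.succAbove_of_castSucc_lt _ _ hg, ← mul_assoc]
      rfl
    · rw [List.filter_cons_of_neg (by simpa using hg), List.filter_cons_of_pos (by simpa using hg),
        Fin.succAbove_of_le_castSucc _ _ (not_lt.1 hg), List.map_cons,
        ev_cons _ (List.map _ _), ← mul_assoc, ← mul_assoc]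
      congr 1
      refine (ev_map_commute (u := w.filter fun g => g.1.castSucc < i) (v := [g]) (f := Fin.castSucc)
        (f' := Fin.succ) ?_).symm.eq
      intro x hx y hy
      obtain rfl : y = g := by simpa using hy
      have hx := (List.mem_filter.1 hx).2
      simp only [decide_eq_true_eq, Fin.lt_def, Fin.val_castSucc, Fin.val_succ] at hx hg ⊢
      omega

/-- A single letter `i` joins the low part `U` to the high part, as in a connected sum. The high
part is a conjugate of `V`, its copy with all indices lowered by one, by the descending product from
the last index to `i`. By cyclic invariance the closure is that of `U V` times a conjugate of the
single letter, which `desc_conj` rewrites as `P⁻¹ * t N * P` with `P` free of the last generator.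
Thus one has the closure of `P U V P⁻¹` followed by the last generator, which destabilizes to that
of `U V`. -/
theorem cl_skipWord (i : Fin (N + 1)) (b : Bool) (w : BraidWord N) :
    cl ((i, b) :: skipWord i w) = cl (sortWord i w) := by
  obtain ⟨d, hd⟩ : ∃ d, (i : ℕ) + d = N := ⟨N - i, by omega⟩
  obtain ⟨u, hu⟩ : ∃ u, u = w.filter fun g => g.1.castSucc < i := ⟨_, rfl⟩
  obtain ⟨v, hv⟩ : ∃ v, v = w.filter fun g => ¬g.1.castSucc < i := ⟨_, rfl⟩
  -- All generators are taken with the sign `b` of the letter to be removed; indices out of range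
  -- get the harmless value `1`.
  let t : ℕ → Braids (N + 1) := fun j => if h : j < N + 1 then ev [(⟨j, h⟩, b)] else 1
  have ht : ∀ j : Fin (N + 1), t j = ev [(j, b)] := fun j => dif_pos j.2
  have hb : ∀ j, j + 1 < N + 1 → t j * t (j + 1) * t j = t (j + 1) * t j * t (j + 1) := by
    intro j hj
    have h := ev_braid_sign (i := ⟨j, by omega⟩) (j := ⟨j + 1, hj⟩) rfl b
    rwa [← ht, ← ht] at h
  have hc : ∀ j k, j + 2 ≤ k → k < N + 1 → Commute (t j) (t k) := by
    intro j k hjk hk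
    have h := ev_comm_sign (i := ⟨j, by omega⟩) (j := ⟨k, hk⟩) hjk b b
    rwa [← ht, ← ht] at h
  have hE : Commute (desc t (i + 1) d) (ev (liftWord u)) := by
    refine desc_commute fun j hj hj' => ?_
    have h := ht ⟨j, by omega⟩
    simp only at h
    rw [h]
    clear hv
    rw [hu]
    clear hu
    induction w with
    | nil => exact Commute.one_right _
    | cons g w ih =>
      by_cases hg : g.1.castSucc < i
      · rw [List.filter_cons_of_pos (by simpa using hg), liftWord, List.map_cons, ev_cons]
        refine Commute.mul_right (ev_comm_sign ?_ _ _).symm ih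
        simp only [Fin.lt_def, Fin.val_castSucc] at hg ⊢
        omega
      · rwa [List.filter_cons_of_neg (by simpa using hg)]
  have hD : SemiconjBy (desc t i (d + 1)) (ev (v.map fun g => (g.1.succ, g.2))) (ev (liftWord v)) := by
    clear hu
    rw [hv]
    clear hv
    induction w with
    | nil => exact SemiconjBy.one_right _
    | cons g w ih =>
      by_cases hg : g.1.castSucc < i
      · rwa [List.filter_cons_of_neg (by simpa using hg)]
      · rw [List.filter_cons_of_pos (by simpa using hg), liftWord, List.map_cons, List.map_cons,
          ev_cons, ev_cons (g.1.castSucc, g.2)]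
        refine SemiconjBy.mul_right ?_ ih
        have h := desc_semiconj hb hc (i := i) (d := d) (j := g.1)
          (by simpa [Fin.lt_def] using hg) (by omega) (by omega)
        have h1 := ht g.1.castSucc
        have h2 := ht g.1.succ
        rw [Fin.val_castSucc] at h1
        rw [Fin.val_succ] at h2
        rw [h1, h2] at h
        -- Letters of the high part may have the opposite sign; they are conjugated as inverses.
        have hf : ∀ i : Fin (N + 1), ev [(i, !b)] = (ev [(i, b)])⁻¹ := fun i => ev_not i b
        by_cases hgb : g.2 = b
        · rwa [hgb]
        · rw [show g.2 = !b by cases b <;> simpa using hgb, hf, hf]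
          exact h.inv_right
  -- The product with indices below `N` avoids the last generator, so it comes from the braids on
  -- one strand fewer, as destabilization requires.
  have hP : ∀ e, (i : ℕ) + e ≤ N → ∃ p : FreeGroup (Fin N),
      desc t i e = ((FreeGroup.map Fin.castSucc p : FreeGroup (Fin (N + 1))) : Braids (N + 1)) := by
    intro e
    induction e with
    | zero => exact fun _ => ⟨1, rfl⟩
    | succ e ih =>
      intro he
      obtain ⟨p, hp⟩ := ih (by omega)
      refine ⟨FreeGroup.mk [(⟨i + e, by omega⟩, b)] * p, ?_⟩
      rw [desc_succ, hp, map_mul]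
      have h := ht (⟨i + e, by omega⟩ : Fin N).castSucc
      simp only [Fin.val_castSucc] at h
      rw [h]
      rfl
  obtain ⟨p, hp⟩ := hP d hd.le
  have hconj := desc_conj hb hc (i := i) (d := d) (by omega)
  have hlast : t (i + d) = ev [(Fin.last N, b)] := by rw [hd]; exact ht (Fin.last N)
  have hV : ev (v.map fun g => (g.1.succ, g.2)) =
      (desc t i (d + 1))⁻¹ * ev (liftWord v) * desc t i (d + 1) := by
    rw [mul_assoc, ← hD.eq, inv_mul_cancel_left]
  have hUV : Commute (ev (liftWord u)) (ev (v.map fun g => (g.1.succ, g.2))) := by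
    refine ev_map_commute (f := Fin.castSucc) (f' := Fin.succ) fun x hx y hy => ?_
    rw [hu] at hx
    rw [hv] at hy
    have hx := (List.mem_filter.1 hx).2
    have hy := (List.mem_filter.1 hy).2
    simp only [decide_eq_true_eq, Fin.lt_def, Fin.val_castSucc, Fin.val_succ] at hx hy ⊢
    omega
  have e1 : tr (ev [(i, b)] * (ev (liftWord u) * ev (v.map fun g => (g.1.succ, g.2)))) =
      tr (ev (liftWord u) * ev (liftWord v) *
        (desc t (i + 1) d * t i * (desc t (i + 1) d)⁻¹)) := by
    rw [hUV.eq, ← mul_assoc, tr_mul_comm, hV, ← ht i, desc_succ_right, mul_inv_rev]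
    have h := hE.inv_left.eq
    rw [show ev (liftWord u) * (t i * ((t i)⁻¹ * (desc t (i + 1) d)⁻¹ * ev (liftWord v) *
      (desc t (i + 1) d * t i))) = ev (liftWord u) * (desc t (i + 1) d)⁻¹ * (ev (liftWord v) *
      (desc t (i + 1) d * t i)) by group, ← h, mul_assoc, tr_mul_comm]
    simp only [mul_assoc]
  rw [← tr_ev, ev_cons, ev_skipWord, ← hu, ← hv, e1, hconj, ← tr_ev, sortWord, ← hu, ← hv,
    ← mul_assoc, tr_mul_comm, hlast, hp]
  have e2 := clFree_stabilize (p * (FreeGroup.mk (u ++ v)) * p⁻¹) b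
  rw [clFree_conj] at e2
  refine Eq.trans ?_ e2
  rw [map_mul, map_mul, map_inv, ← FreeGroup.mul_mk, map_mul]
  simp only [mul_assoc]
  rfl

end

/-! ### Finiteness -/

theorem mem_sortWord {N : ℕ} {i : Fin (N + 1)} {w : BraidWord N} {g : Fin N × Bool} :
    g ∈ sortWord i w ↔ g ∈ w := by
  by_cases h : g.1.castSucc < i <;> simp [sortWord, h, not_lt.1]

theorem exists_skipWord {N : ℕ} {i : Fin (N + 1)} {w : BraidWord (N + 1)}
    (h : ∀ b, (i, b) ∉ w) : ∃ v : BraidWord N, skipWord i v = w := by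
  induction w with
  | nil => exact ⟨[], rfl⟩
  | cons g w ih =>
    obtain ⟨v, rfl⟩ := ih fun b hb => h b (List.mem_cons_of_mem _ hb)
    obtain ⟨j, hj⟩ := Fin.exists_succAbove_eq (x := g.1) (y := i) fun hg =>
      h g.2 (by rw [← hg]; exact List.mem_cons_self)
    exact ⟨(j, g.2) :: v, by rw [skipWord, List.map_cons]; simp only [hj]; rfl⟩

theorem mem_skipWord {N : ℕ} {i : Fin (N + 1)} {w : BraidWord N} {j : Fin N} {b : Bool} :
    (i.succAbove j, b) ∈ skipWord i w ↔ (j, b) ∈ w := by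
  constructor
  · intro h
    obtain ⟨g, hg, h⟩ := List.mem_map.1 h
    simp only [Prod.mk.injEq, Fin.succAbove_right_inj] at h
    obtain ⟨rfl, rfl⟩ := h
    exact hg
  · exact fun h => List.mem_map.2 ⟨_, h, rfl⟩

/-- The closure of a homogeneous word is the closure of a homogeneous word in which every generator
occurs at least twice. -/
theorem exists_homogeneous_two_le {N : ℕ} (w : BraidWord N) (hw : w.Homogeneous) :
    ∃ (M : ℕ) (v : BraidWord M), v.Homogeneous ∧ cl v = cl w ∧
      ∀ i, 2 ≤ v.count (i, true) + v.count (i, false) := by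
  induction N with
  | zero => exact ⟨0, w, hw, rfl, fun i => i.elim0⟩
  | succ N ih =>
    by_cases h : ∀ i, 2 ≤ w.count (i, true) + w.count (i, false)
    · exact ⟨N + 1, w, hw, rfl, h⟩
    push Not at h
    obtain ⟨i, hi⟩ := h
    -- By homogeneity every generator occurs, so one that occurs less than twice occurs exactly
    -- once.
    obtain ⟨b, hb⟩ : ∃ b, (i, b) ∈ w := by
      by_cases h : (i, true) ∈ w
      · exact ⟨true, h⟩
      · exact ⟨false, by_contra fun h' => h ((hw i).2 h')⟩
    obtain ⟨A, C, rfl⟩ := List.append_of_mem hb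
    have hAC : ∀ c, (i, c) ∉ C ++ A := by
      intro c hc
      have h1 := List.count_pos_iff.2 hc
      rw [List.count_append] at h1
      cases b <;> cases c <;> simp at hi <;> omega
    obtain ⟨u, hu⟩ := exists_skipWord hAC
    obtain ⟨M, v, hv, hvu, h2⟩ := ih (sortWord i u) fun j => by
      rw [mem_sortWord, mem_sortWord, ← mem_skipWord (i := i), ← mem_skipWord (i := i), hu]
      have h3 := hw (i.succAbove j)
      have h4 : ∀ c d, ((i.succAbove j, c) : Fin (N + 1) × Bool) ≠ (i, d) := fun c d h =>
        Fin.succAbove_ne i j (Prod.ext_iff.1 h).1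
      simp only [List.mem_append, List.mem_cons, h4, false_or] at h3 ⊢
      rw [or_comm, h3, or_comm]
    refine ⟨M, v, hv, ?_, h2⟩
    -- The single letter is rotated to the front.
    rw [hvu, ← cl_skipWord i b, hu, cl_rotate A]
    rfl

end PLLink

theorem mainTheorem1 (k : ℕ) :
    {K : PLLink.Link | K.Homogeneous ∧ (PLLink.conway K).degree = (k : WithBot ℕ)}.Finite := by
  by_cases h : ∃ nabla : PLLink.Link → ℤ[X], PLLink.IsConwayPolynomial nabla
  swap
  -- Without a Conway polynomial the default value of `conway` is zero, whose degree is not `k`.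
  · refine Set.finite_empty.subset ?_
    rintro K ⟨-, hK⟩
    rw [PLLink.conway, dif_neg h, Pi.zero_apply, degree_zero] at hK
    exact absurd hK (WithBot.bot_ne_coe)
  have hn : PLLink.IsConwayPolynomial PLLink.conway := by
    rw [PLLink.conway, dif_pos h]
    exact h.choose_spec
  -- The finite set consists of the closures of words with at most `2 * k` letters on at most `k +
  -- 1` strands, and of the empty word on one strand, to which `braidClosure_eq_cl` does not apply.
  refine Set.Finite.subset (Set.Finite.insert (PLLink.braidClosure ([] : PLLink.BraidWord 0))
    (Set.Finite.biUnion (Set.finite_Iic k) fun N _ =>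
      (List.finite_length_le (Fin N × Bool) (2 * k)).image (PLLink.cl (N := N)))) ?_
  rintro _ ⟨⟨N, w, hw, rfl⟩, hk⟩
  by_cases hw0 : w = []
  · subst hw0
    cases N with
    | zero => exact Set.mem_insert _ _
    | succ N =>
      -- On more than one strand the empty word is not homogeneous.
      have := hw 0
      simp at this
  rw [PLLink.braidClosure_eq_cl hw0] at hk ⊢
  obtain ⟨M, v, hv, hvw, h2⟩ := PLLink.exists_homogeneous_two_le w hw
  rw [← hvw] at hk ⊢
  have h3 := PLLink.length_le_of_homogeneous hn hv hk
  -- Counting letters gives `2 * M ≤ v.length`; with `v.length ≤ k + M` this bounds `M` by `k` and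
  -- the length by `2 * k`.
  have h4 := Finset.sum_le_sum fun i (_ : i ∈ (Finset.univ : Finset (Fin M))) => h2 i
  rw [PLLink.sum_count_fst, Finset.sum_const, Finset.card_univ, Fintype.card_fin, smul_eq_mul] at h4
  refine Set.mem_insert_of_mem _ (Set.mem_biUnion (x := M) ?_ ⟨v, ?_, rfl⟩)
  · simp only [Set.mem_Iic]; omega
  · change v.length ≤ 2 * k
    omega
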